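/- **Setting.** Let $\mu$ be a nonzero finite measure on $\mathbb{R}$ and let $N=\sum_{i\ge1}\delta_{(T_i,\Delta_i)}$ be a Poisson point measure on $[0,\infty)\times\mathbb{R}$ with intensity $dt\,\mu(da)$: with $T_0=0$, the gaps $T_{i}-T_{i-1}$ are exponential with parameter $\mu(\mathbb{R})$, the amplitudes $\Delta_i$ have law $\nu=\mu/\mu(\mathbb{R})$, and all gaps and amplitudes are independent. Put $J_t=\#\{i\ge1:T_i\le t\}$. Let $q_0<q_1<\dots<q_{k+1}$ be real numbers and $I=\bigcup_{p=0}^{k}(q_p,q_{p+1})$. Fix a horizon $T\geq 0$ and let $S_t=S_t^x$, $0\le t\le T$, be the solution of $$S_t=x+\sum_{i=1}^{J_t}c(T_i,\Delta_i,S_{T_i-})+\int_0^t g(r,S_r)\,dr ,\qquad x\in\mathbb{R},$$ almost surely, simultaneously for all starting points $x$ (with $r\mapsto g(r,S_r)$ integrable on $[0,T]$). **Hypotheses.** 1. On $(0,T)\times I\times\mathbb{R}$ the function $c(t,a,x)$ is twice differentiable with bounded derivatives of first and second order; on $(0,T)\times\mathbb{R}$ the function $g(t,x)$ is differentiable in $(t,x)$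 with bounded first derivatives, and is twice differentiable in $x$ with bounded $\partial_x^2g$. There is a constant $K$ with $|c(t,a,x)|+|g(t,x)|\le K(1+|x|)$ for all $(t,a,x)\in(0,T)\times I\times\mathbb{R}$. 2. The law $\nu$ of $\Delta_i$ has the density $\mathbf 1_I(y)e^{\rho(y)}$, where $\rho$ is continuously differentiable and bounded on $I$, and $\mathbb{E}|\rho'(\Delta_i)|^m<\infty$ for all $m\in\mathbb{N}$. 3. There is $\varepsilon>0$ such that for all $(t,a,x)\in(0,T)\times I\times\mathbb{R}$: $|q(t,a,x)|\ge\varepsilon$, $|\partial_ac(t,a,x)|\ge\varepsilon$ and $|1+\partial_xc(t,a,x)|\ge\varepsilon$, where $q(t,a,x)=(\partial_tc+g\,\partial_xc)(t,a,x)+g(t,x)-g(t,x+c(t,a,x))$. **Notation.** For $0<u_1<\dots<u_n<T$ and $a\in\mathbb{R}^n$ let $s_t(u,a)$ be the solution of $s_t=x+\sum_{i:\,u_i\le t}c(u_i,a_i,s_{u_i-})+\int_0^tg(r,s_r)\,dr$, $0\le t\le T$. Fix $t\in[0,T]$ and $\alpha\in(0,\tfrac12)$. Let $v=(v_1,\dots,v_{2n})=(u_1,\dots,u_n,a_1,\dots,a_n)$,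 put $u_0=0$, $u_{n+1}=t$, and define, for $i=1,\dots,n$, $$\pi_i(v)=(u_{i+1}-u_i)^\alpha(u_i-u_{i-1})^\alpha\mathbf 1_{[u_{i-1},u_{i+1}]}(u_i),\quad \theta_i(v)=0,$$ $$\pi_{n+i}(v)=\sum_{p=0}^{k}(q_{p+1}-a_i)^\alpha(a_i-q_p)^\alpha\mathbf 1_{(q_p,q_{p+1})}(a_i),\quad \theta_{n+i}(v)=\rho'(a_i).$$ For functions $F,G$ of $v$ let $\langle DF,DG\rangle_\pi=\sum_{i=1}^{2n}\pi_i\,\partial_{v_i}F\,\partial_{v_i}G$, $\gamma_F=1/\langle DF,DF\rangle_\pi$ and $$LF=-\sum_{i=1}^{2n}\Big((\partial_{v_i}\pi_i+\pi_i\theta_i)\,\partial_{v_i}F+\pi_i\,\partial_{v_i}^2F\Big).$$ **Theorem.** Under these hypotheses, for every $x\in\mathbb{R}$, every $n\ge1$ and every continuously differentiable $\phi:\mathbb{R}\to\mathbb{R}$ of linear growth, both expectations below are of integrable random variables and $$\mathbb{E}\big(\phi'(S_t)\,\partial_xS_t\,\mathbf 1_{\{J_t=n\}}\big)=\mathbb{E}\big(\phi(S_t)\,H_n\,\mathbf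 1_{\{J_t=n\}}\big),$$ where, on $\{J_t=n\}$, $H_n$ is the value at $v=(T_1,\dots,T_n,\Delta_1,\dots,\Delta_n)$ of $$\partial_xs_t\,\gamma_{s_t}\,Ls_t-\gamma_{s_t}\,\langle Ds_t,D(\partial_xs_t)\rangle_\pi-\partial_xs_t\,\langle Ds_t,D\gamma_{s_t}\rangle_\pi .$$ -/

import Mathlib

open MeasureTheory ProbabilityTheory Set
open scoped Topology

namespace JumpIBP

noncomputable section

/-! ### The driving noise -/

/-- The marked point sequence `(T i, Δ i)`, `i ≥ 1`, of a Poisson point measure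
`N = ∑ δ_(T i, Δ i)` on `[0, ∞) × ℝ` with intensity `dt × μ(da)`, `0 < μ(ℝ) < ∞`:
with `T 0 = 0`, the gaps `T (i+1) - T i` are exponential with parameter `μ(ℝ)`, the marks
`Δ (i+1)` have law `μ / μ(ℝ)`, and all gaps and all marks are independent. (`Δ 0` is unused.) -/
structure IsMarkedPoisson {Ω : Type*} [MeasurableSpace Ω] (P : Measure Ω) (μ : Measure ℝ)
    (T Δ : ℕ → Ω → ℝ) : Prop where
  measurable_time : ∀ i, Measurable (T i)
  measurable_mark : ∀ i, Measurable (Δ i)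
  time_zero : ∀ ω, T 0 ω = 0
  gap_law : ∀ i, P.map (fun ω => T (i + 1) ω - T i ω) = expMeasure (μ.real univ)
  mark_law : ∀ i, P.map (Δ (i + 1)) = (μ univ)⁻¹ • μ
  indep : iIndepFun (fun k : ℕ ⊕ ℕ =>
    (Sum.elim (fun i ω => T (i + 1) ω - T i ω) (fun i => Δ (i + 1)) k : Ω → ℝ)) P

/-- The counting process `J_t = N([0, t] × ℝ)`: the number of `i ≥ 1` with `T i ≤ t`. -/
def jumpCount {Ω : Type*} (T : ℕ → Ω → ℝ) (t : ℝ) (ω : Ω) : ℕ :=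
  Set.ncard {i : ℕ | 1 ≤ i ∧ T i ω ≤ t}

/-! ### The jump equation, along a path and in its deterministic form -/

/-- On the horizon `[0, h]`, the path `S` solves
`S_r = x + ∑_{i=1}^{J_r} c(T_i, Δ_i, S_{T_i-}) + ∫_0^r g(v, S_v) dv`,
where `τ i`, `δ i`, `i ≥ 1`, are the jump times and amplitudes and `J` counts the jumps.
Integrability of the drift makes the right-hand side càdlàg, so the left limits exist. -/
structure IsJumpPath (c : ℝ → ℝ → ℝ → ℝ) (g : ℝ → ℝ → ℝ) (h x : ℝ) (J : ℝ → ℕ)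
    (τ δ : ℕ → ℝ) (S : ℝ → ℝ) : Prop where
  drift_integrable : IntervalIntegrable (fun r => g r (S r)) volume 0 h
  eq : ∀ r ∈ Icc 0 h, S r = x
    + ∑ i ∈ Finset.Icc 1 (J r), c (τ i) (δ i) (Function.leftLim S (τ i))
    + ∫ v in (0 : ℝ)..r, g v (S v)

/-- The deterministic equation with `n` jumps of amplitudes `a_i` at the times `u_i`:
`s_r = x + ∑_{u_i ≤ r} c(u_i, a_i, s_{u_i-}) + ∫_0^r g(v, s_v) dv` for `0 ≤ r ≤ h`. -/
structure IsDetPath (c : ℝ → ℝ → ℝ → ℝ) (g : ℝ → ℝ → ℝ) (h x : ℝ) {n : ℕ}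
    (u a : Fin n → ℝ) (s : ℝ → ℝ) : Prop where
  drift_integrable : IntervalIntegrable (fun r => g r (s r)) volume 0 h
  eq : ∀ r ∈ Icc 0 h, s r = x
    + ∑ i with u i ≤ r, c (u i) (a i) (Function.leftLim s (u i))
    + ∫ v in (0 : ℝ)..r, g v (s v)

/-- `s_t(u, a)`: the value at time `t` of the solution of the deterministic equation on `[0, h]`
started at `x`, as a function of `v = (u, a) ∈ ℝⁿ × ℝⁿ` (`Sum.inl` coordinates are the jump times,
`Sum.inr` coordinates are the amplitudes). -/
def detSol (c : ℝ → ℝ → ℝ → ℝ) (g : ℝ → ℝ → ℝ) (h t : ℝ) {n : ℕ} (x : ℝ)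
    (v : Fin n ⊕ Fin n → ℝ) : ℝ :=
  Classical.epsilon
    (fun s : ℝ → ℝ => IsDetPath c g h x (fun i => v (Sum.inl i)) (fun i => v (Sum.inr i)) s) t

/-- `∂_x s_t(u, a)`: the derivative with respect to the starting point. -/
def detSolX (c : ℝ → ℝ → ℝ → ℝ) (g : ℝ → ℝ → ℝ) (h t : ℝ) {n : ℕ} (x : ℝ)
    (v : Fin n ⊕ Fin n → ℝ) : ℝ :=
  deriv (fun y => detSol c g h t y v) x

/-! ### Differential calculus for functions of finitely many variables -/

section Calculus

variable {ι : Type*} [Fintype ι] [DecidableEq ι]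

/-- The partial derivative `∂_i f (v)`. -/
def pderiv (f : (ι → ℝ) → ℝ) (i : ι) (v : ι → ℝ) : ℝ :=
  deriv (fun y => f (Function.update v i y)) (v i)

/-- `⟨DF, DG⟩_π = ∑_i π_i ∂_i F ∂_i G`. -/
def carre (w : ι → (ι → ℝ) → ℝ) (F G : (ι → ℝ) → ℝ) (v : ι → ℝ) : ℝ :=
  ∑ i, w i v * pderiv F i v * pderiv G i v

/-- `γ_F = 1 / σ_F`, where `σ_F = ⟨DF, DF⟩_π`. -/
def invCov (w : ι → (ι → ℝ) → ℝ) (F : (ι → ℝ) → ℝ) (v : ι → ℝ) : ℝ :=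
  (carre w F F v)⁻¹

/-- `L F = - ∑_i ((π_i' + π_i ∂ ln p_i) ∂_i F + π_i ∂_i² F)`, where `π_i' = ∂_i π_i` and
`score i = ∂ ln p_i`. -/
def ouOp (w score : ι → (ι → ℝ) → ℝ) (F : (ι → ℝ) → ℝ) (v : ι → ℝ) : ℝ :=
  -∑ i, ((pderiv (w i) i v + w i v * score i v) * pderiv F i v
    + w i v * pderiv (pderiv F i) i v)

/-- `H(F, G) = G γ_F L F - γ_F ⟨DF, DG⟩_π - G ⟨DF, Dγ_F⟩_π`. -/
def malliavinWeight (w score : ι → (ι → ℝ) → ℝ) (F G : (ι → ℝ) → ℝ) (v : ι → ℝ) : ℝ :=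
  G v * invCov w F v * ouOp w score F v
    - invCov w F v * carre w F G v
    - G v * carre w F (invCov w F) v

end Calculus

/-! ### Weights and logarithmic derivatives of the mixed calculus -/

/-- `u_0 = 0, u_1, …, u_n, u_{n+1} = t`; coordinate `j : Fin n` of `u` is `u_{j+1}`. -/
def knot {n : ℕ} (t : ℝ) (u : Fin n → ℝ) : ℕ → ℝ
  | 0 => 0
  | j + 1 => if hj : j < n then u ⟨j, hj⟩ else t

/-- `I = ⋃_{p=0}^{k} (q_p, q_{p+1})`. -/
def markSet {k : ℕ} (q : Fin (k + 2) → ℝ) : Set ℝ :=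
  ⋃ p : Fin (k + 1), Ioo (q p.castSucc) (q p.succ)

/-- `π(y) = ∑_{p=0}^{k} (q_{p+1} - y)^α (y - q_p)^α 1_{(q_p, q_{p+1})}(y)`. -/
def markWeight (α : ℝ) {k : ℕ} (q : Fin (k + 2) → ℝ) (y : ℝ) : ℝ :=
  ∑ p : Fin (k + 1), (Ioo (q p.castSucc) (q p.succ)).indicator
    (fun y => (q p.succ - y) ^ α * (y - q p.castSucc) ^ α) y

/-- The weights: `(u_{i+1} - u_i)^α (u_i - u_{i-1})^α 1_{[u_{i-1}, u_{i+1}]}(u_i)` for the jump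
times and `π(a_i)` for the amplitudes. -/
def mixedWeight (α t : ℝ) {k : ℕ} (q : Fin (k + 2) → ℝ) {n : ℕ} :
    Fin n ⊕ Fin n → (Fin n ⊕ Fin n → ℝ) → ℝ
  | Sum.inl i, v =>
      (Icc (knot t (fun j => v (Sum.inl j)) i) (knot t (fun j => v (Sum.inl j)) (i + 2))).indicator
        (fun y => (knot t (fun j => v (Sum.inl j)) (i + 2) - y) ^ α
          * (y - knot t (fun j => v (Sum.inl j)) i) ^ α) (v (Sum.inl i))
  | Sum.inr i, v => markWeight α q (v (Sum.inr i))

/-- `∂ ln p_i`: zero for the jump times (conditionally uniform), `ρ'(a_i)` for the amplitudes. -/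
def mixedScore (ρ : ℝ → ℝ) {n : ℕ} : Fin n ⊕ Fin n → (Fin n ⊕ Fin n → ℝ) → ℝ
  | Sum.inl _, _ => 0
  | Sum.inr i, v => deriv ρ (v (Sum.inr i))

/-- `H_n = H(S_t, ∂_x S_t)` as a function of `(u, a)`. -/
def mixedH (c : ℝ → ℝ → ℝ → ℝ) (g : ℝ → ℝ → ℝ) (h t : ℝ) (α : ℝ) {k : ℕ} (q : Fin (k + 2) → ℝ)
    (ρ : ℝ → ℝ) (x : ℝ) (n : ℕ) (v : Fin n ⊕ Fin n → ℝ) : ℝ :=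
  malliavinWeight (mixedWeight α t q) (mixedScore ρ) (detSol c g h t x) (detSolX c g h t x) v

/-- The vector `(T_1, …, T_n, Δ_1, …, Δ_n)`. -/
def noiseVector {Ω : Type*} (T Δ : ℕ → Ω → ℝ) (n : ℕ) (ω : Ω) : Fin n ⊕ Fin n → ℝ :=
  Sum.elim (fun i => T (i + 1) ω) (fun i => Δ (i + 1) ω)

/-! ### Hypotheses on the coefficients and on the law of the amplitudes -/

/-- `c` is twice differentiable in `(t, a, x)`; `g` is differentiable in `(t, x)` and twice
differentiable in `x`; these derivatives are bounded and `|c| + |g| ≤ K (1 + |x|)`. Everything is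
required for `0 < t < h`, `a ∈ I` and `x ∈ ℝ`. -/
structure CoeffHyp (c : ℝ → ℝ → ℝ → ℝ) (g : ℝ → ℝ → ℝ) (h : ℝ) (I : Set ℝ) : Prop where
  c_diff : DifferentiableOn ℝ (fun p : ℝ × ℝ × ℝ => c p.1 p.2.1 p.2.2) (Ioo 0 h ×ˢ I ×ˢ univ)
  c_diff_two : DifferentiableOn ℝ (fderiv ℝ (fun p : ℝ × ℝ × ℝ => c p.1 p.2.1 p.2.2))
    (Ioo 0 h ×ˢ I ×ˢ univ)
  c_bdd : ∃ K : ℝ, ∀ p ∈ Ioo 0 h ×ˢ I ×ˢ (univ : Set ℝ),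
    ‖fderiv ℝ (fun p : ℝ × ℝ × ℝ => c p.1 p.2.1 p.2.2) p‖ ≤ K ∧
    ‖fderiv ℝ (fderiv ℝ (fun p : ℝ × ℝ × ℝ => c p.1 p.2.1 p.2.2)) p‖ ≤ K
  g_diff : DifferentiableOn ℝ (fun p : ℝ × ℝ => g p.1 p.2) (Ioo 0 h ×ˢ univ)
  g_bdd : ∃ K : ℝ, ∀ p ∈ Ioo 0 h ×ˢ (univ : Set ℝ),
    ‖fderiv ℝ (fun p : ℝ × ℝ => g p.1 p.2) p‖ ≤ K
  g_diff_two : ∀ t ∈ Ioo 0 h, Differentiable ℝ (deriv (g t))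
  g_bdd_two : ∃ K : ℝ, ∀ t ∈ Ioo 0 h, ∀ x, |deriv (deriv (g t)) x| ≤ K
  growth : ∃ K : ℝ, ∀ t ∈ Ioo 0 h, ∀ a ∈ I, ∀ x, |c t a x| + |g t x| ≤ K * (1 + |x|)

/-- The law `ν` of the amplitudes has density `1_I e^ρ`, with `ρ` continuously differentiable and
bounded on `I`, and the logarithmic derivative `ρ'` has moments of all orders under `ν`. -/
structure MarkLawHyp (ν : Measure ℝ) (I : Set ℝ) (ρ : ℝ → ℝ) : Prop where
  density : ν = volume.withDensity (I.indicator fun y => ENNReal.ofReal (Real.exp (ρ y)))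
  contDiff : ContDiffOn ℝ 1 ρ I
  bdd : ∃ M : ℝ, ∀ y ∈ I, |ρ y| ≤ M
  score_moments : ∀ m : ℕ, Integrable (fun y => |deriv ρ y| ^ m) ν

/-- `q(t, a, x) = (∂_t c + g ∂_x c)(t, a, x) + g(t, x) - g(t, x + c(t, a, x))`. -/
def timeSens (c : ℝ → ℝ → ℝ → ℝ) (g : ℝ → ℝ → ℝ) (t a x : ℝ) : ℝ :=
  deriv (fun r => c r a x) t + g t x * deriv (fun y => c t a y) x + g t x - g t (x + c t a x)

end

end JumpIBP

namespace JumpIBP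

noncomputable section

/-! ### Functions with bounded derivatives up to order one or two -/

section BoundedDerivatives

variable {E F G H : Type*} [NormedAddCommGroup E] [NormedSpace ℝ E]
  [NormedAddCommGroup F] [NormedSpace ℝ F] [NormedAddCommGroup G] [NormedSpace ℝ G]
  [NormedAddCommGroup H] [NormedSpace ℝ H]

/-- `f` is differentiable at the points of `U`, and `f` and its derivative are bounded on `U`. -/
def C1b (U : Set E) (f : E → F) : Prop :=
  ∃ C : ℝ, ∀ p ∈ U, DifferentiableAt ℝ f p ∧ ‖f p‖ ≤ C ∧ ‖fderiv ℝ f p‖ ≤ C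

/-- `f` is twice differentiable at the points of `U`, and `f` and its derivatives of order one and
two are bounded on `U`. -/
def C2b (U : Set E) (f : E → F) : Prop :=
  C1b U f ∧ C1b U (fderiv ℝ f)

lemma C1b.of_hasFDerivAt {U : Set E} {f : E → F} {f' : E → E →L[ℝ] F} {C C' : ℝ}
    (h : ∀ p ∈ U, HasFDerivAt f (f' p) p) (hf : ∀ p ∈ U, ‖f p‖ ≤ C)
    (hf' : ∀ p ∈ U, ‖f' p‖ ≤ C') : C1b U f :=
  ⟨max C C', fun p hp => ⟨(h p hp).differentiableAt, (hf p hp).trans (le_max_left _ _),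
    by rw [(h p hp).fderiv]; exact (hf' p hp).trans (le_max_right _ _)⟩⟩

lemma C1b.differentiableAt {U : Set E} {f : E → F} (hf : C1b U f) {p : E} (hp : p ∈ U) :
    DifferentiableAt ℝ f p := by
  obtain ⟨C, hC⟩ := hf
  exact (hC p hp).1

lemma C1b.bdd {U : Set E} {f : E → F} (hf : C1b U f) : ∃ C, 0 ≤ C ∧ ∀ p ∈ U, ‖f p‖ ≤ C := by
  obtain ⟨C, hC⟩ := hf
  exact ⟨max C 0, le_max_right _ _, fun p hp => (hC p hp).2.1.trans (le_max_left _ _)⟩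

lemma C1b.bdd_fderiv {U : Set E} {f : E → F} (hf : C1b U f) :
    ∃ C, 0 ≤ C ∧ ∀ p ∈ U, ‖fderiv ℝ f p‖ ≤ C := by
  obtain ⟨C, hC⟩ := hf
  exact ⟨max C 0, le_max_right _ _, fun p hp => (hC p hp).2.2.trans (le_max_left _ _)⟩

lemma C1b.congr {U : Set E} (hU : IsOpen U) {f f₁ : E → F} (hf : C1b U f)
    (h : ∀ p ∈ U, f₁ p = f p) : C1b U f₁ := by
  obtain ⟨C, hC⟩ := hf
  refine ⟨C, fun p hp => ?_⟩
  have he : f₁ =ᶠ[𝓝 p] f := Filter.eventuallyEq_of_mem (hU.mem_nhds hp) h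
  obtain ⟨h1, h2, h3⟩ := hC p hp
  exact ⟨h1.congr_of_eventuallyEq he, by rw [h p hp]; exact h2, by rw [he.fderiv_eq]; exact h3⟩

lemma C1b.const (U : Set E) (y : F) : C1b U (fun _ : E => y) :=
  ⟨‖y‖, fun p _ => ⟨differentiableAt_const _, le_rfl, by simp⟩⟩

lemma C1b.clm (L : F →L[ℝ] G) {U : Set E} {f : E → F} (hf : C1b U f) :
    C1b U (fun p => L (f p)) := by
  obtain ⟨C, hC⟩ := hf
  refine C1b.of_hasFDerivAt (f' := fun p => L.comp (fderiv ℝ f p)) (C := ‖L‖ * C) (C' := ‖L‖ * C)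
    (fun p hp => L.hasFDerivAt.comp p (hC p hp).1.hasFDerivAt) (fun p hp => ?_) (fun p hp => ?_)
  · exact (L.le_opNorm _).trans (mul_le_mul_of_nonneg_left (hC p hp).2.1 (norm_nonneg _))
  · exact (L.opNorm_comp_le _).trans (mul_le_mul_of_nonneg_left (hC p hp).2.2 (norm_nonneg _))

lemma C1b.add {U : Set E} {f g : E → F} (hf : C1b U f) (hg : C1b U g) :
    C1b U (fun p => f p + g p) := by
  obtain ⟨C, hC⟩ := hf
  obtain ⟨D, hD⟩ := hg
  exact C1b.of_hasFDerivAt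
    (fun p hp => (hC p hp).1.hasFDerivAt.add (hD p hp).1.hasFDerivAt)
    (fun p hp => (norm_add_le _ _).trans (add_le_add (hC p hp).2.1 (hD p hp).2.1))
    (fun p hp => (norm_add_le _ _).trans (add_le_add (hC p hp).2.2 (hD p hp).2.2))

lemma C1b.comp {U : Set E} {V : Set F} {f : F → G} {k : E → F} (hf : C1b V f) (hk : C1b U k)
    (hm : ∀ p ∈ U, k p ∈ V) : C1b U (fun p => f (k p)) := by
  obtain ⟨C, hC⟩ := hf
  obtain ⟨D, hD⟩ := hk
  refine C1b.of_hasFDerivAt (f' := fun p => (fderiv ℝ f (k p)).comp (fderiv ℝ k p))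
    (C := C) (C' := C * D)
    (fun p hp => (hC _ (hm p hp)).1.hasFDerivAt.comp p (hD p hp).1.hasFDerivAt)
    (fun p hp => (hC _ (hm p hp)).2.1) (fun p hp => ?_)
  refine (ContinuousLinearMap.opNorm_comp_le _ _).trans ?_
  have h1 := (hC _ (hm p hp)).2.2
  exact mul_le_mul h1 (hD p hp).2.2 (norm_nonneg _) ((norm_nonneg _).trans h1)

lemma C1b.bilin (B : F →L[ℝ] G →L[ℝ] H) {U : Set E} {f : E → F} {k : E → G}
    (hf : C1b U f) (hk : C1b U k) : C1b U (fun p => B (f p) (k p)) := by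
  obtain ⟨C, hC⟩ := hf
  obtain ⟨D, hD⟩ := hk
  refine C1b.of_hasFDerivAt
    (f' := fun p => B.precompR E (f p) (fderiv ℝ k p) + B.precompL E (fderiv ℝ f p) (k p))
    (C := ‖B‖ * C * D) (C' := ‖B‖ * C * D + ‖B‖ * C * D)
    (fun p hp => B.hasFDerivAt_of_bilinear (hC p hp).1.hasFDerivAt (hD p hp).1.hasFDerivAt)
    (fun p hp => ?_) (fun p hp => ?_)
  · refine (B.le_opNorm₂ _ _).trans ?_
    have h1 := (hC p hp).2.1
    have h0 : 0 ≤ C := (norm_nonneg _).trans h1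
    have := (hD p hp).2.1
    gcongr
  · have h1 := (hC p hp).2.1
    have h0 : 0 ≤ C := (norm_nonneg _).trans h1
    have h2 := (hD p hp).2.1
    have h3 := (hC p hp).2.2
    have h4 := (hD p hp).2.2
    refine (norm_add_le _ _).trans (add_le_add ?_ ?_)
    · refine (ContinuousLinearMap.le_opNorm₂ _ _ _).trans ?_
      have := B.norm_precompR_le E
      gcongr
    · refine (ContinuousLinearMap.le_opNorm₂ _ _ _).trans ?_
      have := B.norm_precompL_le E
      gcongr

lemma C1b.smul {U : Set E} {f : E → ℝ} {k : E → F} (hf : C1b U f) (hk : C1b U k) :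
    C1b U (fun p => f p • k p) :=
  C1b.bilin (ContinuousLinearMap.lsmul ℝ ℝ) hf hk

lemma C1b.neg {U : Set E} {f : E → F} (hf : C1b U f) : C1b U (fun p => - f p) := by
  simpa using (C1b.const U (-1 : ℝ)).smul hf

lemma C1b.sub {U : Set E} {f g : E → F} (hf : C1b U f) (hg : C1b U g) :
    C1b U (fun p => f p - g p) := by
  simpa [sub_eq_add_neg] using hf.add hg.neg

lemma C1b.prodMk {U : Set E} {f : E → F} {k : E → G} (hf : C1b U f) (hk : C1b U k) :
    C1b U (fun p => (f p, k p)) := by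
  simpa using (C1b.clm (ContinuousLinearMap.inl ℝ F G) hf).add
    (C1b.clm (ContinuousLinearMap.inr ℝ F G) hk)

lemma C1b.exp {U : Set E} {f : E → ℝ} (hf : C1b U f) : C1b U (fun p => Real.exp (f p)) := by
  obtain ⟨C, hC⟩ := hf
  refine C1b.of_hasFDerivAt (f' := fun p => Real.exp (f p) • fderiv ℝ f p) (C := Real.exp C)
    (C' := Real.exp C * C)
    (fun p hp => (hC p hp).1.hasFDerivAt.exp) (fun p hp => ?_) (fun p hp => ?_)
  · rw [Real.norm_eq_abs, Real.abs_exp]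
    exact Real.exp_le_exp.2 ((le_abs_self _).trans (hC p hp).2.1)
  · rw [norm_smul, Real.norm_eq_abs, Real.abs_exp]
    have := (hC p hp).2.2
    have := Real.exp_le_exp.2 ((le_abs_self _).trans (hC p hp).2.1)
    gcongr

lemma C2b.of_hasFDerivAt {U : Set E} (hU : IsOpen U) {f : E → F} {f' : E → E →L[ℝ] F} {C : ℝ}
    (h : ∀ p ∈ U, HasFDerivAt f (f' p) p) (hf : ∀ p ∈ U, ‖f p‖ ≤ C) (hf' : C1b U f') :
    C2b U f := by
  have h1 : C1b U (fderiv ℝ f) := hf'.congr hU fun p hp => (h p hp).fderiv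
  obtain ⟨D, -, hD⟩ := hf'.bdd
  exact ⟨C1b.of_hasFDerivAt h hf hD, h1⟩

lemma C2b.const {U : Set E} (y : F) : C2b U (fun _ : E => y) :=
  ⟨C1b.const U y, by rw [fderiv_fun_const]; exact C1b.const U 0⟩

lemma C2b.clm_self (L : E →L[ℝ] F) {U : Set E} (hU : IsOpen U) (hb : ∃ C, ∀ p ∈ U, ‖p‖ ≤ C) :
    C2b U (fun p => L p) := by
  obtain ⟨C, hC⟩ := hb
  exact C2b.of_hasFDerivAt (C := ‖L‖ * C) hU (fun p _ => L.hasFDerivAt)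
    (fun p hp => (L.le_opNorm _).trans (mul_le_mul_of_nonneg_left (hC p hp) (norm_nonneg _)))
    (C1b.const U L)

lemma C2b.comp {U : Set E} (hU : IsOpen U) {V : Set F} {f : F → G} {k : E → F} (hf : C2b V f)
    (hk : C2b U k) (hm : ∀ p ∈ U, k p ∈ V) : C2b U (fun p => f (k p)) := by
  obtain ⟨C, -, hC⟩ := hf.1.bdd
  refine C2b.of_hasFDerivAt hU (f' := fun p => (fderiv ℝ f (k p)).comp (fderiv ℝ k p))
    (fun p hp => (hf.1.differentiableAt (hm p hp)).hasFDerivAt.comp p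
      (hk.1.differentiableAt hp).hasFDerivAt) (fun p hp => hC _ (hm p hp)) ?_
  exact C1b.bilin (ContinuousLinearMap.compL ℝ E F G) (hf.2.comp hk.1 hm) hk.2

lemma C2b.clm {U : Set E} (hU : IsOpen U) (L : F →L[ℝ] G) {f : E → F} (hf : C2b U f) :
    C2b U (fun p => L (f p)) := by
  obtain ⟨C, -, hC⟩ := (hf.1.clm L).bdd
  refine C2b.of_hasFDerivAt hU (f' := fun p => L.comp (fderiv ℝ f p))
    (fun p hp => L.hasFDerivAt.comp p (hf.1.differentiableAt hp).hasFDerivAt) hC ?_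
  exact C1b.clm (ContinuousLinearMap.compL ℝ E F G L) hf.2

lemma C2b.add {U : Set E} (hU : IsOpen U) {f g : E → F} (hf : C2b U f) (hg : C2b U g) :
    C2b U (fun p => f p + g p) := by
  obtain ⟨C, -, hC⟩ := (hf.1.add hg.1).bdd
  exact C2b.of_hasFDerivAt hU
    (fun p hp => (hf.1.differentiableAt hp).hasFDerivAt.add (hg.1.differentiableAt hp).hasFDerivAt)
    hC (hf.2.add hg.2)

lemma C2b.prodMk {U : Set E} (hU : IsOpen U) {f : E → F} {k : E → G} (hf : C2b U f)
    (hk : C2b U k) : C2b U (fun p => (f p, k p)) := by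
  simpa using (C2b.clm hU (ContinuousLinearMap.inl ℝ F G) hf).add hU
    (C2b.clm hU (ContinuousLinearMap.inr ℝ F G) hk)

end BoundedDerivatives

/-! ### The flow of the drift -/

/-- The regularity of the drift used for its flow, with a single constant `K`. -/
structure DriftHyp (g : ℝ → ℝ → ℝ) (h K : ℝ) : Prop where
  h_pos : 0 < h
  K_nonneg : 0 ≤ K
  diff : ∀ r ∈ Ioo 0 h, ∀ x, DifferentiableAt ℝ (fun p : ℝ × ℝ => g p.1 p.2) (r, x)
  bdd : ∀ r ∈ Ioo 0 h, ∀ x, ‖fderiv ℝ (fun p : ℝ × ℝ => g p.1 p.2) (r, x)‖ ≤ K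
  diff_two : ∀ r ∈ Ioo 0 h, Differentiable ℝ (deriv (g r))
  bdd_two : ∀ r ∈ Ioo 0 h, ∀ x, |deriv (deriv (g r)) x| ≤ K
  growth : ∀ r ∈ Ioo 0 h, ∀ x, |g r x| ≤ K * (1 + |x|)

/-- `y` solves `y' = g(r, y)` on `[a, b]`, the equation being required in the interior. -/
def IsSolOn (g : ℝ → ℝ → ℝ) (a b : ℝ) (y : ℝ → ℝ) : Prop :=
  ContinuousOn y (Icc a b) ∧ ∀ r ∈ Ioo a b, HasDerivAt y (g r (y r)) r

/-- Two-sided Gronwall estimate for a function `w` with `|w'| ≤ L w`. -/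
lemma le_mul_exp_of_abs_deriv_le {w w' : ℝ → ℝ} {a b L : ℝ} (hc : ContinuousOn w (Icc a b))
    (hd : ∀ r ∈ Ioo a b, HasDerivAt w (w' r) r) (hb : ∀ r ∈ Ioo a b, |w' r| ≤ L * w r)
    {s r : ℝ} (hs : s ∈ Icc a b) (hr : r ∈ Icc a b) : w r ≤ w s * Real.exp (L * |r - s|) := by
  have key : ∀ σ : ℝ, (σ = 1 ∨ σ = -1) → ∀ r ∈ Ioo a b,
      HasDerivAt (fun r => w r * Real.exp (-(σ * L * r)))
        (w' r * Real.exp (-(σ * L * r)) + w r * (Real.exp (-(σ * L * r)) * -(σ * L))) r := by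
    intro σ _ r hr
    have h1 : HasDerivAt (fun r => -(σ * L * r)) (-(σ * L)) r := by
      simpa using ((hasDerivAt_id' r).const_mul (σ * L)).fun_neg
    exact (hd r hr).mul h1.exp
  have hcont : ∀ σ : ℝ, ContinuousOn (fun r => w r * Real.exp (-(σ * L * r))) (Icc a b) :=
    fun σ => hc.mul (by fun_prop)
  rcases le_total s r with hsr | hrs
  · have hanti : AntitoneOn (fun r => w r * Real.exp (-(1 * L * r))) (Icc a b) := by
      refine antitoneOn_of_deriv_nonpos (convex_Icc a b) (hcont 1) ?_ ?_
      · rw [interior_Icc]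
        exact fun r hr => (key 1 (Or.inl rfl) r hr).differentiableAt.differentiableWithinAt
      · rw [interior_Icc]
        intro r hr
        rw [(key 1 (Or.inl rfl) r hr).deriv]
        have h1 := (abs_le.1 (hb r hr)).2
        have h2 := Real.exp_pos (-(1 * L * r))
        nlinarith
    have h1 := hanti hs hr hsr
    simp only [one_mul] at h1
    rw [abs_of_nonneg (sub_nonneg.2 hsr)]
    calc w r = w r * Real.exp (-(L * r)) * Real.exp (L * r) := by
          rw [mul_assoc, ← Real.exp_add]; simp
      _ ≤ w s * Real.exp (-(L * s)) * Real.exp (L * r) :=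
          mul_le_mul_of_nonneg_right h1 (Real.exp_pos _).le
      _ = w s * Real.exp (L * (r - s)) := by
          rw [mul_assoc, ← Real.exp_add]; ring_nf
  · have hmono : MonotoneOn (fun r => w r * Real.exp (-(-1 * L * r))) (Icc a b) := by
      refine monotoneOn_of_deriv_nonneg (convex_Icc a b) (hcont (-1)) ?_ ?_
      · rw [interior_Icc]
        exact fun r hr => (key (-1) (Or.inr rfl) r hr).differentiableAt.differentiableWithinAt
      · rw [interior_Icc]
        intro r hr
        rw [(key (-1) (Or.inr rfl) r hr).deriv]
        have h1 := (abs_le.1 (hb r hr)).1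
        have h2 := Real.exp_pos (-(-1 * L * r))
        nlinarith
    have h1 := hmono hr hs hrs
    simp only [neg_mul, one_mul, neg_neg] at h1
    rw [abs_of_nonpos (sub_nonpos.2 hrs)]
    calc w r = w r * Real.exp (L * r) * Real.exp (-(L * r)) := by
          rw [mul_assoc, ← Real.exp_add]; simp
      _ ≤ w s * Real.exp (L * s) * Real.exp (-(L * r)) :=
          mul_le_mul_of_nonneg_right h1 (Real.exp_pos _).le
      _ = w s * Real.exp (L * -(r - s)) := by
          rw [mul_assoc, ← Real.exp_add]; ring_nf

lemma one_add_sq_le_of_abs_deriv_le {y y' : ℝ → ℝ} {a b K : ℝ} (hK : 0 ≤ K)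
    (hc : ContinuousOn y (Icc a b)) (hd : ∀ r ∈ Ioo a b, HasDerivAt y (y' r) r)
    (hb : ∀ r ∈ Ioo a b, |y' r| ≤ K * (1 + |y r|)) {s r : ℝ} (hs : s ∈ Icc a b)
    (hr : r ∈ Icc a b) : 1 + y r ^ 2 ≤ (1 + y s ^ 2) * Real.exp (3 * K * |r - s|) := by
  refine le_mul_exp_of_abs_deriv_le (w := fun r => 1 + y r ^ 2) (w' := fun r => 2 * y r * y' r)
    (continuousOn_const.add (hc.pow 2)) (fun r hr => ?_) (fun r hr => ?_) hs hr
  · simpa using ((hd r hr).pow 2).const_add 1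
  · rw [abs_mul, abs_mul, abs_two]
    have h1 := hb r hr
    have h2 : |y r| ^ 2 = y r ^ 2 := sq_abs _
    have h3 := abs_nonneg (y r)
    calc 2 * |y r| * |y' r| ≤ 2 * |y r| * (K * (1 + |y r|)) := by gcongr
      _ ≤ 3 * K * (1 + y r ^ 2) := by
        rw [← h2]; nlinarith [sq_nonneg (|y r| - 1), mul_nonneg hK (sq_nonneg (|y r| - 1))]

namespace DriftHyp

variable {g : ℝ → ℝ → ℝ} {h K : ℝ}

lemma hasDerivAt_space (hg : DriftHyp g h K) {r : ℝ} (hr : r ∈ Ioo 0 h) (x : ℝ) :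
    HasDerivAt (g r) (fderiv ℝ (fun p : ℝ × ℝ => g p.1 p.2) (r, x) (0, 1)) x := by
  have h1 : HasDerivAt (fun y : ℝ => ((r, y) : ℝ × ℝ)) (0, 1) x :=
    (hasDerivAt_const x r).prodMk (hasDerivAt_id x)
  exact (hg.diff r hr x).hasFDerivAt.comp_hasDerivAt x h1

lemma differentiable_space (hg : DriftHyp g h K) {r : ℝ} (hr : r ∈ Ioo 0 h) :
    Differentiable ℝ (g r) := fun x => (hg.hasDerivAt_space hr x).differentiableAt

lemma abs_deriv_le (hg : DriftHyp g h K) {r : ℝ} (hr : r ∈ Ioo 0 h) (x : ℝ) :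
    |deriv (g r) x| ≤ K := by
  rw [(hg.hasDerivAt_space hr x).deriv, ← Real.norm_eq_abs]
  refine (ContinuousLinearMap.le_opNorm _ _).trans ?_
  have : ‖((0 : ℝ), (1 : ℝ))‖ = 1 := by simp [Prod.norm_def]
  rw [this, mul_one]
  exact hg.bdd r hr x

lemma abs_sub_le (hg : DriftHyp g h K) {r : ℝ} (hr : r ∈ Ioo 0 h) (x y : ℝ) :
    |g r x - g r y| ≤ K * |x - y| :=
  convex_univ.norm_image_sub_le_of_norm_deriv_le (fun x _ => hg.differentiable_space hr x)
    (fun x _ => hg.abs_deriv_le hr x) (mem_univ y) (mem_univ x)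

lemma abs_deriv_sub_le (hg : DriftHyp g h K) {r : ℝ} (hr : r ∈ Ioo 0 h) (x y : ℝ) :
    |deriv (g r) x - deriv (g r) y| ≤ K * |x - y| :=
  convex_univ.norm_image_sub_le_of_norm_deriv_le (fun x _ => hg.diff_two r hr x)
    (fun x _ => hg.bdd_two r hr x) (mem_univ y) (mem_univ x)

lemma lipschitzOnWith (hg : DriftHyp g h K) :
    LipschitzOnWith K.toNNReal (fun p : ℝ × ℝ => g p.1 p.2) (Ioo 0 h ×ˢ univ) := by
  refine ((convex_Ioo 0 h).prod convex_univ).lipschitzOnWith_of_nnnorm_fderiv_le (𝕜 := ℝ)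
    (fun p hp => hg.diff p.1 hp.1 p.2) (fun p hp => ?_)
  rw [← NNReal.coe_le_coe, Real.coe_toNNReal _ hg.K_nonneg]
  exact hg.bdd p.1 hp.1 p.2

lemma continuousAt (hg : DriftHyp g h K) {r : ℝ} (hr : r ∈ Ioo 0 h) (x : ℝ) :
    ContinuousAt (fun p : ℝ × ℝ => g p.1 p.2) (r, x) := (hg.diff r hr x).continuousAt

/-- The space derivative of the drift is the uniform limit of difference quotients, hence jointly
continuous. -/
lemma continuousAt_deriv (hg : DriftHyp g h K) {r : ℝ} (hr : r ∈ Ioo 0 h) (x : ℝ) :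
    ContinuousAt (fun p : ℝ × ℝ => deriv (g p.1) p.2) (r, x) := by
  have hU : (Ioo 0 h ×ˢ univ : Set (ℝ × ℝ)) ∈ 𝓝 (r, x) :=
    (isOpen_Ioo.prod isOpen_univ).mem_nhds ⟨hr, mem_univ _⟩
  suffices ContinuousOn (fun p : ℝ × ℝ => deriv (g p.1) p.2) (Ioo 0 h ×ˢ univ) from
    this.continuousAt hU
  have hlim : TendstoUniformlyOn (fun (η : ℝ) (p : ℝ × ℝ) => (g p.1 (p.2 + η) - g p.1 p.2) / η)
      (fun p => deriv (g p.1) p.2) (𝓝[>] 0) (Ioo 0 h ×ˢ univ) := by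
    rw [Metric.tendstoUniformlyOn_iff]
    intro ε hε
    have hδ : 0 < ε / (K + 1) := div_pos hε (by linarith [hg.K_nonneg])
    filter_upwards [Ioo_mem_nhdsGT hδ] with η hη p hp
    obtain ⟨ξ, hξ, hξ'⟩ := exists_deriv_eq_slope (g p.1) (lt_add_of_pos_right p.2 hη.1)
      (hg.differentiable_space hp.1).continuous.continuousOn
      (hg.differentiable_space hp.1).differentiableOn
    rw [add_sub_cancel_left] at hξ'
    rw [← hξ', Real.dist_eq]
    refine (hg.abs_deriv_sub_le hp.1 _ _).trans_lt ?_
    rw [abs_of_nonpos (by linarith [hξ.1])]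
    have h1 : -(p.2 - ξ) ≤ η := by linarith [hξ.2]
    have h2 : η * (K + 1) < ε := (lt_div_iff₀ (by linarith [hg.K_nonneg])).1 hη.2
    nlinarith [hg.K_nonneg, hη.1]
  refine hlim.continuousOn (Filter.Eventually.frequently (Filter.Eventually.of_forall fun η => ?_))
  intro p hp
  refine ContinuousAt.continuousWithinAt ?_
  have h1 : ContinuousAt (fun p : ℝ × ℝ => g p.1 (p.2 + η)) p :=
    ContinuousAt.comp (f := fun p : ℝ × ℝ => (p.1, p.2 + η)) (hg.continuousAt hp.1 (p.2 + η))
      (by fun_prop)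
  exact (h1.sub (hg.continuousAt hp.1 p.2)).div_const η

/-- Two solutions on `[a, b] ⊆ [0, h]` separate at most exponentially. -/
lemma abs_sub_le_of_isSolOn (hg : DriftHyp g h K) {a b : ℝ} (hab : Ioo a b ⊆ Ioo 0 h)
    {y z : ℝ → ℝ} (hy : IsSolOn g a b y) (hz : IsSolOn g a b z) {s r : ℝ} (hs : s ∈ Icc a b)
    (hr : r ∈ Icc a b) : |y r - z r| ≤ |y s - z s| * Real.exp (K * |r - s|) := by
  have := le_mul_exp_of_abs_deriv_le (w := fun r => (y r - z r) ^ 2)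
    (w' := fun r => 2 * (y r - z r) * (g r (y r) - g r (z r))) (L := 2 * K)
    ((hy.1.sub hz.1).pow 2) (fun r hr => ?_) (fun r hr => ?_) hs hr
  · refine abs_le_of_sq_le_sq' ?_ (by positivity) |> abs_le.2
    rw [mul_pow, sq_abs, ← Real.exp_nat_mul]
    rwa [show ((2 : ℕ) : ℝ) * (K * |r - s|) = 2 * K * |r - s| by push_cast; ring]
  · simpa using ((hy.2 r hr).fun_sub (hz.2 r hr)).fun_pow 2
  · rw [abs_mul, abs_mul, abs_two, ← sq_abs (y r - z r)]
    have := hg.abs_sub_le (hab hr) (y r) (z r)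
    have h3 := abs_nonneg (y r - z r)
    nlinarith

lemma eqOn_of_isSolOn (hg : DriftHyp g h K) {a b : ℝ} (hab : Ioo a b ⊆ Ioo 0 h)
    {y z : ℝ → ℝ} (hy : IsSolOn g a b y) (hz : IsSolOn g a b z) {s r : ℝ} (hs : s ∈ Icc a b)
    (hr : r ∈ Icc a b) (h0 : y s = z s) : y r = z r := by
  have := hg.abs_sub_le_of_isSolOn hab hy hz hs hr
  rw [h0, sub_self, abs_zero, zero_mul] at this
  exact sub_eq_zero.1 (abs_nonpos_iff.1 this)

lemma one_add_sq_le_of_isSolOn (hg : DriftHyp g h K) {a b : ℝ} (hab : Ioo a b ⊆ Ioo 0 h)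
    {y : ℝ → ℝ} (hy : IsSolOn g a b y) {s r : ℝ} (hs : s ∈ Icc a b) (hr : r ∈ Icc a b) :
    1 + y r ^ 2 ≤ (1 + y s ^ 2) * Real.exp (3 * K * |r - s|) :=
  one_add_sq_le_of_abs_deriv_le hg.K_nonneg hy.1 hy.2 (fun r hr => hg.growth r (hab hr) _) hs hr

/-- Global existence, from the Picard-Lindelöf theorem for a truncated drift. -/
lemma exists_isSolOn (hg : DriftHyp g h K) {s : ℝ} (hs : s ∈ Icc 0 h) (x : ℝ) :
    ∃ y, IsSolOn g 0 h y ∧ y s = x := by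
  obtain ⟨G, hG, hGe⟩ := hg.lipschitzOnWith.extend_real
  set R : ℝ := (1 + x ^ 2) * Real.exp (3 * K * h) with hR
  have hR1 : 1 ≤ R := by
    have h1 : 1 ≤ Real.exp (3 * K * h) :=
      Real.one_le_exp (by have := hg.K_nonneg; have := hg.h_pos; positivity)
    nlinarith [sq_nonneg x]
  set tr : ℝ → ℝ := fun x => max (-R) (min x R) with htr
  have htr_lip : LipschitzWith 1 tr := (LipschitzWith.id.min_const R).const_max (-R)
  have htr_R : ∀ x, |tr x| ≤ R := fun x => abs_le.2 ⟨le_max_left _ _,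
    max_le (by linarith) (min_le_right _ _)⟩
  have htr_abs : ∀ x, |tr x| ≤ |x| := by
    intro x
    refine abs_le.2 ⟨?_, max_le (by linarith [abs_nonneg x]) ((min_le_left _ _).trans (le_abs_self x))⟩
    rcases le_total x R with hx | hx
    · exact le_max_of_le_right (by rw [min_eq_left hx]; exact neg_abs_le x)
    · exact le_max_of_le_right (by rw [min_eq_right hx]; linarith [abs_nonneg x])
  have htr_id : ∀ x, |x| ≤ R → tr x = x := fun x hx => by
    rw [abs_le] at hx
    simp only [htr, min_eq_left hx.2, max_eq_right hx.1]
  set L : ℝ := |G (0, 0)| + K * max h R with hL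
  have hK0 := hg.K_nonneg
  have hL0 : 0 ≤ L := by have := hg.h_pos; positivity
  have hbound : ∀ r ∈ Icc 0 h, ∀ z, |G (r, tr z)| ≤ L := by
    intro r hr z
    have h1 := hG.dist_le_mul (r, tr z) (0, 0)
    rw [Real.dist_eq, Real.coe_toNNReal _ hK0, Prod.dist_eq, Real.dist_eq, Real.dist_eq,
      sub_zero, sub_zero, abs_of_nonneg hr.1] at h1
    have h2 : max r |tr z| ≤ max h R := max_le_max hr.2 (htr_R z)
    have h3 : |G (r, tr z)| ≤ |G (0, 0)| + |G (r, tr z) - G (0, 0)| := by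
      have := abs_add_le (G (0, 0)) (G (r, tr z) - G (0, 0))
      simpa using this
    have h4 := mul_le_mul_of_nonneg_left h2 hK0
    simp only at h1
    linarith
  have hPL : IsPicardLindelof (fun r z => G (r, tr z)) (⟨s, hs⟩ : Icc 0 h) x
      (L * h).toNNReal 0 L.toNNReal K.toNNReal := by
    refine ⟨fun r _ => ?_, fun z _ => ?_, fun r hr z _ => ?_, ?_⟩
    · have h1 : LipschitzWith 1 (fun z => (r, tr z)) := by
        refine LipschitzWith.of_dist_le_mul fun a b => ?_
        rw [Prod.dist_eq]
        simpa using htr_lip.dist_le_mul a b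
      simpa [Function.comp_def] using (hG.comp h1).lipschitzOnWith
    · exact (hG.continuous.comp (by fun_prop)).continuousOn
    · rw [Real.norm_eq_abs, Real.coe_toNNReal _ hL0]
      exact hbound r hr z
    · rw [Real.coe_toNNReal _ hL0, Real.coe_toNNReal _ (mul_nonneg hL0 hg.h_pos.le)]
      simp only [NNReal.coe_zero, sub_zero]
      exact mul_le_mul_of_nonneg_left (max_le (by linarith [hs.1]) hs.2) hL0
  obtain ⟨y, hy0, hy⟩ := hPL.exists_eq_forall_mem_Icc_hasDerivWithinAt₀
  have hyc : ContinuousOn y (Icc 0 h) := fun r hr => (hy r hr).continuousWithinAt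
  have hyd : ∀ r ∈ Ioo 0 h, HasDerivAt y (g r (tr (y r))) r := by
    intro r hr
    have h1 := (hy r (Ioo_subset_Icc_self hr)).hasDerivAt (Icc_mem_nhds hr.1 hr.2)
    have h2 : g r (tr (y r)) = G (r, tr (y r)) := hGe (x := (r, tr (y r))) ⟨hr, mem_univ _⟩
    rwa [h2]
  have hyb : ∀ r ∈ Icc 0 h, |y r| ≤ R := by
    intro r hr
    have h1 := one_add_sq_le_of_abs_deriv_le hK0 hyc hyd (fun r hr => (hg.growth r hr _).trans
      (mul_le_mul_of_nonneg_left (by linarith [htr_abs (y r)]) hK0)) hs hr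
    simp only [hy0] at h1
    have h2 : Real.exp (3 * K * |r - s|) ≤ Real.exp (3 * K * h) := by
      refine Real.exp_le_exp.2 (mul_le_mul_of_nonneg_left ?_ (by positivity))
      exact abs_le.2 ⟨by linarith [hr.1, hs.2], by linarith [hr.2, hs.1]⟩
    have h3 : (1 + x ^ 2) * Real.exp (3 * K * |r - s|) ≤ R :=
      mul_le_mul_of_nonneg_left h2 (by positivity)
    refine abs_le_of_sq_le_sq' ?_ (by linarith) |> abs_le.2
    nlinarith
  exact ⟨y, ⟨hyc, fun r hr => by
    have := hyd r hr
    rwa [htr_id _ (hyb r (Ioo_subset_Icc_self hr))] at this⟩, hy0⟩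

end DriftHyp

/-- Projection of a time onto `[0, h]`. -/
def clampTime (h s : ℝ) : ℝ := max 0 (min s h)

/-- The flow of `y' = g(r, y)` on `[0, h]`, with all times projected onto `[0, h]`. -/
def flow (g : ℝ → ℝ → ℝ) (h s t x : ℝ) : ℝ :=
  Classical.epsilon (fun y : ℝ → ℝ => IsSolOn g 0 h y ∧ y (clampTime h s) = x) (clampTime h t)

/-- The times at which the drift, extended by zero outside `(0, h)`, is regular. -/
def regTime (h : ℝ) : Set ℝ := {r | r ≠ 0 ∧ r ≠ h}

/-- The drift extended by zero outside `(0, h)`. -/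
def drift (g : ℝ → ℝ → ℝ) (h r x : ℝ) : ℝ := (Ioo 0 h).indicator (fun r => g r x) r

/-- The space derivative of the extended drift. -/
def driftX (g : ℝ → ℝ → ℝ) (h r x : ℝ) : ℝ := (Ioo 0 h).indicator (fun r => deriv (g r) x) r

/-- The second space derivative of the extended drift. -/
def driftXX (g : ℝ → ℝ → ℝ) (h r x : ℝ) : ℝ :=
  (Ioo 0 h).indicator (fun r => deriv (deriv (g r)) x) r

/-- The logarithm of the space derivative of the flow. -/
def flowLog (g : ℝ → ℝ → ℝ) (h s t x : ℝ) : ℝ := ∫ r in s..t, driftX g h r (flow g h s r x)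

lemma isOpen_regTime (h : ℝ) : IsOpen (regTime h) :=
  (isOpen_ne (x := (0 : ℝ))).inter (isOpen_ne (x := h))

lemma regTime_compl (h : ℝ) : (regTime h)ᶜ = {0, h} := by
  ext r
  simp only [regTime, mem_compl_iff, mem_ofPred_eq, mem_insert_iff, mem_singleton_iff]
  tauto

lemma ae_mem_regTime (h : ℝ) : ∀ᵐ r, r ∈ regTime h := by
  rw [ae_iff]
  exact ((Set.countable_singleton h).insert 0).measure_zero volume |> fun h0 => by
    simpa [← regTime_compl, compl_def] using h0

lemma eventually_mem_Ioo_or {h r : ℝ} (hr : r ∈ regTime h) :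
    (r ∈ Ioo 0 h ∧ ∀ᶠ s in 𝓝 r, s ∈ Ioo 0 h) ∨ (r ∉ Ioo 0 h ∧ ∀ᶠ s in 𝓝 r, s ∉ Ioo 0 h) := by
  by_cases hm : r ∈ Ioo 0 h
  · exact Or.inl ⟨hm, isOpen_Ioo.mem_nhds hm⟩
  · refine Or.inr ⟨hm, ?_⟩
    rcases lt_or_gt_of_ne hr.1 with h1 | h1
    · filter_upwards [Iio_mem_nhds h1] with s hs hs'
      exact lt_asymm hs hs'.1
    · have h2 : h < r := lt_of_le_of_ne (not_lt.1 fun h2 => hm ⟨h1, h2⟩) (Ne.symm hr.2)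
      filter_upwards [Ioi_mem_nhds h2] with s hs hs'
      exact lt_asymm hs hs'.2

lemma clampTime_mem {h : ℝ} (hh : 0 < h) (s : ℝ) : clampTime h s ∈ Icc 0 h :=
  ⟨le_max_left _ _, max_le hh.le (min_le_right _ _)⟩

lemma clampTime_of_mem {h s : ℝ} (hs : s ∈ Icc 0 h) : clampTime h s = s := by
  simp [clampTime, hs.1, hs.2]

lemma clampTime_of_nonpos {h s : ℝ} (hs : s ≤ 0) : clampTime h s = 0 :=
  max_eq_left ((min_le_left _ _).trans hs)

lemma clampTime_of_ge {h s : ℝ} (hh : 0 < h) (hs : h ≤ s) : clampTime h s = h := by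
  simp [clampTime, hs, hh.le]

lemma continuous_clampTime (h : ℝ) : Continuous (clampTime h) := by
  unfold clampTime; fun_prop

lemma intervalIntegrable_of_continuousAt_regTime {h K : ℝ} {m : ℝ → ℝ}
    (hc : ∀ r ∈ regTime h, ContinuousAt m r) (hb : ∀ r, |m r| ≤ K) (a b : ℝ) :
    IntervalIntegrable m volume a b := by
  have hm : AEStronglyMeasurable m volume := by
    have h1 : AEStronglyMeasurable m (volume.restrict (regTime h)) :=
      ContinuousOn.aestronglyMeasurable (fun r hr => (hc r hr).continuousWithinAt)
        (isOpen_regTime h).measurableSet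
    rwa [Measure.restrict_eq_self_of_ae_mem (ae_mem_regTime h)] at h1
  exact (intervalIntegrable_const (c := K)).mono_fun hm.restrict
    (Filter.Eventually.of_forall fun r => by
      simpa using (hb r).trans (le_abs_self K))

lemma integral_eq_sub_of_hasDerivAt_regTime {h : ℝ} {f f' : ℝ → ℝ} (hf : Continuous f)
    (hd : ∀ r ∈ regTime h, HasDerivAt f (f' r) r) {a b : ℝ}
    (hi : IntervalIntegrable f' volume a b) : ∫ r in a..b, f' r = f b - f a :=
  integral_eq_of_hasDerivAt_off_countable f f' (s := {0, h}) ((Set.countable_singleton h).insert 0)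
    hf.continuousOn
    (fun r hr => hd r (by rw [← regTime_compl] at hr; simpa using hr.2)) hi

/-- Solutions of the linear equation `D' = m D`. -/
lemma eq_mul_exp_integral_of_hasDerivAt {h K : ℝ} {D m : ℝ → ℝ} (hD : Continuous D)
    (hd : ∀ r ∈ regTime h, HasDerivAt D (m r * D r) r)
    (hc : ∀ r ∈ regTime h, ContinuousAt m r) (hb : ∀ r, |m r| ≤ K) (s t : ℝ) :
    D t = D s * Real.exp (∫ r in s..t, m r) := by
  have hi := intervalIntegrable_of_continuousAt_regTime hc hb
  have hN : Continuous (fun t => ∫ r in s..t, m r) :=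
    intervalIntegral.continuous_primitive hi s
  have hNd : ∀ r ∈ regTime h, HasDerivAt (fun t => ∫ r in s..t, m r) (m r) r := by
    intro r hr
    refine intervalIntegral.integral_hasDerivAt_right (hi s r) ?_ (hc r hr)
    exact ContinuousAt.stronglyMeasurableAtFilter (isOpen_regTime h) hc r hr
  have hprod := integral_eq_sub_of_hasDerivAt_regTime (h := h) (a := s) (b := t)
    (f := fun r => D r * Real.exp (-(∫ v in s..r, m v))) (f' := fun _ => 0)
    (hD.mul (by fun_prop)) (fun r hr => by
      have := (hd r hr).fun_mul (hNd r hr).fun_neg.exp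
      refine this.congr_deriv ?_
      ring) (by simp)
  simp only [intervalIntegral.integral_zero, intervalIntegral.integral_same, neg_zero,
    Real.exp_zero, mul_one] at hprod
  have h1 : D s = D t * Real.exp (-(∫ v in s..t, m v)) := by linarith
  rw [h1, mul_assoc, ← Real.exp_add]
  simp

namespace DriftHyp

variable {g : ℝ → ℝ → ℝ} {h K : ℝ}

/-! #### The extended drift -/

lemma abs_drift_le (hg : DriftHyp g h K) (r x : ℝ) : |drift g h r x| ≤ K * (1 + |x|) := by
  unfold drift
  by_cases hr : r ∈ Ioo 0 h
  · rw [indicator_of_mem hr]; exact hg.growth r hr x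
  · rw [indicator_of_notMem hr, abs_zero]
    have := hg.K_nonneg; positivity

lemma abs_driftX_le (hg : DriftHyp g h K) (r x : ℝ) : |driftX g h r x| ≤ K := by
  unfold driftX
  by_cases hr : r ∈ Ioo 0 h
  · rw [indicator_of_mem hr]; exact hg.abs_deriv_le hr x
  · rw [indicator_of_notMem hr, abs_zero]; exact hg.K_nonneg

lemma abs_driftXX_le (hg : DriftHyp g h K) (r x : ℝ) : |driftXX g h r x| ≤ K := by
  unfold driftXX
  by_cases hr : r ∈ Ioo 0 h
  · rw [indicator_of_mem hr]; exact hg.bdd_two r hr x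
  · rw [indicator_of_notMem hr, abs_zero]; exact hg.K_nonneg

lemma hasDerivAt_driftX (hg : DriftHyp g h K) (r x : ℝ) :
    HasDerivAt (driftX g h r) (driftXX g h r x) x := by
  unfold driftX driftXX
  by_cases hr : r ∈ Ioo 0 h
  · simp only [indicator_of_mem hr]
    exact (hg.diff_two r hr x).hasDerivAt
  · simp only [indicator_of_notMem hr]
    exact hasDerivAt_const _ _

lemma differentiableAt_drift (hg : DriftHyp g h K) {r : ℝ} (hr : r ∈ regTime h) (x : ℝ) :
    DifferentiableAt ℝ (fun p : ℝ × ℝ => drift g h p.1 p.2) (r, x) ∧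
      ‖fderiv ℝ (fun p : ℝ × ℝ => drift g h p.1 p.2) (r, x)‖ ≤ K := by
  have hfst : Filter.Tendsto (Prod.fst : ℝ × ℝ → ℝ) (𝓝 (r, x)) (𝓝 r) := continuous_fst.tendsto _
  rcases eventually_mem_Ioo_or hr with ⟨hr, he⟩ | ⟨hr, he⟩
  · have he' : (fun p : ℝ × ℝ => drift g h p.1 p.2) =ᶠ[𝓝 (r, x)] fun p => g p.1 p.2 := by
      filter_upwards [hfst.eventually he] with p hp
      simp [drift, indicator_of_mem hp]
    exact ⟨(hg.diff r hr x).congr_of_eventuallyEq he', by rw [he'.fderiv_eq]; exact hg.bdd r hr x⟩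
  · have he' : (fun p : ℝ × ℝ => drift g h p.1 p.2) =ᶠ[𝓝 (r, x)] fun _ => 0 := by
      filter_upwards [hfst.eventually he] with p hp
      simp [drift, indicator_of_notMem hp]
    exact ⟨(differentiableAt_const _).congr_of_eventuallyEq he', by
      rw [he'.fderiv_eq]; simpa using hg.K_nonneg⟩

lemma continuousAt_driftX (hg : DriftHyp g h K) {r : ℝ} (hr : r ∈ regTime h) (x : ℝ) :
    ContinuousAt (fun p : ℝ × ℝ => driftX g h p.1 p.2) (r, x) := by
  have hfst : Filter.Tendsto (Prod.fst : ℝ × ℝ → ℝ) (𝓝 (r, x)) (𝓝 r) := continuous_fst.tendsto _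
  rcases eventually_mem_Ioo_or hr with ⟨hr, he⟩ | ⟨hr, he⟩
  · refine (hg.continuousAt_deriv hr x).congr ?_
    filter_upwards [hfst.eventually he] with p hp
    simp [driftX, indicator_of_mem hp]
  · refine (continuousAt_const (y := (0 : ℝ))).congr ?_
    filter_upwards [hfst.eventually he] with p hp
    simp [driftX, indicator_of_notMem hp]

/-! #### Elementary properties of the flow -/

lemma flow_spec (hg : DriftHyp g h K) (s x : ℝ) :
    ∃ y, IsSolOn g 0 h y ∧ y (clampTime h s) = x ∧ ∀ t, flow g h s t x = y (clampTime h t) := by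
  have h1 := Classical.epsilon_spec (hg.exists_isSolOn (clampTime_mem hg.h_pos s) x)
  exact ⟨_, h1.1, h1.2, fun t => rfl⟩

lemma flow_eq (hg : DriftHyp g h K) {y : ℝ → ℝ} (hy : IsSolOn g 0 h y) (s t : ℝ) :
    flow g h s t (y (clampTime h s)) = y (clampTime h t) := by
  obtain ⟨z, hz, hz0, hzt⟩ := hg.flow_spec s (y (clampTime h s))
  rw [hzt]
  exact hg.eqOn_of_isSolOn subset_rfl hz hy (clampTime_mem hg.h_pos s) (clampTime_mem hg.h_pos t)
    hz0

lemma flow_self (hg : DriftHyp g h K) (s x : ℝ) : flow g h s s x = x := by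
  obtain ⟨y, hy, hy0, hyt⟩ := hg.flow_spec s x
  rw [hyt, hy0]

lemma flow_flow (hg : DriftHyp g h K) (s r t x : ℝ) :
    flow g h r t (flow g h s r x) = flow g h s t x := by
  obtain ⟨y, hy, hy0, hyt⟩ := hg.flow_spec s x
  rw [hyt, hyt, hg.flow_eq hy]

lemma flow_congr_left {s s' : ℝ} (hs : clampTime h s = clampTime h s') (t x : ℝ) :
    flow g h s t x = flow g h s' t x := by
  simp only [flow, hs]

lemma flow_congr_right {t t' : ℝ} (ht : clampTime h t = clampTime h t') (s x : ℝ) :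
    flow g h s t x = flow g h s t' x := by
  simp only [flow, ht]

lemma continuous_flow_time (hg : DriftHyp g h K) (s x : ℝ) :
    Continuous (fun t => flow g h s t x) := by
  obtain ⟨y, hy, hy0, hyt⟩ := hg.flow_spec s x
  simp only [hyt]
  exact hy.1.comp_continuous (continuous_clampTime h) (clampTime_mem hg.h_pos)

lemma hasDerivAt_flow_time (hg : DriftHyp g h K) (s x : ℝ) {t : ℝ} (ht : t ∈ regTime h) :
    HasDerivAt (fun t => flow g h s t x) (drift g h t (flow g h s t x)) t := by
  obtain ⟨y, hy, hy0, hyt⟩ := hg.flow_spec s x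
  simp only [hyt]
  rcases eventually_mem_Ioo_or ht with ⟨hm, he⟩ | ⟨hm, he⟩
  · rw [drift, indicator_of_mem hm, clampTime_of_mem (Ioo_subset_Icc_self hm)]
    refine (hy.2 t hm).congr_of_eventuallyEq ?_
    filter_upwards [he] with r hr
    rw [clampTime_of_mem (Ioo_subset_Icc_self hr)]
  · rw [drift, indicator_of_notMem hm]
    refine (hasDerivAt_const t (y (clampTime h t))).congr_of_eventuallyEq ?_
    rcases lt_or_gt_of_ne ht.1 with h1 | h1
    · filter_upwards [Iio_mem_nhds h1] with r hr
      rw [clampTime_of_nonpos (le_of_lt hr), clampTime_of_nonpos h1.le]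
    · have h2 : h < t := lt_of_le_of_ne (not_lt.1 fun h2 => hm ⟨h1, h2⟩) (Ne.symm ht.2)
      filter_upwards [Ioi_mem_nhds h2] with r hr
      rw [clampTime_of_ge hg.h_pos (le_of_lt hr), clampTime_of_ge hg.h_pos h2.le]

lemma isSolOn_flow (hg : DriftHyp g h K) (s x : ℝ) : IsSolOn g 0 h (fun t => flow g h s t x) :=
  ⟨(hg.continuous_flow_time s x).continuousOn, fun r hr => by
    have := hg.hasDerivAt_flow_time s x (t := r) ⟨hr.1.ne', hr.2.ne⟩
    rwa [drift, indicator_of_mem hr] at this⟩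

lemma abs_flow_sub_le (hg : DriftHyp g h K) (s t x y : ℝ) :
    |flow g h s t x - flow g h s t y| ≤ |x - y| * Real.exp (K * h) := by
  obtain ⟨y₁, hy, hy0, hyt⟩ := hg.flow_spec s x
  obtain ⟨y₂, hz, hz0, hzt⟩ := hg.flow_spec s y
  rw [hyt, hzt, ← hy0, ← hz0]
  have hs := clampTime_mem hg.h_pos s
  have ht := clampTime_mem hg.h_pos t
  refine (hg.abs_sub_le_of_isSolOn subset_rfl hy hz hs ht).trans ?_
  refine mul_le_mul_of_nonneg_left (Real.exp_le_exp.2 (mul_le_mul_of_nonneg_left ?_ hg.K_nonneg))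
    (abs_nonneg _)
  exact abs_le.2 ⟨by linarith [ht.1, hs.2], by linarith [ht.2, hs.1]⟩

lemma abs_flow_le (hg : DriftHyp g h K) (s t x : ℝ) :
    |flow g h s t x| ≤ (1 + x ^ 2) * Real.exp (3 * K * h) := by
  obtain ⟨y, hy, hy0, hyt⟩ := hg.flow_spec s x
  rw [hyt, ← hy0]
  have hs := clampTime_mem hg.h_pos s
  have ht := clampTime_mem hg.h_pos t
  have h1 := hg.one_add_sq_le_of_isSolOn subset_rfl hy hs ht
  have h2 : Real.exp (3 * K * |clampTime h t - clampTime h s|) ≤ Real.exp (3 * K * h) := by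
    refine Real.exp_le_exp.2 (mul_le_mul_of_nonneg_left ?_ (by have := hg.K_nonneg; positivity))
    exact abs_le.2 ⟨by linarith [ht.1, hs.2], by linarith [ht.2, hs.1]⟩
  have h3 := mul_le_mul_of_nonneg_left h2 (show 0 ≤ 1 + y (clampTime h s) ^ 2 by positivity)
  nlinarith [sq_nonneg (|y (clampTime h t)| - 1), sq_abs (y (clampTime h t))]

lemma abs_drift_flow_le (hg : DriftHyp g h K) (s r x : ℝ) :
    |drift g h r (flow g h s r x)| ≤ K * (1 + (1 + x ^ 2) * Real.exp (3 * K * h)) :=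
  (hg.abs_drift_le _ _).trans
    (mul_le_mul_of_nonneg_left (by linarith [hg.abs_flow_le s r x]) hg.K_nonneg)

lemma intervalIntegrable_drift_flow (hg : DriftHyp g h K) (s x a b : ℝ) :
    IntervalIntegrable (fun r => drift g h r (flow g h s r x)) volume a b := by
  refine intervalIntegrable_of_continuousAt_regTime (h := h) (fun r hr => ?_)
    (fun r => hg.abs_drift_flow_le s r x) _ _
  exact ContinuousAt.comp (f := fun r => (r, flow g h s r x))
    (hg.differentiableAt_drift hr (flow g h s r x)).1.continuousAt
    (continuousAt_id.prodMk (hg.continuous_flow_time s x).continuousAt)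

lemma integral_drift_flow (hg : DriftHyp g h K) (s x a b : ℝ) :
    ∫ r in a..b, drift g h r (flow g h s r x) = flow g h s b x - flow g h s a x :=
  integral_eq_sub_of_hasDerivAt_regTime (hg.continuous_flow_time s x)
    (fun _ hr => hg.hasDerivAt_flow_time s x hr) (hg.intervalIntegrable_drift_flow s x a b)

lemma abs_flow_time_sub_le (hg : DriftHyp g h K) (s t t' x : ℝ) :
    |flow g h s t x - flow g h s t' x|
      ≤ K * (1 + (1 + x ^ 2) * Real.exp (3 * K * h)) * |t - t'| := by
  rw [← hg.integral_drift_flow, ← Real.norm_eq_abs]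
  exact intervalIntegral.norm_integral_le_of_norm_le_const (fun r _ => hg.abs_drift_flow_le s r x)

lemma continuous_flow (hg : DriftHyp g h K) :
    Continuous (fun p : ℝ × ℝ × ℝ => flow g h p.1 p.2.1 p.2.2) := by
  rw [continuous_iff_continuousAt]
  rintro ⟨s₀, t₀, x₀⟩
  rw [ContinuousAt, tendsto_iff_dist_tendsto_zero]
  simp only [Real.dist_eq]
  set E := Real.exp (3 * K * h)
  refine squeeze_zero (g := fun p : ℝ × ℝ × ℝ =>
    (K * (1 + (1 + p.2.2 ^ 2) * E) * |s₀ - p.1| + |p.2.2 - x₀|) * Real.exp (K * h)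
      + K * (1 + (1 + x₀ ^ 2) * E) * |p.2.1 - t₀|) (fun _ => abs_nonneg _) (fun p => ?_) ?_
  · rw [← hg.flow_flow p.1 s₀ p.2.1 p.2.2]
    have h1 := hg.abs_flow_sub_le s₀ p.2.1 (flow g h p.1 s₀ p.2.2) x₀
    have h2 := hg.abs_flow_time_sub_le s₀ p.2.1 t₀ x₀
    have h3 := hg.abs_flow_time_sub_le p.1 s₀ p.1 p.2.2
    rw [hg.flow_self] at h3
    have h4 : |flow g h p.1 s₀ p.2.2 - x₀|
        ≤ K * (1 + (1 + p.2.2 ^ 2) * E) * |s₀ - p.1| + |p.2.2 - x₀| :=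
      (_root_.abs_sub_le _ p.2.2 _).trans (by linarith)
    have h5 := mul_le_mul_of_nonneg_right h4 (Real.exp_pos (K * h)).le
    exact (_root_.abs_sub_le _ (flow g h s₀ p.2.1 x₀) _).trans (by linarith)
  · have : Continuous (fun p : ℝ × ℝ × ℝ =>
      (K * (1 + (1 + p.2.2 ^ 2) * E) * |s₀ - p.1| + |p.2.2 - x₀|) * Real.exp (K * h)
      + K * (1 + (1 + x₀ ^ 2) * E) * |p.2.1 - t₀|) := by fun_prop
    have h0 := this.tendsto (s₀, t₀, x₀)
    simpa using h0

end DriftHyp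

namespace DriftHyp

variable {g : ℝ → ℝ → ℝ} {h K : ℝ}

/-! #### Differentiability of the flow in the starting point -/

lemma continuousAt_driftX_flow (hg : DriftHyp g h K) (s x : ℝ) {r : ℝ} (hr : r ∈ regTime h) :
    ContinuousAt (fun r => driftX g h r (flow g h s r x)) r :=
  ContinuousAt.comp (f := fun r => (r, flow g h s r x))
    (hg.continuousAt_driftX hr (flow g h s r x))
    (continuousAt_id.prodMk (hg.continuous_flow_time s x).continuousAt)

lemma intervalIntegrable_driftX_flow (hg : DriftHyp g h K) (s x a b : ℝ) :
    IntervalIntegrable (fun r => driftX g h r (flow g h s r x)) volume a b :=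
  intervalIntegrable_of_continuousAt_regTime (fun _ hr => hg.continuousAt_driftX_flow s x hr)
    (fun _ => hg.abs_driftX_le _ _) a b

lemma abs_flowLog_le (hg : DriftHyp g h K) (s t x : ℝ) : |flowLog g h s t x| ≤ K * |t - s| := by
  rw [← Real.norm_eq_abs]
  exact intervalIntegral.norm_integral_le_of_norm_le_const (fun r _ => hg.abs_driftX_le _ _)

lemma flowLog_self (s x : ℝ) : flowLog g h s s x = 0 := intervalIntegral.integral_same

lemma hasDerivAt_flowLog_time (hg : DriftHyp g h K) (s x : ℝ) {t : ℝ} (ht : t ∈ regTime h) :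
    HasDerivAt (fun t => flowLog g h s t x) (driftX g h t (flow g h s t x)) t := by
  refine intervalIntegral.integral_hasDerivAt_right (hg.intervalIntegrable_driftX_flow s x s t) ?_
    (hg.continuousAt_driftX_flow s x ht)
  exact ContinuousAt.stronglyMeasurableAtFilter (isOpen_regTime h)
    (fun _ hr => hg.continuousAt_driftX_flow s x hr) t ht

lemma flowLog_add (hg : DriftHyp g h K) (s r t x : ℝ) :
    flowLog g h s r x + flowLog g h r t (flow g h s r x) = flowLog g h s t x := by
  unfold flowLog
  simp only [hg.flow_flow]
  exact intervalIntegral.integral_add_adjacent_intervals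
    (hg.intervalIntegrable_driftX_flow s x s r) (hg.intervalIntegrable_driftX_flow s x r t)

/-- The difference quotient of the drift along two trajectories. -/
lemma flow_sub_eq (hg : DriftHyp g h K) (s t : ℝ) {x z : ℝ} (hxz : z ≠ x) :
    flow g h s t z - flow g h s t x = (z - x) * Real.exp (∫ r in s..t,
      (drift g h r (flow g h s r z) - drift g h r (flow g h s r x))
        / (flow g h s r z - flow g h s r x)) ∧
    (∀ r, flow g h s r z - flow g h s r x ≠ 0) ∧
    (∀ r ∈ regTime h, ContinuousAt (fun r =>
      (drift g h r (flow g h s r z) - drift g h r (flow g h s r x))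
        / (flow g h s r z - flow g h s r x)) r) ∧
    ∀ r, |(drift g h r (flow g h s r z) - drift g h r (flow g h s r x))
        / (flow g h s r z - flow g h s r x)| ≤ K := by
  have hne : ∀ r, flow g h s r z - flow g h s r x ≠ 0 := by
    intro r h0
    apply hxz
    rw [← hg.flow_self s z, ← hg.flow_self s x, ← hg.flow_flow s r s z, ← hg.flow_flow s r s x,
      sub_eq_zero.1 h0]
  have hdc : ∀ y, ∀ r ∈ regTime h, ContinuousAt (fun r => drift g h r (flow g h s r y)) r :=
    fun y r hr => ContinuousAt.comp (f := fun r => (r, flow g h s r y))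
      (hg.differentiableAt_drift hr (flow g h s r y)).1.continuousAt
      (continuousAt_id.prodMk (hg.continuous_flow_time s y).continuousAt)
  have hc : ∀ r ∈ regTime h, ContinuousAt (fun r =>
      (drift g h r (flow g h s r z) - drift g h r (flow g h s r x))
        / (flow g h s r z - flow g h s r x)) r := fun r hr =>
    ((hdc z r hr).sub (hdc x r hr)).div ((hg.continuous_flow_time s z).continuousAt.sub
      (hg.continuous_flow_time s x).continuousAt) (hne r)
  have hb : ∀ r, |(drift g h r (flow g h s r z) - drift g h r (flow g h s r x))
        / (flow g h s r z - flow g h s r x)| ≤ K := by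
    intro r
    rw [abs_div, div_le_iff₀ (abs_pos.2 (hne r))]
    unfold drift
    by_cases hr : r ∈ Ioo 0 h
    · simp only [indicator_of_mem hr]
      exact hg.abs_sub_le hr _ _
    · simp only [indicator_of_notMem hr, sub_self, abs_zero]
      have := hg.K_nonneg
      positivity
  refine ⟨?_, hne, hc, hb⟩
  have := eq_mul_exp_integral_of_hasDerivAt (h := h)
    (D := fun r => flow g h s r z - flow g h s r x)
    ((hg.continuous_flow_time s z).sub (hg.continuous_flow_time s x)) (fun r hr => by
      refine ((hg.hasDerivAt_flow_time s z hr).fun_sub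
        (hg.hasDerivAt_flow_time s x hr)).congr_deriv ?_
      rw [div_mul_cancel₀ _ (hne r)]) hc hb s t
  simpa only [hg.flow_self] using this

lemma hasDerivAt_flow_space (hg : DriftHyp g h K) (s t x : ℝ) :
    HasDerivAt (fun x => flow g h s t x) (Real.exp (flowLog g h s t x)) x := by
  rw [hasDerivAt_iff_tendsto_slope]
  have hlim : Filter.Tendsto (fun z => ∫ r in s..t,
      (drift g h r (flow g h s r z) - drift g h r (flow g h s r x))
        / (flow g h s r z - flow g h s r x)) (𝓝[≠] x) (𝓝 (flowLog g h s t x)) := by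
    refine intervalIntegral.tendsto_integral_filter_of_dominated_convergence (fun _ => K) ?_ ?_
      intervalIntegrable_const ?_
    · filter_upwards [self_mem_nhdsWithin] with z hz
      obtain ⟨-, -, hc, hb⟩ := hg.flow_sub_eq s t hz
      exact (intervalIntegrable_of_continuousAt_regTime hc hb s t).def'.aestronglyMeasurable
    · filter_upwards [self_mem_nhdsWithin] with z hz
      obtain ⟨-, -, hc, hb⟩ := hg.flow_sub_eq s t hz
      exact Filter.Eventually.of_forall fun r _ => hb r
    · refine Filter.Eventually.of_forall fun r _ => ?_
      unfold drift driftX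
      by_cases hr : r ∈ Ioo 0 h
      · simp only [indicator_of_mem hr]
        have h1 := hasDerivAt_iff_tendsto_slope.1
          (hg.differentiable_space hr (flow g h s r x)).hasDerivAt
        have h2 : Filter.Tendsto (fun z => flow g h s r z) (𝓝[≠] x) (𝓝[≠] (flow g h s r x)) := by
          refine tendsto_nhdsWithin_iff.2 ⟨?_, ?_⟩
          · have : Continuous (fun z => flow g h s r z) :=
              hg.continuous_flow.comp (f := fun z => (s, r, z)) (by fun_prop)
            exact (this.tendsto x).mono_left nhdsWithin_le_nhds
          · filter_upwards [self_mem_nhdsWithin] with z hz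
            exact sub_ne_zero.1 ((hg.flow_sub_eq s t hz).2.1 r)
        refine (h1.comp h2).congr fun z => ?_
        simp [slope_def_field]
      · simp only [indicator_of_notMem hr]
        simp
  refine ((Real.continuous_exp.tendsto _).comp hlim).congr' ?_
  filter_upwards [self_mem_nhdsWithin] with z hz
  obtain ⟨he, -, -, -⟩ := hg.flow_sub_eq s t hz
  rw [slope_def_field, he, mul_div_cancel_left₀ _ (sub_ne_zero.2 hz)]
  rfl

lemma hasDerivAt_flowLog_space (hg : DriftHyp g h K) (s t x : ℝ) :
    ∃ d, HasDerivAt (fun x => flowLog g h s t x) d x ∧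
      |d| ≤ K * Real.exp (K * |t - s|) * |t - s| := by
  have hdiff : ∀ r x, HasDerivAt (fun x => driftX g h r (flow g h s r x))
      (driftXX g h r (flow g h s r x) * Real.exp (flowLog g h s r x)) x := fun r x =>
    (hg.hasDerivAt_driftX r _).comp x (hg.hasDerivAt_flow_space s r x)
  have hbound : ∀ r ∈ uIoc s t, ∀ x,
      ‖driftXX g h r (flow g h s r x) * Real.exp (flowLog g h s r x)‖
        ≤ K * Real.exp (K * |t - s|) := by
    intro r hr x
    rw [norm_mul, Real.norm_eq_abs, Real.norm_eq_abs, Real.abs_exp]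
    refine mul_le_mul (hg.abs_driftXX_le _ _) (Real.exp_le_exp.2 ?_) (Real.exp_pos _).le
      hg.K_nonneg
    refine (le_abs_self _).trans ((hg.abs_flowLog_le s r x).trans
      (mul_le_mul_of_nonneg_left ?_ hg.K_nonneg))
    exact abs_sub_left_of_mem_uIcc (uIoc_subset_uIcc hr)
  have hmeas : ∀ x, AEStronglyMeasurable (fun r => driftX g h r (flow g h s r x))
      (volume.restrict (uIoc s t)) := fun x =>
    (hg.intervalIntegrable_driftX_flow s x s t).def'.aestronglyMeasurable
  have hmeas' : AEStronglyMeasurable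
      (fun r => driftXX g h r (flow g h s r x) * Real.exp (flowLog g h s r x))
      (volume.restrict (uIoc s t)) := by
    have hu : Filter.Tendsto (fun k : ℕ => x + 1 / ((k : ℝ) + 1)) Filter.atTop (𝓝[≠] x) := by
      refine tendsto_nhdsWithin_iff.2 ⟨?_, Filter.Eventually.of_forall fun k => ?_⟩
      · simpa using tendsto_const_nhds.add (tendsto_one_div_add_atTop_nhds_zero_nat (𝕜 := ℝ))
      · have : (0 : ℝ) < 1 / ((k : ℝ) + 1) := by positivity
        simpa using by positivity
    refine aestronglyMeasurable_of_tendsto_ae Filter.atTop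
      (f := fun k : ℕ => fun r => slope (fun x => driftX g h r (flow g h s r x)) x
        (x + 1 / ((k : ℝ) + 1))) (fun k => ?_) (Filter.Eventually.of_forall fun r => ?_)
    · simp only [slope_def_field]
      exact ((hmeas _).sub (hmeas _)).mul_const _
    · exact (hasDerivAt_iff_tendsto_slope.1 (hdiff r x)).comp hu
  have := intervalIntegral.hasDerivAt_integral_of_dominated_loc_of_deriv_le (μ := volume)
    (F := fun x r => driftX g h r (flow g h s r x))
    (F' := fun x r => driftXX g h r (flow g h s r x) * Real.exp (flowLog g h s r x))
    (bound := fun _ => K * Real.exp (K * |t - s|)) (x₀ := x) (a := s) (b := t) Filter.univ_mem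
    (Filter.Eventually.of_forall hmeas) (hg.intervalIntegrable_driftX_flow s x s t) hmeas'
    (Filter.Eventually.of_forall fun r hr x _ => hbound r hr x) intervalIntegrable_const
    (Filter.Eventually.of_forall fun r _ x _ => hdiff r x)
  refine ⟨_, this.2, ?_⟩
  rw [← Real.norm_eq_abs]
  exact intervalIntegral.norm_integral_le_of_norm_le_const (fun r hr => hbound r hr x)

/-! #### Joint differentiability of the flow -/

/-- Expansion near the diagonal of a quantity whose time derivative is `b(t, flow s t x)`. -/
lemma isLittleO_diag (hg : DriftHyp g h K) {N : ℝ → ℝ → ℝ → ℝ} {b : ℝ × ℝ → ℝ} {t₀ y₀ : ℝ}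
    (ht₀ : t₀ ∈ regTime h)
    (hN : ∀ s x, ∀ t ∈ regTime h, HasDerivAt (fun t => N s t x) (b (t, flow g h s t x)) t)
    (hb : ContinuousAt b (t₀, y₀)) :
    (fun p : ℝ × ℝ × ℝ => N p.1 p.2.1 p.2.2 - N p.1 p.1 p.2.2 - b (t₀, y₀) * (p.2.1 - p.1))
      =o[𝓝 (t₀, t₀, y₀)] fun p => p.2.1 - p.1 := by
  rw [Asymptotics.isLittleO_iff]
  intro ε hε
  have hc : ContinuousAt (fun p : ℝ × ℝ × ℝ => b (p.2.1, flow g h p.1 p.2.1 p.2.2))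
      (t₀, t₀, y₀) := by
    refine ContinuousAt.comp (f := fun p : ℝ × ℝ × ℝ => (p.2.1, flow g h p.1 p.2.1 p.2.2)) ?_
      (continuous_snd.fst.prodMk hg.continuous_flow).continuousAt
    simpa only [hg.flow_self] using hb
  have h1 : ∀ᶠ p : ℝ × ℝ × ℝ in 𝓝 (t₀, t₀, y₀), p.1 ∈ regTime h ∧
      |b (p.2.1, flow g h p.1 p.2.1 p.2.2) - b (t₀, y₀)| ≤ ε := by
    have h2 := hc.eventually (Metric.closedBall_mem_nhds _ hε)
    have h3 : ∀ᶠ p : ℝ × ℝ × ℝ in 𝓝 (t₀, t₀, y₀), p.1 ∈ regTime h :=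
      (continuous_fst.tendsto (t₀, t₀, y₀)).eventually ((isOpen_regTime h).mem_nhds ht₀)
    filter_upwards [h2, h3] with p hp hp'
    simp only [hg.flow_self, Real.dist_eq] at hp
    exact ⟨hp', hp⟩
  obtain ⟨δ, hδ, hball⟩ := Metric.eventually_nhds_iff_ball.1 h1
  filter_upwards [Metric.ball_mem_nhds (t₀, t₀, y₀) hδ] with p hp
  obtain ⟨s, t, x⟩ := p
  simp only [Metric.mem_ball, Prod.dist_eq, max_lt_iff] at hp
  obtain ⟨hs, ht, hx⟩ := hp
  have hmem : ∀ r ∈ Metric.ball t₀ δ, r ∈ regTime h ∧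
      |b (r, flow g h s r x) - b (t₀, y₀)| ≤ ε := by
    intro r hr
    rw [Metric.mem_ball] at hr
    refine ⟨(hball (r, t₀, y₀) ?_).1, (hball (s, r, x) ?_).2⟩ <;>
    simp [Metric.mem_ball, Prod.dist_eq, hs, hr, hx]
  have := (convex_ball t₀ δ).norm_image_sub_le_of_norm_hasDerivWithin_le (C := ε)
    (f := fun r => N s r x - b (t₀, y₀) * r) (f' := fun r => b (r, flow g h s r x) - b (t₀, y₀))
    (fun r hr => by
      have := (hN s x r (hmem r hr).1).fun_sub ((hasDerivAt_id' r).const_mul (b (t₀, y₀)))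
      rw [mul_one] at this
      exact this.hasDerivWithinAt)
    (fun r hr => (hmem r hr).2) (x := s) (y := t) hs ht
  change ‖N s t x - N s s x - b (t₀, y₀) * (t - s)‖ ≤ ε * ‖t - s‖
  rw [show N s t x - N s s x - b (t₀, y₀) * (t - s)
    = N s t x - b (t₀, y₀) * t - (N s s x - b (t₀, y₀) * s) by ring]
  exact this

lemma hasFDerivAt_diag (hg : DriftHyp g h K) {N : ℝ → ℝ → ℝ → ℝ} {b : ℝ × ℝ → ℝ} {t₀ y₀ : ℝ}
    (ht₀ : t₀ ∈ regTime h)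
    (hN : ∀ s x, ∀ t ∈ regTime h, HasDerivAt (fun t => N s t x) (b (t, flow g h s t x)) t)
    (hb : ContinuousAt b (t₀, y₀)) {E : Type*} [NormedAddCommGroup E] [NormedSpace ℝ E]
    {σ τ X : E → ℝ} {σ' τ' : E →L[ℝ] ℝ} {p₀ : E} (hσ : HasFDerivAt σ σ' p₀)
    (hτ : HasFDerivAt τ τ' p₀) (hX : ContinuousAt X p₀) (hσ₀ : σ p₀ = t₀) (hτ₀ : τ p₀ = t₀)
    (hX₀ : X p₀ = y₀) :
    HasFDerivAt (fun p => N (σ p) (τ p) (X p) - N (σ p) (σ p) (X p)) (b (t₀, y₀) • (τ' - σ'))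
      p₀ := by
  have hd := hτ.fun_sub hσ
  have hlim : Filter.Tendsto (fun p => (σ p, τ p, X p)) (𝓝 p₀) (𝓝 (t₀, t₀, y₀)) := by
    have := hσ.continuousAt.prodMk (hτ.continuousAt.prodMk hX)
    rw [ContinuousAt, hσ₀, hτ₀, hX₀] at this
    exact this
  have h1 := (hg.isLittleO_diag ht₀ hN hb).comp_tendsto hlim
  have h2 : (fun p => τ p - σ p) =O[𝓝 p₀] fun p => p - p₀ := by
    have := hd.isBigO_sub
    simpa [hσ₀, hτ₀] using this
  have h3 : (fun p => N (σ p) (τ p) (X p) - N (σ p) (σ p) (X p) - b (t₀, y₀) * (τ p - σ p))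
      =o[𝓝 p₀] fun p => p - p₀ := h1.trans_isBigO h2
  have h4 := (hd.const_mul (b (t₀, y₀)))
  rw [hasFDerivAt_iff_isLittleO] at h4 ⊢
  refine (h3.add h4).congr_left fun p => ?_
  simp [hσ₀, hτ₀]

end DriftHyp

namespace DriftHyp

variable {g : ℝ → ℝ → ℝ} {h K : ℝ}

/-- The backward flow `(s, x) ↦ flow s s₀ x` near the diagonal `s = s₀`. -/
lemma hasFDerivAt_flow_start (hg : DriftHyp g h K) {s₀ t₀ x₀ : ℝ} (hs₀ : s₀ ∈ regTime h) :
    HasFDerivAt (fun p : ℝ × ℝ × ℝ => flow g h p.1 s₀ p.2.2)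
      (ContinuousLinearMap.snd ℝ ℝ ℝ ∘L ContinuousLinearMap.snd ℝ ℝ (ℝ × ℝ)
        - drift g h s₀ x₀ • ContinuousLinearMap.fst ℝ ℝ (ℝ × ℝ)) (s₀, t₀, x₀) := by
  have h1 := hg.hasFDerivAt_diag (N := flow g h) (b := fun p => drift g h p.1 p.2) hs₀
    (fun s x t ht => hg.hasDerivAt_flow_time s x ht)
    (hg.differentiableAt_drift hs₀ x₀).1.continuousAt (p₀ := ((s₀, t₀, x₀) : ℝ × ℝ × ℝ))
    (σ := fun p => p.1) (τ := fun _ => s₀) (X := fun p => p.2.2) hasFDerivAt_fst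
    (hasFDerivAt_const _ _) (by fun_prop) rfl rfl rfl
  have h2 : HasFDerivAt (fun p : ℝ × ℝ × ℝ => p.2.2)
      (ContinuousLinearMap.snd ℝ ℝ ℝ ∘L ContinuousLinearMap.snd ℝ ℝ (ℝ × ℝ)) (s₀, t₀, x₀) :=
    hasFDerivAt_snd.comp (s₀, t₀, x₀) hasFDerivAt_snd
  have h3 := h1.fun_add h2
  simp only [hg.flow_self, sub_add_cancel] at h3
  refine h3.congr_fderiv ?_
  ext <;> simp

lemma hasFDerivAt_flow (hg : DriftHyp g h K) {s₀ t₀ x₀ : ℝ} (hs₀ : s₀ ∈ regTime h)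
    (ht₀ : t₀ ∈ regTime h) :
    HasFDerivAt (fun p : ℝ × ℝ × ℝ => flow g h p.1 p.2.1 p.2.2)
      (Real.exp (flowLog g h s₀ t₀ x₀) •
        (ContinuousLinearMap.snd ℝ ℝ ℝ ∘L ContinuousLinearMap.snd ℝ ℝ (ℝ × ℝ)
          - drift g h s₀ x₀ • ContinuousLinearMap.fst ℝ ℝ (ℝ × ℝ))
        + drift g h t₀ (flow g h s₀ t₀ x₀) •
          (ContinuousLinearMap.fst ℝ ℝ ℝ ∘L ContinuousLinearMap.snd ℝ ℝ (ℝ × ℝ)))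
      (s₀, t₀, x₀) := by
  have hA := hg.hasFDerivAt_flow_start (t₀ := t₀) (x₀ := x₀) hs₀
  have hQ : HasFDerivAt (fun p : ℝ × ℝ × ℝ => flow g h s₀ t₀ (flow g h p.1 s₀ p.2.2)) _
      (s₀, t₀, x₀) :=
    HasDerivAt.comp_hasFDerivAt (f := fun p : ℝ × ℝ × ℝ => flow g h p.1 s₀ p.2.2) (s₀, t₀, x₀)
      (hg.hasDerivAt_flow_space s₀ t₀ (flow g h s₀ s₀ x₀)) hA
  have hdT : HasFDerivAt (fun p : ℝ × ℝ × ℝ => p.2.1)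
      (ContinuousLinearMap.fst ℝ ℝ ℝ ∘L ContinuousLinearMap.snd ℝ ℝ (ℝ × ℝ)) (s₀, t₀, x₀) :=
    hasFDerivAt_fst.comp (s₀, t₀, x₀) hasFDerivAt_snd
  have hE := hg.hasFDerivAt_diag (N := flow g h) (b := fun p => drift g h p.1 p.2) ht₀
    (fun s x t ht => hg.hasDerivAt_flow_time s x ht)
    (hg.differentiableAt_drift ht₀ (flow g h s₀ t₀ x₀)).1.continuousAt
    (p₀ := ((s₀, t₀, x₀) : ℝ × ℝ × ℝ))
    (σ := fun _ => t₀) (τ := fun p => p.2.1)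
    (X := fun p => flow g h s₀ t₀ (flow g h p.1 s₀ p.2.2)) (hasFDerivAt_const _ _)
    hdT hQ.continuousAt rfl rfl (by simp only [hg.flow_self])
  have hsum := hE.fun_add hQ
  simp only [hg.flow_self, sub_add_cancel, hg.flow_flow] at hsum
  refine hsum.congr_fderiv ?_
  rw [sub_zero, add_comm]

lemma hasFDerivAt_flowLog (hg : DriftHyp g h K) {s₀ t₀ x₀ : ℝ} (hs₀ : s₀ ∈ regTime h)
    (ht₀ : t₀ ∈ regTime h) :
    ∃ d, |d| ≤ K * Real.exp (K * |t₀ - s₀|) * |t₀ - s₀| ∧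
    HasFDerivAt (fun p : ℝ × ℝ × ℝ => flowLog g h p.1 p.2.1 p.2.2)
      (d • (ContinuousLinearMap.snd ℝ ℝ ℝ ∘L ContinuousLinearMap.snd ℝ ℝ (ℝ × ℝ)
          - drift g h s₀ x₀ • ContinuousLinearMap.fst ℝ ℝ (ℝ × ℝ))
        - driftX g h s₀ x₀ • ContinuousLinearMap.fst ℝ ℝ (ℝ × ℝ)
        + driftX g h t₀ (flow g h s₀ t₀ x₀) •
          (ContinuousLinearMap.fst ℝ ℝ ℝ ∘L ContinuousLinearMap.snd ℝ ℝ (ℝ × ℝ)))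
      (s₀, t₀, x₀) := by
  have hA := hg.hasFDerivAt_flow_start (t₀ := t₀) (x₀ := x₀) hs₀
  obtain ⟨d, hd, hdb⟩ := hg.hasDerivAt_flowLog_space s₀ t₀ (flow g h s₀ s₀ x₀)
  refine ⟨d, hdb, ?_⟩
  have hM : HasFDerivAt (fun p : ℝ × ℝ × ℝ => flowLog g h s₀ t₀ (flow g h p.1 s₀ p.2.2)) _
      (s₀, t₀, x₀) :=
    HasDerivAt.comp_hasFDerivAt (f := fun p : ℝ × ℝ × ℝ => flow g h p.1 s₀ p.2.2) (s₀, t₀, x₀)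
      hd hA
  have hdT : HasFDerivAt (fun p : ℝ × ℝ × ℝ => p.2.1)
      (ContinuousLinearMap.fst ℝ ℝ ℝ ∘L ContinuousLinearMap.snd ℝ ℝ (ℝ × ℝ)) (s₀, t₀, x₀) :=
    hasFDerivAt_fst.comp (s₀, t₀, x₀) hasFDerivAt_snd
  have hQ : ContinuousAt (fun p : ℝ × ℝ × ℝ => flow g h p.1 t₀ p.2.2) (s₀, t₀, x₀) :=
    (hg.continuous_flow.comp (f := fun p : ℝ × ℝ × ℝ => (p.1, t₀, p.2.2))
      (by fun_prop)).continuousAt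
  have hE := hg.hasFDerivAt_diag (N := flowLog g h) (b := fun p => driftX g h p.1 p.2) ht₀
    (fun s x t ht => hg.hasDerivAt_flowLog_time s x ht)
    (hg.continuousAt_driftX ht₀ (flow g h s₀ t₀ x₀))
    (p₀ := ((s₀, t₀, x₀) : ℝ × ℝ × ℝ))
    (σ := fun _ => t₀) (τ := fun p => p.2.1)
    (X := fun p => flow g h p.1 t₀ p.2.2) (hasFDerivAt_const _ _)
    hdT hQ rfl rfl rfl
  have hB := hg.hasFDerivAt_diag (N := flowLog g h) (b := fun p => driftX g h p.1 p.2) hs₀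
    (fun s x t ht => hg.hasDerivAt_flowLog_time s x ht)
    (hg.continuousAt_driftX hs₀ x₀) (p₀ := ((s₀, t₀, x₀) : ℝ × ℝ × ℝ))
    (σ := fun p => p.1) (τ := fun _ => s₀) (X := fun p => p.2.2) hasFDerivAt_fst
    (hasFDerivAt_const _ _) (by fun_prop) rfl rfl rfl
  have hsum := (hB.fun_add hM).fun_add hE
  simp only [flowLog_self, sub_zero, hg.flowLog_add] at hsum
  refine hsum.congr_fderiv ?_
  rw [zero_sub, smul_neg]
  abel

/-- The domain on which the flow has bounded derivatives up to order two. -/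
def flowDomain (h R : ℝ) : Set (ℝ × ℝ × ℝ) :=
  (regTime h ∩ Ioo (-2) (h + 2)) ×ˢ (regTime h ∩ Ioo (-2) (h + 2)) ×ˢ Ioo (-R) R

lemma isOpen_flowDomain (h R : ℝ) : IsOpen (flowDomain h R) :=
  ((isOpen_regTime h).inter isOpen_Ioo).prod (((isOpen_regTime h).inter isOpen_Ioo).prod isOpen_Ioo)

lemma C1b_drift (hg : DriftHyp g h K) (R : ℝ) :
    C1b (regTime h ×ˢ Ioo (-R) R) (fun p : ℝ × ℝ => drift g h p.1 p.2) := by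
  refine C1b.of_hasFDerivAt (C := K * (1 + R)) (C' := K)
    (fun p hp => (hg.differentiableAt_drift hp.1 p.2).1.hasFDerivAt) (fun p hp => ?_)
    (fun p hp => (hg.differentiableAt_drift hp.1 p.2).2)
  refine (hg.abs_drift_le _ _).trans (mul_le_mul_of_nonneg_left ?_ hg.K_nonneg)
  have : |p.2| ≤ R := abs_le.2 ⟨hp.2.1.le, hp.2.2.le⟩
  linarith

lemma abs_sub_le_of_mem_flowDomain {R : ℝ} {p : ℝ × ℝ × ℝ}
    (hp : p ∈ flowDomain h R) : |p.2.1 - p.1| ≤ h + 4 := by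
  obtain ⟨⟨-, h1⟩, ⟨-, h2⟩, -⟩ := hp
  exact abs_le.2 ⟨by linarith [h1.1, h1.2, h2.1, h2.2], by linarith [h1.1, h1.2, h2.1, h2.2]⟩

lemma C1b_proj {R : ℝ} (hg : DriftHyp g h K) :
    C1b (flowDomain h R) (fun p : ℝ × ℝ × ℝ => p) := by
  refine C1b.of_hasFDerivAt (C := max (h + 2) (max (h + 2) R)) (C' := 1)
    (fun p hp => hasFDerivAt_id p) (fun p hp => ?_)
    (fun p hp => ContinuousLinearMap.norm_id_le)
  obtain ⟨⟨-, h1⟩, ⟨-, h2⟩, h3⟩ := hp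
  have := hg.h_pos
  exact max_le_max (abs_le.2 ⟨by linarith [h1.1], h1.2.le⟩)
    (max_le_max (abs_le.2 ⟨by linarith [h2.1], h2.2.le⟩) (abs_le.2 ⟨h3.1.le, h3.2.le⟩))

lemma C1b_flowLog (hg : DriftHyp g h K) (R : ℝ) :
    C1b (flowDomain h R) (fun p : ℝ × ℝ × ℝ => flowLog g h p.1 p.2.1 p.2.2) := by
  have hK := hg.K_nonneg
  have hh := hg.h_pos
  choose! d hdb hd using fun p (hp : p ∈ flowDomain h R) =>
    hg.hasFDerivAt_flowLog (s₀ := p.1) (t₀ := p.2.1) (x₀ := p.2.2) hp.1.1 hp.2.1.1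
  refine C1b.of_hasFDerivAt (C := K * (h + 4))
    (C' := K * Real.exp (K * (h + 4)) * (h + 4) *
      (‖ContinuousLinearMap.snd ℝ ℝ ℝ ∘L ContinuousLinearMap.snd ℝ ℝ (ℝ × ℝ)‖
        + K * (1 + R) * ‖ContinuousLinearMap.fst ℝ ℝ (ℝ × ℝ)‖)
      + K * ‖ContinuousLinearMap.fst ℝ ℝ (ℝ × ℝ)‖
      + K * ‖ContinuousLinearMap.fst ℝ ℝ ℝ ∘L ContinuousLinearMap.snd ℝ ℝ (ℝ × ℝ)‖)
    (fun p hp => hd p hp) (fun p hp => ?_) (fun p hp => ?_)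
  · exact (hg.abs_flowLog_le _ _ _).trans
      (mul_le_mul_of_nonneg_left (abs_sub_le_of_mem_flowDomain hp) hK)
  · have hts := abs_sub_le_of_mem_flowDomain hp
    have hx : |p.2.2| ≤ R := abs_le.2 ⟨hp.2.2.1.le, hp.2.2.2.le⟩
    have hR : 0 ≤ R := (abs_nonneg _).trans hx
    have h1 : |d p| ≤ K * Real.exp (K * (h + 4)) * (h + 4) := by
      refine (hdb p hp).trans ?_
      gcongr
    have h2 : |drift g h p.1 p.2.2| ≤ K * (1 + R) :=
      (hg.abs_drift_le _ _).trans (mul_le_mul_of_nonneg_left (by linarith) hK)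
    refine (norm_add_le _ _).trans (add_le_add ((norm_sub_le _ _).trans (add_le_add ?_ ?_)) ?_)
    · rw [norm_smul]
      refine mul_le_mul h1 ((norm_sub_le _ _).trans (add_le_add le_rfl ?_)) (norm_nonneg _)
        (by positivity)
      rw [norm_smul]
      exact mul_le_mul_of_nonneg_right h2 (norm_nonneg _)
    · rw [norm_smul]
      exact mul_le_mul_of_nonneg_right (hg.abs_driftX_le _ _) (norm_nonneg _)
    · rw [norm_smul]
      exact mul_le_mul_of_nonneg_right (hg.abs_driftX_le _ _) (norm_nonneg _)

lemma C2b_flow (hg : DriftHyp g h K) (R : ℝ) :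
    C2b (flowDomain h R) (fun p : ℝ × ℝ × ℝ => flow g h p.1 p.2.1 p.2.2) := by
  have hid := hg.C1b_proj (R := R)
  have hs : C1b (flowDomain h R) (fun p : ℝ × ℝ × ℝ => p.1) :=
    hid.clm (ContinuousLinearMap.fst ℝ ℝ (ℝ × ℝ))
  have ht : C1b (flowDomain h R) (fun p : ℝ × ℝ × ℝ => p.2.1) :=
    hid.clm (ContinuousLinearMap.fst ℝ ℝ ℝ ∘L ContinuousLinearMap.snd ℝ ℝ (ℝ × ℝ))
  have hx : C1b (flowDomain h R) (fun p : ℝ × ℝ × ℝ => p.2.2) :=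
    hid.clm (ContinuousLinearMap.snd ℝ ℝ ℝ ∘L ContinuousLinearMap.snd ℝ ℝ (ℝ × ℝ))
  set R' : ℝ := (1 + R ^ 2) * Real.exp (3 * K * h) with hR'
  have hfb : ∀ p ∈ flowDomain h R, |flow g h p.1 p.2.1 p.2.2| ≤ R' := by
    intro p hp
    refine (hg.abs_flow_le _ _ _).trans (mul_le_mul_of_nonneg_right ?_ (Real.exp_pos _).le)
    have := sq_le_sq' hp.2.2.1.le hp.2.2.2.le
    linarith
  have hE := (hg.C1b_flowLog R).exp
  have hds : C1b (flowDomain h R) (fun p : ℝ × ℝ × ℝ => drift g h p.1 p.2.2) :=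
    (hg.C1b_drift R).comp (hs.prodMk hx) fun p hp => ⟨hp.1.1, hp.2.2⟩
  have hF' : ∀ p ∈ flowDomain h R, HasFDerivAt (fun p : ℝ × ℝ × ℝ => flow g h p.1 p.2.1 p.2.2) _ p
    := fun p hp => hg.hasFDerivAt_flow (s₀ := p.1) (t₀ := p.2.1) (x₀ := p.2.2) hp.1.1 hp.2.1.1
  have hQ : C1b (flowDomain h R) (fun p => Real.exp (flowLog g h p.1 p.2.1 p.2.2) •
        (ContinuousLinearMap.snd ℝ ℝ ℝ ∘L ContinuousLinearMap.snd ℝ ℝ (ℝ × ℝ)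
          - drift g h p.1 p.2.2 • ContinuousLinearMap.fst ℝ ℝ (ℝ × ℝ))) :=
    hE.smul ((C1b.const _ _).sub (hds.smul (C1b.const _ _)))
  have hflow1 : C1b (flowDomain h R) (fun p : ℝ × ℝ × ℝ => flow g h p.1 p.2.1 p.2.2) := by
    obtain ⟨C, -, hC⟩ := hQ.bdd
    refine C1b.of_hasFDerivAt (C := R') (C' := C + K * (1 + R') *
      ‖ContinuousLinearMap.fst ℝ ℝ ℝ ∘L ContinuousLinearMap.snd ℝ ℝ (ℝ × ℝ)‖) hF' hfb
      fun p hp => (norm_add_le _ _).trans (add_le_add (hC p hp) ?_)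
    rw [norm_smul]
    refine mul_le_mul_of_nonneg_right ((hg.abs_drift_le _ _).trans
      (mul_le_mul_of_nonneg_left ?_ hg.K_nonneg)) (norm_nonneg _)
    linarith [hfb p hp]
  have hdt : C1b (flowDomain h R)
      (fun p : ℝ × ℝ × ℝ => drift g h p.2.1 (flow g h p.1 p.2.1 p.2.2)) :=
    (hg.C1b_drift (R' + 1)).comp (ht.prodMk hflow1) fun p hp => ⟨hp.2.1.1, by
      have := abs_le.1 (hfb p hp)
      exact ⟨by linarith [this.1], by linarith [this.2]⟩⟩
  exact C2b.of_hasFDerivAt (isOpen_flowDomain h R) hF' hfb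
    (hQ.add (hdt.smul (C1b.const _ _)))

end DriftHyp

/-! ### The solution of the deterministic equation as a composition of flows and jumps -/

/-- The value just after the `j`-th jump. -/
def jumpState (c : ℝ → ℝ → ℝ → ℝ) (g : ℝ → ℝ → ℝ) (h : ℝ) (τ δ : ℕ → ℝ) (x : ℝ) : ℕ → ℝ
  | 0 => x
  | j + 1 => flow g h (τ j) (τ (j + 1)) (jumpState c g h τ δ x j)
      + c (τ (j + 1)) (δ (j + 1)) (flow g h (τ j) (τ (j + 1)) (jumpState c g h τ δ x j))

/-- The amplitudes as a sequence; coordinate `j : Fin n` of `a` is the `(j+1)`-st amplitude. -/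
def markSeq {n : ℕ} (a : Fin n → ℝ) : ℕ → ℝ
  | 0 => 0
  | j + 1 => if hj : j < n then a ⟨j, hj⟩ else 0

/-- The open set of jump times `0 < u_1 < ⋯ < u_n < t` and amplitudes in `I`. -/
def mixedRegion (t : ℝ) (I : Set ℝ) (n : ℕ) : Set (Fin n ⊕ Fin n → ℝ) :=
  {v | (∀ j ≤ n, knot t (fun i => v (Sum.inl i)) j < knot t (fun i => v (Sum.inl i)) (j + 1)) ∧
    ∀ i, v (Sum.inr i) ∈ I}

lemma knot_succ_of_lt {n : ℕ} (t : ℝ) (u : Fin n → ℝ) {j : ℕ} (hj : j < n) :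
    knot t u (j + 1) = u ⟨j, hj⟩ := by simp [knot, hj]

lemma knot_last {n : ℕ} (t : ℝ) (u : Fin n → ℝ) : knot t u (n + 1) = t := by simp [knot]

lemma markSeq_succ_of_lt {n : ℕ} (a : Fin n → ℝ) {j : ℕ} (hj : j < n) :
    markSeq a (j + 1) = a ⟨j, hj⟩ := by simp [markSeq, hj]

lemma knot_lt_knot {t : ℝ} {n : ℕ} {u : Fin n → ℝ} (hu : ∀ j ≤ n, knot t u j < knot t u (j + 1))
    {i j : ℕ} (hij : i < j) (hj : j ≤ n + 1) : knot t u i < knot t u j := by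
  induction j, hij using Nat.le_induction with
  | base => exact hu i (by omega)
  | succ k hk ih => exact (ih (by omega)).trans (hu k (by omega))

lemma continuous_knot {n : ℕ} (t : ℝ) (j : ℕ) : Continuous (fun u : Fin n → ℝ => knot t u j) := by
  rcases j with - | j
  · exact continuous_const
  · by_cases hj : j < n
    · simp only [knot_succ_of_lt t _ hj]; fun_prop
    · simp only [knot, hj, dite_false]; fun_prop

lemma isOpen_mixedRegion (t : ℝ) {I : Set ℝ} (hI : IsOpen I) (n : ℕ) :
    IsOpen (mixedRegion t I n) := by
  have h1 : mixedRegion t I n = (⋂ j ∈ Finset.range (n + 1),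
      {v : Fin n ⊕ Fin n → ℝ | knot t (fun i => v (Sum.inl i)) j
        < knot t (fun i => v (Sum.inl i)) (j + 1)}) ∩ ⋂ i, {v | v (Sum.inr i) ∈ I} := by
    ext v
    simp [mixedRegion]
  rw [h1]
  refine IsOpen.inter (isOpen_biInter_finset fun j _ => ?_) (isOpen_iInter_of_finite fun i => ?_)
  · have hc : Continuous (fun (v : Fin n ⊕ Fin n → ℝ) (i : Fin n) => v (Sum.inl i)) := by fun_prop
    exact isOpen_lt ((continuous_knot t j).comp hc) ((continuous_knot t (j + 1)).comp hc)
  · exact hI.preimage (continuous_apply _)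

/-- The starting time of the `j`-th piece, with `0` replaced by `-1`. -/
def startTime {n : ℕ} (t : ℝ) (u : Fin n → ℝ) : ℕ → ℝ
  | 0 => -1
  | j + 1 => knot t u (j + 1)

lemma clampTime_startTime {n : ℕ} (h t : ℝ) (u : Fin n → ℝ) (j : ℕ) :
    clampTime h (startTime t u j) = clampTime h (knot t u j) := by
  rcases j with - | j
  · rw [startTime, knot, clampTime_of_nonpos (by norm_num), clampTime_of_nonpos le_rfl]
  · rfl

lemma knot_mem_Ioo {h t : ℝ} (hth : t ≤ h) {n : ℕ} {u : Fin n → ℝ}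
    (hu : ∀ j ≤ n, knot t u j < knot t u (j + 1)) {j : ℕ} (hj0 : 0 < j) (hj : j ≤ n) :
    knot t u j ∈ Ioo 0 h := by
  have h1 := knot_lt_knot hu hj0 (by omega)
  have h2 := knot_lt_knot hu (Nat.lt_succ_of_le hj) le_rfl
  rw [Nat.succ_eq_add_one, knot_last] at h2
  exact ⟨h1, h2.trans_le hth⟩

lemma knot_mem_regTime {h t : ℝ} (hth : t ≤ h) {n : ℕ} {u : Fin n → ℝ}
    (hu : ∀ j ≤ n, knot t u j < knot t u (j + 1)) {j : ℕ} (hj0 : 0 < j) (hj : j ≤ n) :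
    knot t u j ∈ regTime h ∩ Ioo (-2) (h + 2) := by
  have := knot_mem_Ioo hth hu hj0 hj
  exact ⟨⟨this.1.ne', this.2.ne⟩, by linarith [this.1], by linarith [this.2]⟩

lemma startTime_mem {h t : ℝ} (hh : 0 < h) (hth : t ≤ h) {n : ℕ} {u : Fin n → ℝ}
    (hu : ∀ j ≤ n, knot t u j < knot t u (j + 1)) {j : ℕ} (hj : j ≤ n) :
    startTime t u j ∈ regTime h ∩ Ioo (-2) (h + 2) := by
  rcases j with - | j
  · simp only [startTime]
    exact ⟨⟨by norm_num, by linarith⟩, by norm_num, by linarith⟩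
  · exact knot_mem_regTime hth hu (Nat.succ_pos j) hj

/-- The assumptions on the jump coefficient used for the regularity of the deterministic
solution. -/
structure JumpHyp (c : ℝ → ℝ → ℝ → ℝ) (g : ℝ → ℝ → ℝ) (h K ε : ℝ) (I : Set ℝ) : Prop where
  drift_hyp : DriftHyp g h K
  isOpen : IsOpen I
  bdd : Bornology.IsBounded I
  jump : ∀ R, C2b (Ioo 0 h ×ˢ I ×ˢ Ioo (-R) R) (fun p : ℝ × ℝ × ℝ => c p.1 p.2.1 p.2.2)
  pos : 0 < ε
  time : ∀ r ∈ Ioo 0 h, ∀ a ∈ I, ∀ y, ε ≤ |timeSens c g r a y|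
  mark : ∀ r ∈ Ioo 0 h, ∀ a ∈ I, ∀ y, ε ≤ |deriv (fun b => c r b y) a|
  flow : ∀ r ∈ Ioo 0 h, ∀ a ∈ I, ∀ y, ε ≤ |1 + deriv (fun z => c r a z) y|

section Regularity

variable {c : ℝ → ℝ → ℝ → ℝ} {g : ℝ → ℝ → ℝ} {h K ε : ℝ} {I : Set ℝ}

lemma JumpHyp.differentiableAt (hJ : JumpHyp c g h K ε I) {r a : ℝ} (hr : r ∈ Ioo 0 h)
    (ha : a ∈ I) (z : ℝ) :
    DifferentiableAt ℝ (fun p : ℝ × ℝ × ℝ => c p.1 p.2.1 p.2.2) (r, a, z) :=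
  (hJ.jump (|z| + 1)).1.differentiableAt
    ⟨hr, ha, by linarith [neg_abs_le z], by linarith [le_abs_self z]⟩

/-- The differential of the jump coefficient in terms of its partial derivatives. -/
lemma JumpHyp.fderiv_apply (hJ : JumpHyp c g h K ε I) {r a : ℝ} (hr : r ∈ Ioo 0 h)
    (ha : a ∈ I) (z α β γ : ℝ) :
    fderiv ℝ (fun p : ℝ × ℝ × ℝ => c p.1 p.2.1 p.2.2) (r, a, z) (α, β, γ)
      = deriv (fun r => c r a z) r * α + deriv (fun b => c r b z) a * β
        + deriv (fun z => c r a z) z * γ := by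
  have hd := (hJ.differentiableAt hr ha z).hasFDerivAt
  have h1 : HasDerivAt (fun r => c r a z) _ r := HasFDerivAt.comp_hasDerivAt r hd
    (f := fun r : ℝ => ((r, a, z) : ℝ × ℝ × ℝ))
    ((hasDerivAt_id r).prodMk (hasDerivAt_const r (a, z)))
  have h2 : HasDerivAt (fun b => c r b z) _ a := HasFDerivAt.comp_hasDerivAt a hd
    (f := fun b : ℝ => ((r, b, z) : ℝ × ℝ × ℝ))
    ((hasDerivAt_const a r).prodMk ((hasDerivAt_id a).prodMk (hasDerivAt_const a z)))
  have h3 : HasDerivAt (fun y => c r a y) _ z := HasFDerivAt.comp_hasDerivAt z hd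
    (f := fun y : ℝ => ((r, a, y) : ℝ × ℝ × ℝ))
    ((hasDerivAt_const z r).prodMk ((hasDerivAt_const z a).prodMk (hasDerivAt_id z)))
  rw [h1.deriv, h2.deriv, h3.deriv]
  have : ((α, β, γ) : ℝ × ℝ × ℝ) = α • (1, (0, 0)) + β • (0, (1, 0)) + γ • (0, (0, 1)) := by
    ext <;> simp
  rw [this]
  simp only [map_add, map_smul, smul_eq_mul]
  simp only [Prod.mk_zero_zero]
  ring

/-- The parameter domain: starting points near `x₀` and `v` in the region. -/
def paramDomain (t x₀ : ℝ) (I : Set ℝ) (n : ℕ) : Set (ℝ × (Fin n ⊕ Fin n → ℝ)) :=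
  Ioo (x₀ - 1) (x₀ + 1) ×ˢ mixedRegion t I n

/-- The value after `j` jumps, as a function of the starting point and of `v`. -/
def paramState (c : ℝ → ℝ → ℝ → ℝ) (g : ℝ → ℝ → ℝ) (h t : ℝ) {n : ℕ} (j : ℕ)
    (p : ℝ × (Fin n ⊕ Fin n → ℝ)) : ℝ :=
  jumpState c g h (knot t fun i => p.2 (Sum.inl i)) (markSeq fun i => p.2 (Sum.inr i)) p.1 j

lemma isOpen_paramDomain (t x₀ : ℝ) (hI : IsOpen I) (n : ℕ) :
    IsOpen (paramDomain t x₀ I n) :=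
  isOpen_Ioo.prod (isOpen_mixedRegion t hI n)

lemma bdd_paramDomain {t : ℝ} (x₀ : ℝ) (hI : Bornology.IsBounded I) (n : ℕ) :
    ∃ C, ∀ p ∈ paramDomain t x₀ I n, ‖p‖ ≤ C := by
  obtain ⟨B, hB⟩ := hI.exists_norm_le
  refine ⟨max (|x₀| + 1) (max |t| (max B 0)), fun p hp => ?_⟩
  refine max_le_max ?_ ?_
  · have := hp.1
    rw [Real.norm_eq_abs, abs_le]
    exact ⟨by linarith [neg_abs_le x₀, this.1], by linarith [le_abs_self x₀, this.2]⟩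
  · rw [pi_norm_le_iff_of_nonneg (by positivity)]
    rintro (i | i)
    · refine le_max_of_le_left ?_
      have := knot_mem_Ioo (le_refl t) hp.2.1 (Nat.succ_pos i) i.2
      rw [Nat.succ_eq_add_one, knot_succ_of_lt _ _ i.2] at this
      rw [Real.norm_eq_abs, abs_of_pos this.1]
      exact this.2.le.trans (le_abs_self t)
    · exact le_max_of_le_right (le_max_of_le_left (hB _ (hp.2.2 i)))

/-- The coordinate functional `p ↦ p.2 k`. -/
def coordCLM {n : ℕ} (k : Fin n ⊕ Fin n) : (ℝ × (Fin n ⊕ Fin n → ℝ)) →L[ℝ] ℝ :=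
  ContinuousLinearMap.proj k ∘L ContinuousLinearMap.snd ℝ ℝ (Fin n ⊕ Fin n → ℝ)

/-- The coordinate direction `(0, e_k)`. -/
def coordDir {n : ℕ} (k : Fin n ⊕ Fin n) : ℝ × (Fin n ⊕ Fin n → ℝ) := (0, Pi.single k 1)

lemma coordCLM_coordDir {n : ℕ} (k l : Fin n ⊕ Fin n) :
    coordCLM k (coordDir l) = if k = l then 1 else 0 := by
  simp [coordCLM, coordDir, Pi.single_apply]

lemma C2b_startTime (hI : IsOpen I) (hb : Bornology.IsBounded I) (t x₀ : ℝ) {n : ℕ}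
    {j : ℕ} (hj : j ≤ n) :
    C2b (paramDomain t x₀ I n) (fun p => startTime t (fun i => p.2 (Sum.inl i)) j) := by
  rcases j with - | j
  · exact C2b.const _
  · simp only [startTime, knot_succ_of_lt t _ hj]
    exact C2b.clm_self (coordCLM (Sum.inl ⟨j, hj⟩)) (isOpen_paramDomain t x₀ hI n)
      (bdd_paramDomain x₀ hb n)

/-- The reduced differential `dY_j - g(u_j, Y_j) du_j` of the state after `j` jumps. -/
def reducedD (c : ℝ → ℝ → ℝ → ℝ) (g : ℝ → ℝ → ℝ) (h t : ℝ) {n : ℕ} (j : ℕ)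
    (p : ℝ × (Fin n ⊕ Fin n → ℝ)) : (ℝ × (Fin n ⊕ Fin n → ℝ)) →L[ℝ] ℝ :=
  fderiv ℝ (paramState c g h t j) p
    - drift g h (startTime t (fun i => p.2 (Sum.inl i)) j) (paramState c g h t j p) •
      fderiv ℝ (fun p : ℝ × (Fin n ⊕ Fin n → ℝ) => startTime t (fun i => p.2 (Sum.inl i)) j) p

lemma exists_flow_bound (hJ : JumpHyp c g h K ε I) (h' : ℝ) :
    ∃ κ, 0 < κ ∧ ∀ s t x : ℝ, |t - s| ≤ h' → κ ≤ Real.exp (flowLog g h s t x) := by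
  refine ⟨Real.exp (-(K * h')), Real.exp_pos _, fun s t x hst => Real.exp_le_exp.2 ?_⟩
  have h1 := hJ.drift_hyp.abs_flowLog_le s t x
  have h2 := mul_le_mul_of_nonneg_left hst hJ.drift_hyp.K_nonneg
  linarith [neg_abs_le (flowLog g h s t x)]

/-- Flowing from the state after `j` jumps up to a smooth time `τ`. -/
lemma C2b_flow_paramState (hJ : JumpHyp c g h K ε I) {t x₀ : ℝ} (hth : t ≤ h) {n j : ℕ}
    (hj : j ≤ n) (hY : C2b (paramDomain t x₀ I n) (paramState c g h t j))
    {τ : ℝ × (Fin n ⊕ Fin n → ℝ) → ℝ} (hτ : C2b (paramDomain t x₀ I n) τ)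
    (hτm : ∀ p ∈ paramDomain t x₀ I n, τ p ∈ regTime h ∩ Ioo (-2) (h + 2)) :
    C2b (paramDomain t x₀ I n) (fun p =>
      JumpIBP.flow g h (knot t (fun i => p.2 (Sum.inl i)) j) (τ p) (paramState c g h t j p)) ∧
    ∀ p ∈ paramDomain t x₀ I n, HasFDerivAt (fun p =>
      JumpIBP.flow g h (knot t (fun i => p.2 (Sum.inl i)) j) (τ p) (paramState c g h t j p))
      (Real.exp (flowLog g h (startTime t (fun i => p.2 (Sum.inl i)) j) (τ p)
        (paramState c g h t j p)) • reducedD c g h t j p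
        + drift g h (τ p) (JumpIBP.flow g h (knot t (fun i => p.2 (Sum.inl i)) j) (τ p)
          (paramState c g h t j p)) • fderiv ℝ τ p) p := by
  have hg := hJ.drift_hyp
  have hW := isOpen_paramDomain t x₀ hJ.isOpen n
  have hσ := C2b_startTime hJ.isOpen hJ.bdd t x₀ hj
  have heq : ∀ p : ℝ × (Fin n ⊕ Fin n → ℝ), ∀ τ y,
      JumpIBP.flow g h (knot t (fun i => p.2 (Sum.inl i)) j) τ y
        = JumpIBP.flow g h (startTime t (fun i => p.2 (Sum.inl i)) j) τ y := fun p τ y =>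
    DriftHyp.flow_congr_left (clampTime_startTime h t _ j).symm τ y
  simp only [heq]
  obtain ⟨R, hR0, hR⟩ := hY.1.bdd
  have hin := hσ.prodMk hW (hτ.prodMk hW hY)
  refine ⟨(hg.C2b_flow (R + 1)).comp hW hin fun p hp => ?_, fun p hp => ?_⟩
  · have hb := abs_le.1 (hR p hp)
    exact ⟨startTime_mem hg.h_pos hth hp.2.1 hj, hτm p hp, by linarith [hb.1], by linarith [hb.2]⟩
  · have h1 := hg.hasFDerivAt_flow (x₀ := paramState c g h t j p)
      (startTime_mem hg.h_pos hth hp.2.1 hj).1 (hτm p hp).1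
    have h2 := (hσ.1.differentiableAt hp).hasFDerivAt.prodMk
      ((hτ.1.differentiableAt hp).hasFDerivAt.prodMk (hY.1.differentiableAt hp).hasFDerivAt)
    refine (HasFDerivAt.comp p h1 h2).congr_fderiv ?_
    ext1 <;> (ext; simp [reducedD])

end Regularity

section Regularity

variable {c : ℝ → ℝ → ℝ → ℝ} {g : ℝ → ℝ → ℝ} {h K ε : ℝ} {I : Set ℝ}

/-- One more jump: regularity of the new state, and the recursion for the reduced differential. -/
lemma paramState_succ (hJ : JumpHyp c g h K ε I) {t x₀ : ℝ} (hth : t ≤ h) {n j : ℕ}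
    (hj : j < n) (hY : C2b (paramDomain t x₀ I n) (paramState c g h t j)) :
    C2b (paramDomain t x₀ I n) (paramState c g h t (j + 1)) ∧
    ∀ p ∈ paramDomain t x₀ I n, ∃ r ∈ Ioo 0 h, ∃ a ∈ I, ∃ z s, s ∈ regTime h ∩ Ioo (-2) (h + 2) ∧
      ∀ w, reducedD c g h t (j + 1) p w
        = (1 + deriv (fun z => c r a z) z) *
            (Real.exp (flowLog g h s r (paramState c g h t j p)) * reducedD c g h t j p w)
          + timeSens c g r a z * coordCLM (Sum.inl ⟨j, hj⟩) w
          + deriv (fun b => c r b z) a * coordCLM (Sum.inr ⟨j, hj⟩) w := by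
  have hW := isOpen_paramDomain t x₀ hJ.isOpen n
  set τ : ℝ × (Fin n ⊕ Fin n → ℝ) → ℝ := fun p => knot t (fun i => p.2 (Sum.inl i)) (j + 1) with hτ
  set A : ℝ × (Fin n ⊕ Fin n → ℝ) → ℝ := fun p => markSeq (fun i => p.2 (Sum.inr i)) (j + 1) with hA
  have hτe : τ = fun p => coordCLM (Sum.inl ⟨j, hj⟩) p := by
    funext p; simp [hτ, knot_succ_of_lt t _ hj, coordCLM]
  have hAe : A = fun p => coordCLM (Sum.inr ⟨j, hj⟩) p := by
    funext p; simp [hA, markSeq_succ_of_lt _ hj, coordCLM]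
  have hτC : C2b (paramDomain t x₀ I n) τ := by
    rw [hτe]; exact C2b.clm_self _ hW (bdd_paramDomain x₀ hJ.bdd n)
  have hAC : C2b (paramDomain t x₀ I n) A := by
    rw [hAe]; exact C2b.clm_self _ hW (bdd_paramDomain x₀ hJ.bdd n)
  have hτD : ∀ p, HasFDerivAt τ (coordCLM (Sum.inl ⟨j, hj⟩)) p := by
    rw [hτe]; exact fun p => ContinuousLinearMap.hasFDerivAt _
  have hAD : ∀ p, HasFDerivAt A (coordCLM (Sum.inr ⟨j, hj⟩)) p := by
    rw [hAe]; exact fun p => ContinuousLinearMap.hasFDerivAt _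
  have hτm : ∀ p ∈ paramDomain t x₀ I n, τ p ∈ Ioo 0 h := fun p hp =>
    knot_mem_Ioo hth hp.2.1 (Nat.succ_pos j) hj
  have hAm : ∀ p ∈ paramDomain t x₀ I n, A p ∈ I := fun p hp => by
    simp only [hA, markSeq_succ_of_lt _ hj]
    exact hp.2.2 _
  obtain ⟨hZ, hZD⟩ := C2b_flow_paramState hJ hth hj.le hY hτC
    (fun p hp => knot_mem_regTime hth hp.2.1 (Nat.succ_pos j) hj)
  set Z : ℝ × (Fin n ⊕ Fin n → ℝ) → ℝ := fun p =>
      JumpIBP.flow g h (knot t (fun i => p.2 (Sum.inl i)) j) (τ p) (paramState c g h t j p) with hZdef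
  have hYs : paramState c g h t (j + 1) = fun p => Z p + c (τ p) (A p) (Z p) := rfl
  obtain ⟨R, hR0, hR⟩ := hZ.1.bdd
  have hcC : C2b (paramDomain t x₀ I n) (fun p => c (τ p) (A p) (Z p)) :=
    (hJ.jump (R + 1)).comp hW (hτC.prodMk hW (hAC.prodMk hW hZ)) fun p hp =>
      ⟨hτm p hp, hAm p hp, by linarith [(abs_le.1 (hR p hp)).1], by linarith [(abs_le.1 (hR p hp)).2]⟩
  refine ⟨by rw [hYs]; exact hZ.add hW hcC, fun p hp => ?_⟩
  refine ⟨τ p, hτm p hp, A p, hAm p hp, Z p, startTime t (fun i => p.2 (Sum.inl i)) j,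
    startTime_mem hJ.drift_hyp.h_pos hth hp.2.1 hj.le, fun w => ?_⟩
  have hZp := hZD p hp
  rw [(hτD p).fderiv] at hZp
  have hcp : HasFDerivAt (fun p => c (τ p) (A p) (Z p)) _ p :=
    HasFDerivAt.comp p (f := fun p => ((τ p, A p, Z p) : ℝ × ℝ × ℝ))
      (hJ.differentiableAt (hτm p hp) (hAm p hp) (Z p)).hasFDerivAt
      ((hτD p).prodMk ((hAD p).prodMk hZp))
  have hYp := hZp.fun_add hcp
  have hst : (fun p : ℝ × (Fin n ⊕ Fin n → ℝ) => startTime t (fun i => p.2 (Sum.inl i)) (j + 1))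
      = τ := rfl
  have hdr : ∀ y, drift g h (τ p) y = g (τ p) y := fun y => by
    rw [drift, indicator_of_mem (hτm p hp)]
  rw [reducedD, hst, hYs, hYp.fderiv, (hτD p).fderiv]
  have hsp : startTime t (fun i => p.2 (Sum.inl i)) (j + 1) = τ p := rfl
  rw [hsp]
  simp only [sub_apply, add_apply,
    smul_apply, ContinuousLinearMap.comp_apply,
    ContinuousLinearMap.prod_apply, smul_eq_mul, hdr]
  rw [hJ.fderiv_apply (hτm p hp) (hAm p hp)]
  simp only [timeSens]
  rw [show JumpIBP.flow g h (knot t (fun i => p.2 (Sum.inl i)) j) (τ p) (paramState c g h t j p)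
    = Z p from rfl]
  ring

lemma abs_sub_le_of_mem_Ioo {h s r : ℝ} (hs : s ∈ Ioo (-2) (h + 2)) (hr : r ∈ Ioo (-2) (h + 2)) :
    |r - s| ≤ h + 4 :=
  abs_le.2 ⟨by linarith [hs.1, hs.2, hr.1, hr.2], by linarith [hs.1, hs.2, hr.1, hr.2]⟩

/-- Regularity of the state after `j` jumps, and nondegeneracy of its reduced differential. -/
lemma paramState_regular (hJ : JumpHyp c g h K ε I) {t : ℝ} (x₀ : ℝ) (hth : t ≤ h) (n : ℕ) :
    ∀ j ≤ n, C2b (paramDomain t x₀ I n) (paramState c g h t j) ∧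
      ∃ κ, 0 < κ ∧ ∀ p ∈ paramDomain t x₀ I n, ∀ i : Fin n,
        ((i : ℕ) < j → κ ≤ |reducedD c g h t j p (coordDir (Sum.inl i))| ∧
          κ ≤ |reducedD c g h t j p (coordDir (Sum.inr i))|) ∧
        (j ≤ (i : ℕ) → reducedD c g h t j p (coordDir (Sum.inl i)) = 0 ∧
          reducedD c g h t j p (coordDir (Sum.inr i)) = 0) := by
  intro j
  induction j with
  | zero =>
    intro _
    have h0 : paramState (n := n) c g h t 0
      = fun p => ContinuousLinearMap.fst ℝ ℝ (Fin n ⊕ Fin n → ℝ) p := rfl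
    refine ⟨?_, 1, one_pos, fun p hp i => ⟨fun hi => absurd hi (Nat.not_lt_zero _), fun _ => ?_⟩⟩
    · rw [h0]
      exact C2b.clm_self _ (isOpen_paramDomain t x₀ hJ.isOpen n) (bdd_paramDomain x₀ hJ.bdd n)
    · have hf : fderiv ℝ (paramState (n := n) c g h t 0) p
          = ContinuousLinearMap.fst ℝ ℝ (Fin n ⊕ Fin n → ℝ) := by
        rw [h0]; exact ContinuousLinearMap.fderiv _
      have hs : fderiv ℝ (fun p : ℝ × (Fin n ⊕ Fin n → ℝ) =>
          startTime t (fun i => p.2 (Sum.inl i)) 0) p = 0 := by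
        simp [startTime]
      rw [reducedD, hf, hs]
      simp [coordDir]
  | succ j ih =>
    intro hj
    obtain ⟨hY, κ, hκ, hκb⟩ := ih (by omega)
    obtain ⟨hY', hrec⟩ := paramState_succ hJ hth hj hY
    obtain ⟨e, he, heb⟩ := exists_flow_bound hJ (h + 4)
    refine ⟨hY', min ε (ε * (e * κ)), lt_min hJ.pos (by have := hJ.pos; positivity),
      fun p hp i => ?_⟩
    obtain ⟨r, hr, a, ha, z, s, hs, hw⟩ := hrec p hp
    rw [hw, hw, coordCLM_coordDir, coordCLM_coordDir, coordCLM_coordDir, coordCLM_coordDir]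
    have hε := hJ.pos
    have hE : e ≤ |Real.exp (flowLog g h s r (paramState c g h t j p))| := by
      rw [Real.abs_exp]
      exact heb _ _ _ (abs_sub_le_of_mem_Ioo hs.2 ⟨by linarith [hr.1], by linarith [hr.2]⟩)
    have hmul : ∀ d : ℝ, κ ≤ |d| → ε * (e * κ) ≤ |(1 + deriv (fun z => c r a z) z) *
        (Real.exp (flowLog g h s r (paramState c g h t j p)) * d)| := by
      intro d hd
      rw [abs_mul, abs_mul]
      exact mul_le_mul (hJ.flow r hr a ha z) (mul_le_mul hE hd hκ.le (abs_nonneg _))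
        (by positivity) (abs_nonneg _)
    refine ⟨fun hi => ?_, fun hi => ?_⟩
    · rcases Nat.lt_succ_iff_lt_or_eq.1 hi with hij | hij
      · obtain ⟨h1, h2⟩ := (hκb p hp i).1 hij
        have hne : (⟨j, hj⟩ : Fin n) ≠ i := fun h => by simp [← h] at hij
        simp only [Sum.inl.injEq, Sum.inr.injEq, hne, reduceCtorEq, if_false, mul_zero, add_zero]
        exact ⟨(min_le_right _ _).trans (hmul _ h1), (min_le_right _ _).trans (hmul _ h2)⟩
      · obtain ⟨h1, h2⟩ := (hκb p hp i).2 hij.ge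
        have hne : (⟨j, hj⟩ : Fin n) = i := Fin.ext hij.symm
        simp only [h1, h2, hne, reduceCtorEq, if_true, if_false, mul_zero, add_zero, mul_one,
          zero_add]
        exact ⟨(min_le_left _ _).trans (hJ.time r hr a ha z),
          (min_le_left _ _).trans (hJ.mark r hr a ha z)⟩
    · obtain ⟨h1, h2⟩ := (hκb p hp i).2 (by omega)
      have hne : (⟨j, hj⟩ : Fin n) ≠ i := fun h => by simp [← h] at hi
      simp [h1, h2, hne]

/-- The value at time `t` of the solution with jumps `v` started at `x`. -/
def paramSol (c : ℝ → ℝ → ℝ → ℝ) (g : ℝ → ℝ → ℝ) (h t : ℝ) {n : ℕ}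
    (p : ℝ × (Fin n ⊕ Fin n → ℝ)) : ℝ :=
  JumpIBP.flow g h (knot t (fun i => p.2 (Sum.inl i)) n) t (paramState c g h t n p)

/-- Regularity and nondegeneracy of the solution as a function of the jumps. -/
lemma paramSol_regular (hJ : JumpHyp c g h K ε I) {t : ℝ} (x₀ : ℝ) (ht : 0 < t) (hth : t ≤ h)
    (n : ℕ) :
    C2b (paramDomain t x₀ I n) (paramSol (n := n) c g h t) ∧
      ∃ κ, 0 < κ ∧ ∀ p ∈ paramDomain t x₀ I n, ∀ k : Fin n ⊕ Fin n,
        κ ≤ |fderiv ℝ (paramSol c g h t) p (coordDir k)| := by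
  obtain ⟨hY, κ, hκ, hκb⟩ := paramState_regular hJ x₀ hth n n le_rfl
  have hg := hJ.drift_hyp
  obtain ⟨t', ht', htc⟩ : ∃ t' ∈ regTime h ∩ Ioo (-2) (h + 2), clampTime h t' = clampTime h t := by
    rcases hth.lt_or_eq with hlt | rfl
    · exact ⟨t, ⟨⟨ht.ne', hlt.ne⟩, by linarith, by linarith⟩, rfl⟩
    · refine ⟨t + 1, ⟨⟨by linarith, by linarith⟩, by linarith, by linarith⟩, ?_⟩
      rw [clampTime_of_ge ht (by linarith), clampTime_of_ge ht le_rfl]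
  have hsol : paramSol (n := n) c g h t = fun p =>
      JumpIBP.flow g h (knot t (fun i => p.2 (Sum.inl i)) n) t' (paramState c g h t n p) := by
    funext p
    exact DriftHyp.flow_congr_right htc.symm _ _
  obtain ⟨hF, hFD⟩ := C2b_flow_paramState hJ hth le_rfl hY (τ := fun _ => t') (C2b.const t')
    (fun _ _ => ht')
  obtain ⟨e, he, heb⟩ := exists_flow_bound hJ (h + 4)
  refine ⟨by rw [hsol]; exact hF, e * κ, by positivity, fun p hp k => ?_⟩
  rw [hsol, (hFD p hp).fderiv]
  simp only [fderiv_fun_const, Pi.zero_apply, smul_zero, add_zero, smul_apply,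
    smul_eq_mul]
  rw [abs_mul, Real.abs_exp]
  refine mul_le_mul (heb _ _ _ (abs_sub_le_of_mem_Ioo
    (startTime_mem hg.h_pos hth hp.2.1 le_rfl).2 ht'.2)) ?_ hκ.le (Real.exp_pos _).le
  rcases k with i | i
  · exact ((hκb p hp i).1 i.2).1
  · exact ((hκb p hp i).1 i.2).2

end Regularity

section Paths

variable {c : ℝ → ℝ → ℝ → ℝ} {g : ℝ → ℝ → ℝ} {h K : ℝ}

/-- The jump equation on `[0, b]` with the jump times `τ 1, …, τ n` and amplitudes `δ 1, …, δ n`. -/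
def IsSeqPath (c : ℝ → ℝ → ℝ → ℝ) (g : ℝ → ℝ → ℝ) (b x : ℝ) (n : ℕ) (τ δ : ℕ → ℝ) (s : ℝ → ℝ) :
    Prop :=
  IntervalIntegrable (fun r => g r (s r)) volume 0 b ∧
    ∀ r ∈ Icc 0 b, s r = x
      + ∑ i ∈ Finset.range n with τ (i + 1) ≤ r,
          c (τ (i + 1)) (δ (i + 1)) (Function.leftLim s (τ (i + 1)))
      + ∫ v in (0 : ℝ)..r, g v (s v)

/-- Between jumps, a solution of the integral equation follows the flow. -/
lemma DriftHyp.eq_flow_of_integral_eq (hg : DriftHyp g h K) {α β A : ℝ} (hα : 0 ≤ α) (hβ : β ≤ h)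
    (hαβ : α ≤ β) {s : ℝ → ℝ} (hi : IntervalIntegrable (fun r => g r (s r)) volume α β)
    (hs : ∀ r ∈ Ico α β, s r = A + ∫ v in α..r, g v (s v)) :
    (∀ r ∈ Ico α β, s r = flow g h α r A) ∧ A + ∫ v in α..β, g v (s v) = flow g h α β A := by
  set y : ℝ → ℝ := fun r => A + ∫ v in α..r, g v (s v) with hy
  have hsub : Ioo α β ⊆ Ioo 0 h := Ioo_subset_Ioo hα hβ
  have hyc : ContinuousOn y (Icc α β) := by
    have := intervalIntegral.continuousOn_primitive_interval
      (μ := volume) (f := fun r => g r (s r)) (a := α) (b := β) (by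
        rw [uIcc_of_le hαβ]
        exact (intervalIntegrable_iff_integrableOn_Icc_of_le hαβ).1 hi)
    rw [uIcc_of_le hαβ] at this
    exact continuousOn_const.add this
  have hsy : ∀ r ∈ Ioo α β, s =ᶠ[𝓝 r] y := fun r hr => by
    filter_upwards [isOpen_Ioo.mem_nhds hr] with v hv using hs v ⟨hv.1.le, hv.2⟩
  have hgc : ∀ r ∈ Ioo α β, ContinuousAt (fun r => g r (s r)) r := by
    intro r hr
    have h1 : ContinuousAt s r :=
      (hyc.continuousAt (Icc_mem_nhds hr.1 hr.2)).congr (hsy r hr).symm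
    exact ContinuousAt.comp (f := fun r => (r, s r)) (hg.continuousAt (hsub hr) (s r))
      (continuousAt_id.prodMk h1)
  have hysol : IsSolOn g α β y := by
    refine ⟨hyc, fun r hr => ?_⟩
    have hir : IntervalIntegrable (fun r => g r (s r)) volume α r :=
      hi.mono_set (by rw [uIcc_of_le hαβ, uIcc_of_le hr.1.le]; exact Icc_subset_Icc_right hr.2.le)
    have h1 := (intervalIntegral.integral_hasDerivAt_right hir
      (ContinuousAt.stronglyMeasurableAtFilter isOpen_Ioo hgc r hr) (hgc r hr)).const_add A
    rw [(hsy r hr).eq_of_nhds] at h1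
    exact h1
  have hfsol : IsSolOn g α β (fun r => flow g h α r A) :=
    ⟨(hg.isSolOn_flow α A).1.mono (Icc_subset_Icc hα hβ),
      fun r hr => (hg.isSolOn_flow α A).2 r (hsub hr)⟩
  have hαm : α ∈ Icc α β := left_mem_Icc.2 hαβ
  have key : ∀ r ∈ Icc α β, y r = flow g h α r A := fun r hr =>
    hg.eqOn_of_isSolOn hsub hysol hfsol hαm hr (by simp [hy, hg.flow_self])
  exact ⟨fun r hr => (hs r hr).trans (key r ⟨hr.1, hr.2.le⟩), key β (right_mem_Icc.2 hαβ)⟩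

/-- Along the flow the integral equation holds. -/
lemma DriftHyp.integral_eq_of_eq_flow (hg : DriftHyp g h K) {α β A : ℝ} (hα : 0 ≤ α) (hβ : β ≤ h)
    (hαβ : α ≤ β) {s : ℝ → ℝ} (hs : ∀ r ∈ Ico α β, s r = flow g h α r A) :
    IntervalIntegrable (fun r => g r (s r)) volume α β ∧
      A + ∫ v in α..β, g v (s v) = flow g h α β A := by
  have hae : ∀ᵐ v, v ∈ uIoc α β → drift g h v (flow g h α v A) = g v (s v) := by
    filter_upwards [(measure_singleton β : volume {β} = 0) |> compl_mem_ae_iff.2] with v hv hv'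
    rw [uIoc_of_le hαβ] at hv'
    have hvβ : v < β := lt_of_le_of_ne hv'.2 hv
    have hm : v ∈ Ioo 0 h := ⟨hα.trans_lt hv'.1, hvβ.trans_le hβ⟩
    rw [drift, indicator_of_mem hm, hs v ⟨hv'.1.le, hvβ⟩]
  refine ⟨(hg.intervalIntegrable_drift_flow α A α β).congr_ae ?_, ?_⟩
  · exact (ae_restrict_iff' measurableSet_uIoc).2 hae
  · rw [← intervalIntegral.integral_congr_ae hae, hg.integral_drift_flow, hg.flow_self]
    ring

variable {n : ℕ} {τ δ : ℕ → ℝ}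

lemma strictMono_of_lt_succ (hτ : ∀ j < n, τ j < τ (j + 1)) {i j : ℕ} (hij : i < j) (hj : j ≤ n) :
    τ i < τ j := by
  induction j, hij using Nat.le_induction with
  | base => exact hτ i (by omega)
  | succ k hk ih => exact (ih (by omega)).trans (hτ k (by omega))

lemma filter_le_eq_range (hτ : ∀ j < n, τ j < τ (j + 1)) {j : ℕ} (hj : j ≤ n) {r : ℝ}
    (hr : τ j ≤ r) (hr' : j < n → r < τ (j + 1)) :
    (Finset.range n).filter (fun i => τ (i + 1) ≤ r) = Finset.range j := by
  ext i
  simp only [Finset.mem_filter, Finset.mem_range]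
  constructor
  · rintro ⟨hi, hir⟩
    by_contra hji
    have hjn : j < n := by omega
    have h1 := hr' hjn
    rcases (show j ≤ i by omega).eq_or_lt with rfl | h2
    · linarith
    · have := strictMono_of_lt_succ hτ (show j + 1 < i + 1 by omega) (by omega)
      linarith
  · intro hi
    refine ⟨by omega, ?_⟩
    rcases (show i + 1 ≤ j by omega).eq_or_lt with rfl | h2
    · exact hr
    · exact (strictMono_of_lt_succ hτ h2 hj).le.trans hr

lemma leftLim_eq_flow (hg : DriftHyp g h K) {α β A : ℝ} (hαβ : α < β) {s : ℝ → ℝ}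
    (hs : ∀ r ∈ Ico α β, s r = flow g h α r A) :
    Function.leftLim s β = flow g h α β A := by
  refine leftLim_eq_of_tendsto ?_
  have h1 : Filter.Tendsto (fun r => flow g h α r A) (𝓝[<] β) (𝓝 (flow g h α β A)) :=
    ((hg.continuous_flow_time α A).tendsto β).mono_left nhdsWithin_le_nhds
  refine h1.congr' ?_
  filter_upwards [Ioo_mem_nhdsLT hαβ] with r hr
  exact (hs r ⟨hr.1.le, hr.2⟩).symm

/-- Uniqueness: a solution is determined by the flow and the jumps. -/
lemma IsSeqPath.eq_flow (hg : DriftHyp g h K) {b x : ℝ} (hb : b ≤ h) (h0 : τ 0 = 0)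
    (hτ : ∀ j < n, τ j < τ (j + 1)) (hτb : τ n ≤ b) {s : ℝ → ℝ}
    (hs : IsSeqPath c g b x n τ δ s) :
    s b = flow g h (τ n) b (jumpState c g h τ δ x n) := by
  obtain ⟨hi, hs⟩ := hs
  have hpos : ∀ j ≤ n, 0 ≤ τ j := by
    intro j hj
    rcases Nat.eq_zero_or_pos j with rfl | hj0
    · exact h0.ge
    · exact h0 ▸ (strictMono_of_lt_succ hτ hj0 hj).le
  have hle : ∀ j ≤ n, τ j ≤ b := by
    intro j hj
    rcases hj.eq_or_lt with rfl | hj'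
    · exact hτb
    · exact (strictMono_of_lt_succ hτ hj' le_rfl).le.trans hτb
  have h_int : ∀ a b', a ∈ Icc 0 b → b' ∈ Icc 0 b →
      IntervalIntegrable (fun r => g r (s r)) volume a b' := fun a b' ha hb' =>
    hi.mono_set (by
      rw [uIcc_of_le (ha.1.trans ha.2)]
      exact ordConnected_Icc.uIcc_subset ha hb')
  have h0b : (0 : ℝ) ∈ Icc 0 b := ⟨le_rfl, (hpos n le_rfl).trans hτb⟩
  have hsum : ∀ j ≤ n, ∀ r ∈ Icc 0 b, τ j ≤ r → (j < n → r < τ (j + 1)) →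
      s r = s (τ j) + ∫ v in (τ j)..r, g v (s v) := by
    intro j hj r hr hjr hjr'
    have hτj : τ j ∈ Icc 0 b := ⟨hpos j hj, hle j hj⟩
    rw [hs r hr, hs (τ j) hτj, filter_le_eq_range hτ hj hjr hjr',
      filter_le_eq_range hτ hj le_rfl (fun h => hτ j h),
      ← intervalIntegral.integral_add_adjacent_intervals (h_int 0 _ h0b hτj) (h_int _ _ hτj hr)]
    ring
  have hstate : ∀ j ≤ n, s (τ j) = jumpState c g h τ δ x j := by
    intro j
    induction j with
    | zero =>
      intro _
      have hm : τ 0 ∈ Icc 0 b := by rw [h0]; exact h0b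
      rw [hs _ hm, filter_le_eq_range hτ (Nat.zero_le n) le_rfl (fun h => hτ 0 h), h0]
      simp [jumpState]
    | succ j ih =>
      intro hj
      have hjn : j < n := hj
      have hj' : τ j ∈ Icc 0 b := ⟨hpos j hjn.le, hle j hjn.le⟩
      have hj1 : τ (j + 1) ∈ Icc 0 b := ⟨hpos _ hj, hle _ hj⟩
      obtain ⟨hflow, hend⟩ := hg.eq_flow_of_integral_eq (A := s (τ j)) hj'.1 (hj1.2.trans hb)
        (hτ j hjn).le (h_int _ _ hj' hj1)
        (fun r hr => hsum j hjn.le r ⟨hj'.1.trans hr.1, hr.2.le.trans hj1.2⟩ hr.1 (fun _ => hr.2))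
      have hlim := leftLim_eq_flow hg (hτ j hjn) hflow
      have hval := hs (τ j) hj'
      rw [filter_le_eq_range hτ hjn.le le_rfl (fun h => hτ j h)] at hval
      rw [hs _ hj1, filter_le_eq_range hτ hj le_rfl (fun h => hτ _ h), Finset.sum_range_succ, hlim,
        jumpState, ← ih hjn.le, ← hend,
        ← intervalIntegral.integral_add_adjacent_intervals (h_int 0 _ h0b hj') (h_int _ _ hj' hj1)]
      linarith
  obtain ⟨-, hend⟩ := hg.eq_flow_of_integral_eq (A := s (τ n)) (hpos n le_rfl) hb hτb
    (h_int _ _ ⟨hpos n le_rfl, hτb⟩ ⟨h0b.2, le_rfl⟩)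
    (fun r hr => hsum n le_rfl r ⟨(hpos n le_rfl).trans hr.1, hr.2.le⟩ hr.1
      (fun h => absurd h (lt_irrefl n)))
  rw [← hstate n le_rfl, ← hend]
  exact hsum n le_rfl b ⟨h0b.2, le_rfl⟩ hτb (fun h => absurd h (lt_irrefl n))

/-- Existence of a solution with given jumps. -/
lemma exists_isSeqPath (hg : DriftHyp g h K) (c : ℝ → ℝ → ℝ → ℝ) (δ : ℕ → ℝ) (x : ℝ)
    (h0 : τ 0 = 0) (hτ : ∀ j < n, τ j < τ (j + 1)) (hτh : τ n ≤ h) :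
    ∃ s, IsSeqPath c g h x n τ δ s := by
  set cnt : ℝ → ℕ := fun r => ((Finset.range n).filter (fun i => τ (i + 1) ≤ r)).card with hcnt
  set s : ℝ → ℝ := fun r => flow g h (τ (cnt r)) r (jumpState c g h τ δ x (cnt r)) with hsdef
  have hsflow : ∀ j ≤ n, ∀ r, τ j ≤ r → (j < n → r < τ (j + 1)) →
      s r = flow g h (τ j) r (jumpState c g h τ δ x j) := by
    intro j hj r hr hr'
    have : cnt r = j := by
      simp only [hcnt]
      rw [filter_le_eq_range hτ hj hr hr', Finset.card_range]
    simp only [hsdef, this]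
  have hpos : ∀ j ≤ n, 0 ≤ τ j := by
    intro j hj
    rcases Nat.eq_zero_or_pos j with rfl | hj0
    · exact h0.ge
    · exact h0 ▸ (strictMono_of_lt_succ hτ hj0 hj).le
  have hle : ∀ j ≤ n, τ j ≤ h := by
    intro j hj
    rcases hj.eq_or_lt with rfl | hj'
    · exact hτh
    · exact (strictMono_of_lt_succ hτ hj' le_rfl).le.trans hτh
  have hlim : ∀ i < n, Function.leftLim s (τ (i + 1))
      = flow g h (τ i) (τ (i + 1)) (jumpState c g h τ δ x i) := fun i hi =>
    leftLim_eq_flow hg (hτ i hi) fun r hr => hsflow i hi.le r hr.1 fun _ => hr.2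
  have hpiece : ∀ j ≤ n, ∀ r, τ j ≤ r → r ≤ h → (j < n → r ≤ τ (j + 1)) →
      IntervalIntegrable (fun r => g r (s r)) volume (τ j) r ∧
        jumpState c g h τ δ x j + ∫ v in (τ j)..r, g v (s v)
          = flow g h (τ j) r (jumpState c g h τ δ x j) := fun j hj r hr hrh hr' =>
    hg.integral_eq_of_eq_flow (hpos j hj) hrh hr fun v hv => hsflow j hj v hv.1 fun hjn =>
      hv.2.trans_le (hr' hjn)
  have hknot : ∀ j ≤ n, IntervalIntegrable (fun r => g r (s r)) volume 0 (τ j) ∧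
      x + ∑ i ∈ Finset.range j, c (τ (i + 1)) (δ (i + 1)) (Function.leftLim s (τ (i + 1)))
        + ∫ v in (0 : ℝ)..(τ j), g v (s v) = jumpState c g h τ δ x j := by
    intro j
    induction j with
    | zero => intro _; simp [h0, jumpState]
    | succ j ih =>
      intro hj
      obtain ⟨hi, he⟩ := ih (by omega)
      obtain ⟨hi', he'⟩ := hpiece j (by omega) (τ (j + 1)) (hτ j hj).le (hle _ hj) (fun _ => le_rfl)
      refine ⟨hi.trans hi', ?_⟩
      rw [Finset.sum_range_succ, hlim j hj, jumpState, ← he',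
        ← intervalIntegral.integral_add_adjacent_intervals hi hi']
      linarith
  have hfull : ∀ j ≤ n, ∀ r, τ j ≤ r → r ≤ h → (j < n → r < τ (j + 1)) →
      IntervalIntegrable (fun r => g r (s r)) volume 0 r ∧
      s r = x + ∑ i ∈ Finset.range n with τ (i + 1) ≤ r,
          c (τ (i + 1)) (δ (i + 1)) (Function.leftLim s (τ (i + 1)))
        + ∫ v in (0 : ℝ)..r, g v (s v) := by
    intro j hj r hr hrh hr'
    obtain ⟨hi, he⟩ := hknot j hj
    obtain ⟨hi', he'⟩ := hpiece j hj r hr hrh (fun h => (hr' h).le)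
    refine ⟨hi.trans hi', ?_⟩
    rw [hsflow j hj r hr hr', ← he', ← he, filter_le_eq_range hτ hj hr hr',
      ← intervalIntegral.integral_add_adjacent_intervals hi hi']
    ring
  refine ⟨s, (hfull n le_rfl h hτh le_rfl (fun h => absurd h (lt_irrefl n))).1, fun r hr => ?_⟩
  have hex : ∃ j ≤ n, τ j ≤ r ∧ (j < n → r < τ (j + 1)) := by
    by_contra hcon
    push Not at hcon
    have : ∀ j ≤ n, τ j ≤ r := by
      intro j
      induction j with
      | zero => intro _; rw [h0]; exact hr.1
      | succ j ih => exact fun hj => (hcon j (by omega) (ih (by omega))).2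
    exact lt_irrefl n (hcon n le_rfl (this n le_rfl)).1
  obtain ⟨j, hj, hjr, hjr'⟩ := hex
  exact (hfull j hj r hjr hr.2 hjr').2

end Paths

section Identification

variable {c : ℝ → ℝ → ℝ → ℝ} {g : ℝ → ℝ → ℝ} {h K : ℝ}

lemma isDetPath_iff {n : ℕ} (t x : ℝ) (u a : Fin n → ℝ) (s : ℝ → ℝ) :
    IsDetPath c g h x u a s ↔ IsSeqPath c g h x n (knot t u) (markSeq a) s := by
  have hsum : ∀ r, ∑ i with u i ≤ r, c (u i) (a i) (Function.leftLim s (u i))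
      = ∑ i ∈ Finset.range n with knot t u (i + 1) ≤ r, c (knot t u (i + 1)) (markSeq a (i + 1))
          (Function.leftLim s (knot t u (i + 1))) := by
    intro r
    rw [Finset.sum_filter, Finset.sum_filter, ← Fin.sum_univ_eq_sum_range (fun i =>
      if knot t u (i + 1) ≤ r then c (knot t u (i + 1)) (markSeq a (i + 1))
          (Function.leftLim s (knot t u (i + 1))) else 0) n]
    refine Finset.sum_congr rfl fun i _ => ?_
    rw [knot_succ_of_lt t u i.2, markSeq_succ_of_lt a i.2]
  constructor
  · rintro ⟨h1, h2⟩
    exact ⟨h1, fun r hr => by rw [← hsum]; exact h2 r hr⟩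
  · rintro ⟨h1, h2⟩
    exact ⟨h1, fun r hr => by rw [hsum]; exact h2 r hr⟩

lemma IsSeqPath.mono {b b' x : ℝ} (hb : 0 ≤ b) (hbb : b ≤ b') {n : ℕ} {τ δ : ℕ → ℝ} {s : ℝ → ℝ}
    (hs : IsSeqPath c g b' x n τ δ s) : IsSeqPath c g b x n τ δ s :=
  ⟨hs.1.mono_set (by
    rw [uIcc_of_le hb, uIcc_of_le (hb.trans hbb)]; exact Icc_subset_Icc_right hbb),
    fun r hr => hs.2 r ⟨hr.1, hr.2.trans hbb⟩⟩

/-- On the region, the deterministic solution is the composition of flows and jumps. -/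
lemma detSol_eq_paramSol (hg : DriftHyp g h K) (c : ℝ → ℝ → ℝ → ℝ) {t : ℝ} (ht : 0 < t)
    (hth : t ≤ h) {I : Set ℝ} {n : ℕ} (x : ℝ) {v : Fin n ⊕ Fin n → ℝ}
    (hv : v ∈ mixedRegion t I n) :
    detSol c g h t x v = paramSol c g h t (x, v) := by
  have hτ : ∀ j < n, knot t (fun i => v (Sum.inl i)) j < knot t (fun i => v (Sum.inl i)) (j + 1) :=
    fun j hj => hv.1 j hj.le
  have hτn : knot t (fun i => v (Sum.inl i)) n ≤ t := by
    have := hv.1 n le_rfl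
    rw [knot_last] at this
    exact this.le
  have hex : ∃ s, IsDetPath c g h x (fun i => v (Sum.inl i)) (fun i => v (Sum.inr i)) s := by
    obtain ⟨s, hs⟩ := exists_isSeqPath hg c (markSeq fun i => v (Sum.inr i)) x
      (τ := knot t fun i => v (Sum.inl i)) rfl hτ (hτn.trans hth)
    exact ⟨s, (isDetPath_iff t x _ _ s).2 hs⟩
  have hspec := (isDetPath_iff t x _ _ _).1 (Classical.epsilon_spec hex)
  exact (hspec.mono ht.le hth).eq_flow hg hth rfl hτ hτn

/-- If the times increase strictly, the jumps up to `r` are the first `jumpCount` ones. -/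
lemma setOf_le_eq_Icc {Ω : Type*} {T : ℕ → Ω → ℝ} {ω : Ω} (hmono : StrictMono fun i => T i ω)
    {r : ℝ} {n : ℕ} (hn : T n ω ≤ r) (hn' : r < T (n + 1) ω) :
    {i : ℕ | 1 ≤ i ∧ T i ω ≤ r} = Icc 1 n := by
  ext i
  simp only [mem_ofPred_eq, mem_Icc]
  refine and_congr_right fun _ => ⟨fun hi => ?_, fun hi => (hmono.monotone hi).trans hn⟩
  by_contra hcon
  have : T (n + 1) ω ≤ T i ω := hmono.monotone (show n + 1 ≤ i by omega)
  linarith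

lemma jumpCount_eq_iff {Ω : Type*} {T : ℕ → Ω → ℝ} {ω : Ω} (hmono : StrictMono fun i => T i ω)
    {r : ℝ} {n : ℕ} (hn : 1 ≤ n) :
    jumpCount T r ω = n ↔ T n ω ≤ r ∧ r < T (n + 1) ω := by
  constructor
  · intro hJ
    unfold jumpCount at hJ
    have hfin : {i : ℕ | 1 ≤ i ∧ T i ω ≤ r}.Finite := finite_of_ncard_pos (by omega)
    constructor
    · by_contra hcon
      have hsub : {i : ℕ | 1 ≤ i ∧ T i ω ≤ r} ⊆ Icc 1 (n - 1) := by
        rintro i ⟨hi1, hi2⟩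
        refine ⟨hi1, ?_⟩
        by_contra hlt
        have : T n ω ≤ T i ω := hmono.monotone (show n ≤ i by omega)
        exact hcon (this.trans hi2)
      have := ncard_le_ncard hsub (finite_Icc _ _)
      rw [hJ, ← Finset.coe_Icc, ncard_coe_finset, Nat.card_Icc] at this
      omega
    · by_contra hcon
      have hsub : Icc 1 (n + 1) ⊆ {i : ℕ | 1 ≤ i ∧ T i ω ≤ r} := by
        rintro i ⟨hi1, hi2⟩
        have : T i ω ≤ T (n + 1) ω := hmono.monotone hi2
        exact ⟨hi1, this.trans (not_lt.1 hcon)⟩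
      have := ncard_le_ncard hsub hfin
      rw [hJ, ← Finset.coe_Icc, ncard_coe_finset, Nat.card_Icc] at this
      omega
  · rintro ⟨h1, h2⟩
    rw [jumpCount, setOf_le_eq_Icc hmono h1 h2, ← Finset.coe_Icc, ncard_coe_finset, Nat.card_Icc]
    omega

/-- On `{J_t = n}` a path of the jump equation is the deterministic solution at the noise. -/
lemma IsJumpPath.eq_detSol (hg : DriftHyp g h K) {t x : ℝ} (ht : 0 < t) (hth : t ≤ h)
    {Ω : Type*} {T Δ : ℕ → Ω → ℝ} {ω : Ω} (hT0 : T 0 ω = 0)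
    (hmono : StrictMono fun i => T i ω) {I : Set ℝ} {n : ℕ}
    (hn : t < T (n + 1) ω) {S : ℝ → ℝ}
    (hS : IsJumpPath c g h x (fun r => jumpCount T r ω) (fun i => T i ω) (fun i => Δ i ω) S)
    (hv : noiseVector T Δ n ω ∈ mixedRegion t I n) :
    S t = detSol c g h t x (noiseVector T Δ n ω) := by
  rw [detSol_eq_paramSol hg c ht hth x hv]
  set τ := knot t fun i => noiseVector T Δ n ω (Sum.inl i) with hτdef
  set δ := markSeq fun i => noiseVector T Δ n ω (Sum.inr i) with hδdef
  have hτe : ∀ i < n, τ (i + 1) = T (i + 1) ω := fun i hi => by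
    rw [hτdef, knot_succ_of_lt t _ hi]; rfl
  have hδe : ∀ i < n, δ (i + 1) = Δ (i + 1) ω := fun i hi => by
    rw [hδdef, markSeq_succ_of_lt _ hi]; rfl
  have hτ : ∀ j < n, τ j < τ (j + 1) := fun j hj => hv.1 j hj.le
  have hτn : τ n ≤ t := by
    have := hv.1 n le_rfl
    rw [knot_last] at this
    exact this.le
  have hpath : IsSeqPath c g t x n τ δ S := by
    refine ⟨hS.1.mono_set (by
      rw [uIcc_of_le ht.le, uIcc_of_le (ht.le.trans hth)]; exact Icc_subset_Icc_right hth),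
      fun r hr => ?_⟩
    rw [hS.2 r ⟨hr.1, hr.2.trans hth⟩]
    congr 2
    have hset : Finset.Icc 1 (jumpCount T r ω)
        = ((Finset.range n).filter (fun i => T (i + 1) ω ≤ r)).image (· + 1) := by
      have hex : ∃ m ≤ n, T m ω ≤ r ∧ r < T (m + 1) ω := by
        by_contra hcon
        push Not at hcon
        have : ∀ m ≤ n + 1, T m ω ≤ r := by
          intro m
          induction m with
          | zero => intro _; rw [hT0]; exact hr.1
          | succ m ih => exact fun hm => hcon m (by omega) (ih (by omega))
        linarith [this (n + 1) le_rfl, hr.2]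
      obtain ⟨m, hm, hm1, hm2⟩ := hex
      have hJ : jumpCount T r ω = m := by
        rw [jumpCount, setOf_le_eq_Icc hmono hm1 hm2, ← Finset.coe_Icc, ncard_coe_finset,
          Nat.card_Icc]
        omega
      rw [hJ]
      have hiff := setOf_le_eq_Icc hmono hm1 hm2
      ext i
      simp only [Finset.mem_Icc, Finset.mem_image, Finset.mem_filter, Finset.mem_range]
      have hi : (1 ≤ i ∧ T i ω ≤ r) ↔ (1 ≤ i ∧ i ≤ m) := by
        have := Set.ext_iff.1 hiff i
        simpa using this
      constructor
      · intro h
        exact ⟨i - 1, ⟨by omega, by rw [Nat.sub_add_cancel h.1]; exact (hi.2 h).2⟩, by omega⟩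
      · rintro ⟨k, ⟨hk, hk'⟩, rfl⟩
        exact hi.1 ⟨by omega, hk'⟩
    rw [hset, Finset.sum_image (fun a _ b _ hab => by simpa using hab)]
    have hfilt : (Finset.range n).filter (fun i => T (i + 1) ω ≤ r)
        = (Finset.range n).filter (fun i => τ (i + 1) ≤ r) := by
      refine Finset.filter_congr fun i hi => ?_
      rw [hτe i (Finset.mem_range.1 hi)]
    rw [hfilt]
    refine Finset.sum_congr rfl fun i hi => ?_
    have hi' := Finset.mem_range.1 (Finset.mem_filter.1 hi).1
    rw [hτe i hi', hδe i hi']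
  exact hpath.eq_flow hg hth rfl hτ hτn

end Identification

/-! ### The law of the noise on `{J_t = n}` -/

section ProductDensity

open scoped ENNReal

variable {ι : Type*} [Fintype ι]

lemma lintegral_pi_prod {f : ι → ℝ → ℝ≥0∞} (hf : ∀ i, Measurable (f i)) :
    ∫⁻ x : ι → ℝ, ∏ i, f i (x i) = ∏ i, ∫⁻ y, f i y := by
  classical
  have hm : ∀ s : Finset ι, Measurable (fun x : ι → ℝ => ∏ i ∈ s, f i (x i)) := fun s =>
    Finset.measurable_fun_prod s fun i _ => (hf i).comp (measurable_pi_apply i)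
  have key : ∀ s : Finset ι, ∀ x,
      (∫⋯∫⁻_s, (fun x : ι → ℝ => ∏ i ∈ s, f i (x i)) ∂(fun _ => volume)) x
        = ∏ i ∈ s, ∫⁻ y, f i y := by
    intro s
    induction s using Finset.induction_on with
    | empty => intro x; simp
    | insert i s hi ih =>
      intro x
      rw [lmarginal_insert _ (hm _) hi]
      have hin : ∀ y, (∫⋯∫⁻_s, (fun x : ι → ℝ => ∏ i ∈ insert i s, f i (x i))
          ∂(fun _ => volume)) (Function.update x i y) = f i y * ∏ i ∈ s, ∫⁻ y, f i y := by
        intro y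
        rw [← ih (Function.update x i y)]
        unfold lmarginal
        refine Eq.trans (lintegral_congr fun z => ?_)
          (lintegral_const_mul (f i y) ((hm s).comp measurable_updateFinset))
        simp only [Finset.prod_insert hi]
        congr 2
        rw [Function.updateFinset, dif_neg hi, Function.update_self]
      simp only [hin]
      rw [lintegral_mul_const _ (hf i), Finset.prod_insert hi]
  rw [volume_pi, lintegral_eq_lmarginal_univ (fun _ => 0)]
  exact key _ _

lemma pi_withDensity {f : ι → ℝ → ℝ≥0∞} (hf : ∀ i, Measurable (f i))
    [∀ i, SigmaFinite (volume.withDensity (f i))] :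
    Measure.pi (fun i => volume.withDensity (f i))
      = (volume : Measure (ι → ℝ)).withDensity (fun x => ∏ i, f i (x i)) := by
  refine Measure.pi_eq fun s hs => ?_
  have h1 : ∀ x : ι → ℝ, (univ.pi s).indicator (fun x => ∏ i, f i (x i)) x
      = ∏ i, (s i).indicator (f i) (x i) := by
    intro x
    by_cases hx : x ∈ univ.pi s
    · rw [indicator_of_mem hx]
      exact Finset.prod_congr rfl fun i _ => (indicator_of_mem (hx i (mem_univ i)) _).symm
    · rw [indicator_of_notMem hx]
      simp only [mem_univ_pi, not_forall] at hx
      obtain ⟨i, hi⟩ := hx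
      exact (Finset.prod_eq_zero (Finset.mem_univ i) (indicator_of_notMem hi _)).symm
  rw [withDensity_apply _ (MeasurableSet.univ_pi hs),
    ← lintegral_indicator (MeasurableSet.univ_pi hs)]
  simp only [h1]
  rw [lintegral_pi_prod fun i => (hf i).indicator (hs i)]
  refine Finset.prod_congr rfl fun i _ => ?_
  rw [withDensity_apply _ (hs i), lintegral_indicator (hs i)]

end ProductDensity

section Cumulative

variable {n : ℕ}

/-- The first `n` coordinates as a sequence. -/
def gapSeq (w : Fin n ⊕ Fin n → ℝ) (k : ℕ) : ℝ := if hk : k < n then w (Sum.inl ⟨k, hk⟩) else 0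

/-- From gaps to jump times; the amplitudes are kept. -/
def cumul (w : Fin n ⊕ Fin n → ℝ) : Fin n ⊕ Fin n → ℝ :=
  Sum.elim (fun i => ∑ k ∈ Finset.range (i + 1), gapSeq w k) (fun i => w (Sum.inr i))

lemma knot_cumul (t : ℝ) (w : Fin n ⊕ Fin n → ℝ) {j : ℕ} (hj : j ≤ n) :
    knot t (fun i => cumul w (Sum.inl i)) j = ∑ k ∈ Finset.range j, gapSeq w k := by
  rcases j with - | j
  · simp [knot]
  · rw [knot_succ_of_lt t _ hj]; rfl

lemma measurePreserving_cumul : MeasurePreserving (cumul (n := n)) := by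
  set A : Matrix (Fin n) (Fin n) ℝ := Matrix.of fun i k => if k ≤ i then 1 else 0
    with hA
  set M : Matrix (Fin n ⊕ Fin n) (Fin n ⊕ Fin n) ℝ := Matrix.fromBlocks A 0 0 1 with hM
  have hAdet : A.det = 1 := by
    rw [Matrix.det_of_isLowerTriangular A]
    · simp [hA]
    · intro i k hik
      have hik' : i < k := hik
      simp [hA, not_le.2 hik']
  have hdet : M.det = 1 := by
    rw [hM, Matrix.det_fromBlocks_zero₂₁, hAdet, Matrix.det_one, mul_one]
  have hlin : (cumul (n := n)) = Matrix.toLin' M := by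
    funext w k
    rcases k with i | i
    · simp only [cumul, Sum.elim_inl, Matrix.toLin'_apply, Matrix.mulVec, dotProduct,
        Fintype.sum_sum_type, hM, Matrix.fromBlocks_apply₁₁, Matrix.fromBlocks_apply₁₂,
        Matrix.zero_apply, zero_mul, Finset.sum_const_zero, add_zero, hA, ite_mul, one_mul,
        Matrix.of_apply]
      have h1 : ∀ k : Fin n, (if k ≤ i then w (Sum.inl k) else 0)
          = (fun k : ℕ => if k ≤ (i : ℕ) then gapSeq w k else 0) k := fun k => by
        simp [gapSeq, k.2]
      simp only [h1]
      rw [Fin.sum_univ_eq_sum_range (fun k : ℕ => if k ≤ (i : ℕ) then gapSeq w k else 0) n,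
        ← Finset.sum_filter]
      refine Finset.sum_congr ?_ fun _ _ => rfl
      ext k
      simp only [Finset.mem_range, Finset.mem_filter]
      have := i.2
      omega
    · simp [cumul, Matrix.toLin'_apply, Matrix.mulVec, dotProduct, hM, Matrix.one_apply]
  have hmeas : Measurable (cumul (n := n)) := by
    rw [hlin]
    exact (LinearMap.continuous_of_finiteDimensional _).measurable
  refine ⟨hmeas, ?_⟩
  rw [hlin, Real.map_matrix_volume_pi_eq_smul_volume_pi (by rw [hdet]; exact one_ne_zero), hdet]
  simp

end Cumulative

section Law

open scoped ENNReal

variable {Ω : Type*} [MeasurableSpace Ω] {P : Measure Ω}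
  {μ : Measure ℝ} {T Δ : ℕ → Ω → ℝ}

/-- The gaps and amplitudes as a vector. -/
def gapVector (T Δ : ℕ → Ω → ℝ) (n : ℕ) (ω : Ω) : Fin n ⊕ Fin n → ℝ :=
  Sum.elim (fun i => T (i + 1) ω - T i ω) (fun i => Δ (i + 1) ω)

lemma IsMarkedPoisson.measurable_gapVector (hN : IsMarkedPoisson P μ T Δ) (n : ℕ) :
    Measurable (gapVector T Δ n) := by
  refine measurable_pi_lambda _ ?_
  rintro (i | i)
  · exact (hN.measurable_time _).sub (hN.measurable_time _)
  · exact hN.measurable_mark _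

lemma IsMarkedPoisson.cumul_gapVector (hN : IsMarkedPoisson P μ T Δ) (n : ℕ) (ω : Ω) :
    cumul (gapVector T Δ n ω) = noiseVector T Δ n ω := by
  funext k
  rcases k with i | i
  · simp only [cumul, noiseVector, Sum.elim_inl]
    rw [Finset.sum_congr rfl (g := fun k => T (k + 1) ω - T k ω), Finset.sum_range_sub
      (fun k => T k ω), hN.time_zero, sub_zero]
    intro k hk
    have hk' : k < n := lt_of_lt_of_le (Finset.mem_range.1 hk) i.2
    simp [gapSeq, hk', gapVector]
  · rfl

lemma expMeasure_Ioi {l s : ℝ} (hl : 0 < l) (hs : 0 ≤ s) :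
    expMeasure l (Ioi s) = ENNReal.ofReal (Real.exp (-(l * s))) := by
  have := isProbabilityMeasure_expMeasure hl
  have h1 := cdf_expMeasure_eq hl s
  rw [if_pos hs, cdf_eq_real] at h1
  have h2 : (expMeasure l).real (Ioi s) = Real.exp (-(l * s)) := by
    rw [← compl_Iic, measureReal_compl measurableSet_Iic, h1]
    simp
  rw [← h2, Measure.real, ENNReal.ofReal_toReal (measure_ne_top _ _)]

lemma expMeasure_eq_withDensity (l : ℝ) : expMeasure l = volume.withDensity
    ((Ioi 0).indicator fun x => ENNReal.ofReal (l * Real.exp (-(l * x)))) := by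
  rw [show expMeasure l = volume.withDensity (exponentialPDF l) from rfl]
  refine withDensity_congr_ae ?_
  filter_upwards [compl_mem_ae_iff.2 (measure_singleton (0 : ℝ) : volume {(0 : ℝ)} = 0)] with x hx
  rw [exponentialPDF_eq]
  rcases lt_or_gt_of_ne (show x ≠ 0 from hx) with h | h
  · rw [if_neg (not_le.2 h), indicator_of_notMem (by simpa using h.le), ENNReal.ofReal_zero]
  · rw [if_pos h.le, indicator_of_mem (mem_Ioi.2 h)]

/-- Joint law of the first `n` gaps and amplitudes and of the next gap. -/
lemma IsMarkedPoisson.map_gapVector [IsProbabilityMeasure P] (hN : IsMarkedPoisson P μ T Δ) (n : ℕ) :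
    P.map (fun ω => (gapVector T Δ n ω, T (n + 1) ω - T n ω))
      = (Measure.pi (Sum.elim (fun _ => expMeasure (μ.real univ)) (fun _ => (μ univ)⁻¹ • μ)
          : Fin n ⊕ Fin n → Measure ℝ)).prod (expMeasure (μ.real univ)) := by
  set e : Option (Fin n ⊕ Fin n) → ℕ ⊕ ℕ := fun o => o.elim (Sum.inl n)
    (Sum.map (fun i => (i : ℕ)) (fun i => (i : ℕ))) with he
  have hinj : Function.Injective e := by
    rintro (- | i | i) (- | j | j) hij <;> simp [he] at hij ⊢
    · exact absurd hij j.2.ne'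
    · exact absurd hij i.2.ne
    · exact Fin.ext hij
    · exact Fin.ext hij
  set Z : ℕ ⊕ ℕ → Ω → ℝ := fun k => Sum.elim (fun i ω => T (i + 1) ω - T i ω) (fun i => Δ (i + 1)) k
    with hZ
  have hZm : ∀ k, Measurable (Z k) := by
    rintro (i | i)
    · exact (hN.measurable_time _).sub (hN.measurable_time _)
    · exact hN.measurable_mark _
  have hind := iIndepFun.precomp hinj hN.indep
  have hlaw := iIndepFun.map_fun_eq_pi_map (fun o => (hZm (e o)).aemeasurable) hind
  have : ∀ o, IsProbabilityMeasure (P.map (Z (e o))) := fun o =>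
    Measure.isProbabilityMeasure_map (hZm _).aemeasurable
  have hopt := Measure.pi_map_piOptionEquivProd (fun o => P.map (Z (e o)))
  have hmap := congrArg (Measure.map (MeasurableEquiv.piOptionEquivProd fun _ => ℝ))
    (hlaw.trans hopt.symm)
  rw [Measure.map_map (MeasurableEquiv.measurable _) (MeasurableEquiv.measurable _),
    Measure.map_map (MeasurableEquiv.measurable _) (measurable_pi_lambda _ fun o => hZm _)] at hmap
  simp only [MeasurableEquiv.self_comp_symm, Measure.map_id] at hmap
  have h1 : (fun i : Fin n ⊕ Fin n => P.map (Z (e (some i))))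
      = Sum.elim (fun _ => expMeasure (μ.real univ)) (fun _ => (μ univ)⁻¹ • μ) := by
    funext k
    rcases k with i | i
    · exact hN.gap_law i
    · exact hN.mark_law i
  have h2 : P.map (Z (e none)) = expMeasure (μ.real univ) := hN.gap_law n
  rw [h1, h2] at hmap
  rw [← hmap]
  congr 1
  funext ω
  refine Prod.ext ?_ rfl
  funext k
  rcases k with i | i <;> rfl

end Law

section Law

open scoped ENNReal

variable {Ω : Type*} [MeasurableSpace Ω] {P : Measure Ω} {μ : Measure ℝ} {T Δ : ℕ → Ω → ℝ}

lemma IsMarkedPoisson.ae_strictMono (hN : IsMarkedPoisson P μ T Δ) (hl : 0 < μ.real univ) :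
    ∀ᵐ ω ∂P, StrictMono fun i => T i ω := by
  have h1 : ∀ i, ∀ᵐ ω ∂P, T i ω < T (i + 1) ω := by
    intro i
    have := isProbabilityMeasure_expMeasure hl
    have h2' : Ioi (0 : ℝ) ∈ ae (expMeasure (μ.real univ)) := by
      rw [mem_ae_iff_prob_eq_one measurableSet_Ioi, expMeasure_Ioi hl le_rfl]
      simp
    have h2 : ∀ᵐ x ∂(expMeasure (μ.real univ)), x ∈ Ioi (0 : ℝ) := h2'
    rw [← hN.gap_law i] at h2
    have h3 := ae_of_ae_map ((hN.measurable_time _).sub (hN.measurable_time _)).aemeasurable h2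
    filter_upwards [h3] with ω hω
    simpa using hω
  filter_upwards [ae_all_iff.2 h1] with ω hω using strictMono_nat_of_lt_succ hω

lemma MarkLawHyp.measurable_density {ν : Measure ℝ} {I : Set ℝ} (hI : IsOpen I) {ρ : ℝ → ℝ}
    (hlaw : MarkLawHyp ν I ρ) :
    Measurable (I.indicator fun y => ENNReal.ofReal (Real.exp (ρ y))) := by
  classical
  have h1 : Measurable (I.piecewise (fun y => Real.exp (ρ y)) fun _ => 0) :=
    hlaw.contDiff.continuousOn.rexp.measurable_piecewise continuousOn_const hI.measurableSet
  convert ENNReal.measurable_ofReal.comp h1 using 1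
  funext y
  by_cases hy : y ∈ I <;> simp [hy]

lemma gapSeq_pos_iff {n : ℕ} (w : Fin n ⊕ Fin n → ℝ) :
    (∀ j < n, 0 < gapSeq w j) ↔ ∀ i : Fin n, 0 < w (Sum.inl i) := by
  constructor
  · intro h i
    have := h i i.2
    simpa [gapSeq] using this
  · intro h j hj
    simpa [gapSeq, hj] using h ⟨j, hj⟩

lemma sum_gapSeq {n : ℕ} (w : Fin n ⊕ Fin n → ℝ) :
    ∑ k ∈ Finset.range n, gapSeq w k = ∑ i : Fin n, w (Sum.inl i) := by
  rw [← Fin.sum_univ_eq_sum_range]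
  exact Finset.sum_congr rfl fun i _ => by simp [gapSeq]

/-- On `{J_t = n}` the jump times and amplitudes have an explicit density. -/
lemma IsMarkedPoisson.map_noiseVector [IsProbabilityMeasure P] [IsFiniteMeasure μ] (hμ : μ ≠ 0)
    (hN : IsMarkedPoisson P μ T Δ) {I : Set ℝ} (hI : IsOpen I) {ρ : ℝ → ℝ}
    (hlaw : MarkLawHyp ((μ univ)⁻¹ • μ) I ρ) (t : ℝ) {n : ℕ} (hn : 1 ≤ n) :
    ∃ C : ℝ≥0∞, C ≠ ∞ ∧ (P.restrict {ω | jumpCount T t ω = n}).map (noiseVector T Δ n)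
      = C • (volume.restrict (mixedRegion t I n)).withDensity
        (fun v => ∏ i, ENNReal.ofReal (Real.exp (ρ (v (Sum.inr i))))) := by
  set l := μ.real univ with hl
  have hl0 : 0 < l := by
    rw [hl, Measure.real, ENNReal.toReal_pos_iff]
    exact ⟨by simpa [pos_iff_ne_zero] using hμ, measure_lt_top _ _⟩
  set eD : ℝ → ℝ≥0∞ := (Ioi 0).indicator fun x => ENNReal.ofReal (l * Real.exp (-(l * x))) with heD
  set D : ℝ → ℝ≥0∞ := I.indicator fun y => ENNReal.ofReal (Real.exp (ρ y)) with hD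
  have heDm : Measurable eD := Measurable.indicator (by fun_prop) measurableSet_Ioi
  have hDm : Measurable D := hlaw.measurable_density hI
  set dens : Fin n ⊕ Fin n → ℝ → ℝ≥0∞ := Sum.elim (fun _ => eD) (fun _ => D) with hdens
  have hdm : ∀ k, Measurable (dens k) := by rintro (i | i) <;> assumption
  have hpi : (Sum.elim (fun _ => expMeasure l) (fun _ => (μ univ)⁻¹ • μ)
      : Fin n ⊕ Fin n → Measure ℝ) = fun k => volume.withDensity (dens k) := by
    funext k
    rcases k with i | i
    · exact expMeasure_eq_withDensity l
    · exact hlaw.density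
  have hsf : ∀ k, SigmaFinite (volume.withDensity (dens k)) := by
    intro k
    rw [← congrFun hpi k]
    rcases k with i | i
    · have := isProbabilityMeasure_expMeasure hl0
      exact inferInstanceAs (SigmaFinite (expMeasure l))
    · have : IsFiniteMeasure ((μ univ)⁻¹ • μ) := ⟨by
        rw [Measure.smul_apply, smul_eq_mul]
        exact ENNReal.mul_lt_top (ENNReal.inv_lt_top.2 (by simpa [pos_iff_ne_zero] using hμ))
          (measure_lt_top _ _)⟩
      exact inferInstanceAs (SigmaFinite ((μ univ)⁻¹ • μ))
  set C : ℝ≥0∞ := ENNReal.ofReal (l ^ n * Real.exp (-(l * t))) with hC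
  refine ⟨C, ENNReal.ofReal_ne_top, ?_⟩
  set A : Set Ω := {ω | T n ω ≤ t ∧ t < T (n + 1) ω} with hA
  have hAm : MeasurableSet A :=
    (measurableSet_le (hN.measurable_time n) measurable_const).inter
      (measurableSet_lt measurable_const (hN.measurable_time _))
  have hJA : {ω | jumpCount T t ω = n} =ᵐ[P] A := by
    filter_upwards [hN.ae_strictMono hl0] with ω hω
    exact propext (jumpCount_eq_iff hω hn)
  have hgm := hN.measurable_gapVector n
  have hcm : Measurable (cumul (n := n)) := measurePreserving_cumul.measurable
  have hnm : Measurable (noiseVector T Δ n) := by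
    have : noiseVector T Δ n = fun ω => cumul (gapVector T Δ n ω) :=
      funext fun ω => (hN.cumul_gapVector n ω).symm
    rw [this]
    exact hcm.comp hgm
  have hR := isOpen_mixedRegion t hI n
  have hdens_region : (volume.restrict (mixedRegion t I n)).withDensity
        (fun v => ∏ i, ENNReal.ofReal (Real.exp (ρ (v (Sum.inr i)))))
      = (volume.restrict (mixedRegion t I n)).withDensity (fun v => ∏ i, D (v (Sum.inr i))) := by
    refine withDensity_congr_ae ((ae_restrict_iff' hR.measurableSet).2
      (Filter.Eventually.of_forall fun v hv => ?_))
    exact Finset.prod_congr rfl fun i _ => by rw [hD, indicator_of_mem (hv.2 i)]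
  rw [Measure.restrict_congr_set hJA, hdens_region]
  refine Measure.ext_of_lintegral _ fun F hF => ?_
  rw [lintegral_map hF hnm, ← lintegral_indicator hAm, lintegral_smul_measure]
  set Sm : (Fin n ⊕ Fin n → ℝ) → ℝ := fun w => ∑ i : Fin n, w (Sum.inl i) with hSm
  have hSmm : Measurable Sm := by fun_prop
  set Ψ : (Fin n ⊕ Fin n → ℝ) × ℝ → ℝ≥0∞ :=
    {p : (Fin n ⊕ Fin n → ℝ) × ℝ | Sm p.1 ≤ t ∧ t < Sm p.1 + p.2}.indicator
      (fun p => F (cumul p.1)) with hΨ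
  have hΨm : Measurable Ψ := by
    refine (hF.comp (hcm.comp measurable_fst)).indicator ?_
    exact (measurableSet_le (hSmm.comp measurable_fst) measurable_const).inter
      (measurableSet_lt measurable_const ((hSmm.comp measurable_fst).add measurable_snd))
  have hSmT : ∀ ω, Sm (gapVector T Δ n ω) = T n ω := by
    intro ω
    simp only [hSm, gapVector, Sum.elim_inl]
    rw [Fin.sum_univ_eq_sum_range (fun i => T (i + 1) ω - T i ω) n, Finset.sum_range_sub
      (fun k => T k ω), hN.time_zero, sub_zero]
  have hΨω : ∀ ω, A.indicator (fun ω => F (noiseVector T Δ n ω)) ω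
      = Ψ (gapVector T Δ n ω, T (n + 1) ω - T n ω) := by
    intro ω
    have hiff : ω ∈ A ↔ (gapVector T Δ n ω, T (n + 1) ω - T n ω) ∈
        {p : (Fin n ⊕ Fin n → ℝ) × ℝ | Sm p.1 ≤ t ∧ t < Sm p.1 + p.2} := by
      simp only [hA, mem_ofPred_eq, hSmT, add_sub_cancel]
    by_cases hω : ω ∈ A
    · rw [indicator_of_mem hω, hΨ, indicator_of_mem (hiff.1 hω), hN.cumul_gapVector]
    · rw [indicator_of_notMem hω, hΨ, indicator_of_notMem (fun h => hω (hiff.2 h))]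
  rw [lintegral_congr hΨω, ← lintegral_map (f := Ψ) (g := fun ω =>
    (gapVector T Δ n ω, T (n + 1) ω - T n ω)) hΨm
    (hgm.prodMk ((hN.measurable_time _).sub (hN.measurable_time _))), hN.map_gapVector, ← hl]
  have hexpP := isProbabilityMeasure_expMeasure hl0
  rw [lintegral_prod _ hΨm.aemeasurable, hpi, pi_withDensity hdm]
  have hinner : ∀ w, ∫⁻ e, Ψ (w, e) ∂(expMeasure l)
      = {w | Sm w ≤ t}.indicator
        (fun w => F (cumul w) * ENNReal.ofReal (Real.exp (-(l * (t - Sm w))))) w := by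
    intro w
    by_cases hw : Sm w ≤ t
    · rw [indicator_of_mem (show w ∈ {w | Sm w ≤ t} from hw), ← expMeasure_Ioi hl0 (sub_nonneg.2 hw),
        ← lintegral_indicator_const measurableSet_Ioi]
      refine lintegral_congr fun e => ?_
      have hiff : (w, e) ∈ {p : (Fin n ⊕ Fin n → ℝ) × ℝ | Sm p.1 ≤ t ∧ t < Sm p.1 + p.2} ↔
          e ∈ Ioi (t - Sm w) := by
        simp only [mem_ofPred_eq, mem_Ioi, hw, true_and]
        exact ⟨fun h => by linarith, fun h => by linarith⟩
      by_cases he : e ∈ Ioi (t - Sm w)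
      · rw [indicator_of_mem he, hΨ, indicator_of_mem (hiff.2 he)]
      · rw [indicator_of_notMem he, hΨ, indicator_of_notMem (fun h => he (hiff.1 h))]
    · rw [indicator_of_notMem (show w ∉ {w | Sm w ≤ t} from hw)]
      have : ∀ e, Ψ (w, e) = 0 := fun e => by
        rw [hΨ, indicator_of_notMem]
        exact fun h => hw h.1
      simp [this]
  simp only [hinner]
  have hprodm : Measurable (fun w : Fin n ⊕ Fin n → ℝ => ∏ k, dens k (w k)) :=
    Finset.measurable_fun_prod _ fun k _ => (hdm k).comp (measurable_pi_apply k)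
  have hinm : Measurable (fun w => {w | Sm w ≤ t}.indicator
      (fun w => F (cumul w) * ENNReal.ofReal (Real.exp (-(l * (t - Sm w))))) w) := by
    have hem : Measurable fun w => ENNReal.ofReal (Real.exp (-(l * (t - Sm w)))) := by fun_prop
    exact Measurable.indicator ((hF.comp hcm).mul hem) (measurableSet_le hSmm measurable_const)
  rw [lintegral_withDensity_eq_lintegral_mul _ hprodm hinm]
  set R' : Set (Fin n ⊕ Fin n → ℝ) := {v | (∀ j < n, knot t (fun i => v (Sum.inl i)) j
    < knot t (fun i => v (Sum.inl i)) (j + 1)) ∧ knot t (fun i => v (Sum.inl i)) n ≤ t} with hR'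
  have hkm : ∀ j, Measurable (fun v : Fin n ⊕ Fin n → ℝ => knot t (fun i => v (Sum.inl i)) j) :=
    fun j => (continuous_knot t j).measurable.comp
      (show Measurable fun (v : Fin n ⊕ Fin n → ℝ) (i : Fin n) => v (Sum.inl i) by fun_prop)
  have hR'm : MeasurableSet R' := by
    have : R' = (⋂ j ∈ Finset.range n, {v : Fin n ⊕ Fin n → ℝ | knot t (fun i => v (Sum.inl i)) j
        < knot t (fun i => v (Sum.inl i)) (j + 1)})
        ∩ {v | knot t (fun i => v (Sum.inl i)) n ≤ t} := by
      ext v; simp [hR']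
    rw [this]
    exact (Finset.measurableSet_biInter _ fun j _ => measurableSet_lt (hkm j) (hkm _)).inter
      (measurableSet_le (hkm n) measurable_const)
  set Θ : (Fin n ⊕ Fin n → ℝ) → ℝ≥0∞ := R'.indicator
    (fun v => (∏ i, D (v (Sum.inr i))) * F v) with hΘ
  have hDprod : Measurable (fun v : Fin n ⊕ Fin n → ℝ => ∏ i, D (v (Sum.inr i))) :=
    Finset.measurable_fun_prod _ fun k _ => hDm.comp (measurable_pi_apply _)
  have hΘm : Measurable Θ := (hDprod.mul hF).indicator hR'm
  have hpoint : ∀ w, ((fun w : Fin n ⊕ Fin n → ℝ => ∏ k, dens k (w k)) *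
      fun w => {w | Sm w ≤ t}.indicator
        (fun w => F (cumul w) * ENNReal.ofReal (Real.exp (-(l * (t - Sm w))))) w) w
      = C * Θ (cumul w) := by
    intro w
    simp only [Pi.mul_apply]
    have hmem : cumul w ∈ R' ↔ (∀ i : Fin n, 0 < w (Sum.inl i)) ∧ Sm w ≤ t := by
      simp only [hR', mem_ofPred_eq, knot_cumul t w le_rfl, sum_gapSeq]
      rw [← gapSeq_pos_iff]
      refine and_congr_left fun _ => forall₂_congr fun j hj => ?_
      rw [knot_cumul t w hj.le, knot_cumul t w hj, Finset.sum_range_succ]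
      simp
    rw [Fintype.prod_sum_type]
    simp only [hdens, Sum.elim_inl, Sum.elim_inr]
    by_cases hw : cumul w ∈ R'
    · obtain ⟨hpos, hS⟩ := hmem.1 hw
      rw [indicator_of_mem (show w ∈ {w | Sm w ≤ t} from hS), hΘ, indicator_of_mem hw]
      have h1 : ∏ i : Fin n, eD (w (Sum.inl i)) = ENNReal.ofReal (l ^ n * Real.exp (-(l * Sm w))) := by
        have h2 : ∀ i : Fin n, eD (w (Sum.inl i))
            = ENNReal.ofReal (l * Real.exp (-(l * w (Sum.inl i)))) := fun i =>
          indicator_of_mem (mem_Ioi.2 (hpos i)) _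
        rw [Finset.prod_congr rfl fun i _ => h2 i, ← ENNReal.ofReal_prod_of_nonneg
          (fun i _ => by positivity), Finset.prod_mul_distrib, ← Real.exp_sum]
        simp [hSm, Finset.mul_sum]
      have h3 : C = ENNReal.ofReal (l ^ n * Real.exp (-(l * Sm w))) *
          ENNReal.ofReal (Real.exp (-(l * (t - Sm w)))) := by
        rw [hC, ← ENNReal.ofReal_mul (by positivity), mul_assoc, ← Real.exp_add]
        congr 3
        ring
      rw [h1, h3]
      simp only [cumul, Sum.elim_inr]
      ring
    · rw [hΘ, indicator_of_notMem hw, mul_zero]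
      by_cases hS : Sm w ≤ t
      · have : ∃ i : Fin n, w (Sum.inl i) ≤ 0 := by
          by_contra hcon
          push Not at hcon
          exact hw (hmem.2 ⟨hcon, hS⟩)
        obtain ⟨i, hi⟩ := this
        rw [Finset.prod_eq_zero (f := fun i => eD (w (Sum.inl i))) (Finset.mem_univ i)
          (indicator_of_notMem (by simpa using hi) _)]
        simp
      · rw [indicator_of_notMem (show w ∉ {w | Sm w ≤ t} from hS), mul_zero]
  rw [lintegral_congr hpoint, lintegral_const_mul C (f := fun w => Θ (cumul w)) (hΘm.comp hcm),
    measurePreserving_cumul.lintegral_comp hΘm, smul_eq_mul,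
    lintegral_withDensity_eq_lintegral_mul _ hDprod hF, ← lintegral_indicator hR.measurableSet]
  congr 1
  refine lintegral_congr_ae ?_
  have hlast : ∀ᵐ v : Fin n ⊕ Fin n → ℝ, v (Sum.inl ⟨n - 1, by omega⟩) ≠ t := by
    rw [ae_iff]
    simp only [not_not]
    rw [volume_pi]
    exact Measure.pi_hyperplane (ι := Fin n ⊕ Fin n) (α := fun _ => ℝ) (fun _ => volume)
      (Sum.inl ⟨n - 1, by omega⟩) t
  filter_upwards [hlast] with v hv
  have hkn : knot t (fun i => v (Sum.inl i)) n = v (Sum.inl ⟨n - 1, by omega⟩) := by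
    obtain ⟨m, rfl⟩ : ∃ m, n = m + 1 := ⟨n - 1, by omega⟩
    rw [knot_succ_of_lt t _ (Nat.lt_succ_self m)]
    rfl
  by_cases hI' : ∀ i, v (Sum.inr i) ∈ I
  · have hiff : v ∈ R' ↔ v ∈ mixedRegion t I n := by
      simp only [hR', mixedRegion, mem_ofPred_eq, hI', implies_true, and_true]
      constructor
      · rintro ⟨h1, h2⟩ j hj
        rcases hj.eq_or_lt with rfl | hj
        · rw [knot_last]
          exact lt_of_le_of_ne h2 (by rw [hkn]; exact hv)
        · exact h1 j hj
      · intro h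
        refine ⟨fun j hj => h j hj.le, ?_⟩
        have := h n le_rfl
        rw [knot_last] at this
        exact this.le
    by_cases hv' : v ∈ R'
    · rw [hΘ, indicator_of_mem hv', indicator_of_mem (hiff.1 hv')]
      rfl
    · rw [hΘ, indicator_of_notMem hv', indicator_of_notMem (fun h => hv' (hiff.2 h))]
  · rw [indicator_of_notMem (fun h : v ∈ mixedRegion t I n => hI' h.2)]
    push Not at hI'
    obtain ⟨i, hi⟩ := hI'
    have h0 : ∏ i, D (v (Sum.inr i)) = 0 :=
      Finset.prod_eq_zero (Finset.mem_univ i) (indicator_of_notMem hi _)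
    simp [hΘ, indicator_apply, h0]

end Law

/-! ### Partial derivatives -/

section Partial

set_option linter.unusedSectionVars false

variable {ι : Type*} [Fintype ι] [DecidableEq ι] {f g : (ι → ℝ) → ℝ} {v : ι → ℝ}

lemma hasDerivAt_pderiv (hf : DifferentiableAt ℝ f v) (i : ι) :
    HasDerivAt (fun y => f (Function.update v i y)) (pderiv f i v) (v i) := by
  have h1 : DifferentiableAt ℝ (fun y => f (Function.update v i y)) (v i) := by
    have h2 : HasDerivAt (Function.update v i) (Pi.single i 1) (v i) := hasDerivAt_update v i (v i)
    have h3 : HasFDerivAt f (fderiv ℝ f v) (Function.update v i (v i)) := by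
      rw [Function.update_eq_self]; exact hf.hasFDerivAt
    exact (h3.comp_hasDerivAt (v i) h2).differentiableAt
  exact h1.hasDerivAt

lemma pderiv_eq_fderiv (hf : DifferentiableAt ℝ f v) (i : ι) :
    pderiv f i v = fderiv ℝ f v (Pi.single i 1) := by
  have h2 : HasDerivAt (Function.update v i) (Pi.single i 1) (v i) := hasDerivAt_update v i (v i)
  have h3 : HasFDerivAt f (fderiv ℝ f v) (Function.update v i (v i)) := by
    rw [Function.update_eq_self]; exact hf.hasFDerivAt
  exact (h3.comp_hasDerivAt (v i) h2).deriv

lemma pderiv_congr (h : f =ᶠ[𝓝 v] g) (i : ι) : pderiv f i v = pderiv g i v := by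
  refine Filter.EventuallyEq.deriv_eq ?_
  have hc : Filter.Tendsto (fun y => Function.update v i y) (𝓝 (v i)) (𝓝 v) := by
    have : Continuous (fun y => Function.update v i y) := by fun_prop
    simpa using this.tendsto (v i)
  exact hc.eventually h

lemma aestronglyMeasurable_pderiv {U : Set (ι → ℝ)} (hU : IsOpen U) {f : (ι → ℝ) → ℝ}
    (hf : ∀ v ∈ U, DifferentiableAt ℝ f v) (i : ι) :
    AEStronglyMeasurable (pderiv f i) (volume.restrict U) := by
  refine AEStronglyMeasurable.congr
    (measurable_fderiv_apply_const ℝ f (Pi.single i 1)).aestronglyMeasurable ?_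
  filter_upwards [ae_restrict_mem hU.measurableSet] with v hv
  exact (pderiv_eq_fderiv (hf v hv) i).symm

lemma aestronglyMeasurable_of_differentiableAt {U : Set (ι → ℝ)} (hU : IsOpen U)
    {f : (ι → ℝ) → ℝ} (hf : ∀ v ∈ U, DifferentiableAt ℝ f v) :
    AEStronglyMeasurable f (volume.restrict U) :=
  (show ContinuousOn f U from fun v hv => (hf v hv).continuousAt.continuousWithinAt
    ).aestronglyMeasurable hU.measurableSet

lemma integral_eq_zero_of_slices (i : ι) {f : (ι → ℝ) → ℝ} (hf : Integrable f)
    (h : ∀ v, Integrable (fun y => f (Function.update v i y)) →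
      ∫ y, f (Function.update v i y) = 0) : ∫ v, f v = 0 := by
  classical
  obtain ⟨p, hp⟩ : ∃ p : ι → Prop, ∀ j, p j ↔ j = i := ⟨_, fun _ => Iff.rfl⟩
  let _ : Unique {j // p j} :=
    ⟨⟨⟨i, (hp i).2 rfl⟩⟩, fun j => Subtype.ext ((hp _).1 j.2)⟩
  set e := MeasurableEquiv.piEquivPiSubtypeProd (fun _ : ι => ℝ) p with he
  have hmp := volume_preserving_piEquivPiSubtypeProd (fun _ : ι => ℝ) p
  have hmps := hmp.symm
  rw [← hmps.integral_comp' f]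
  have h_int : Integrable (fun z => f (e.symm z)) :=
    (hmps.integrable_comp_emb e.symm.measurableEmbedding).2 hf
  rw [Measure.volume_eq_prod] at h_int ⊢
  refine (integral_prod_symm _ h_int).trans ?_
  refine integral_eq_zero_of_ae (Filter.Eventually.of_forall fun z => ?_)
  have hu := (volume_preserving_funUnique {j // p j} ℝ).symm
  have h0 := hu.integral_comp' (fun y => f (e.symm (y, z)))
  simp only [Pi.zero_apply]
  rw [Subsingleton.elim (Unique.fintype : Fintype {j // p j}) (Subtype.fintype p)] at h0
  refine h0.symm.trans ?_
  set v : ι → ℝ := e.symm (0, z) with hv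
  have hupd : ∀ y : ℝ, e.symm ((MeasurableEquiv.funUnique {j // p j} ℝ).symm y, z)
      = Function.update v i y := by
    intro y
    funext j
    by_cases hj : j = i
    · subst hj
      simp [he, MeasurableEquiv.piEquivPiSubtypeProd, Equiv.piEquivPiSubtypeProd, (hp j).2 rfl]
    · simp [hv, he, MeasurableEquiv.piEquivPiSubtypeProd, Equiv.piEquivPiSubtypeProd, hj, hp]
  simp only [hupd]
  by_cases hin : Integrable (fun y => f (Function.update v i y))
  · exact h v hin
  · exact integral_undef hin

/-- A function on an open region dominated by a weight that vanishes at the ends of every slice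
has a partial derivative with zero integral. -/
lemma integral_pderiv_eq_zero {U : Set (ι → ℝ)} (hU : IsOpen U) (hb : Bornology.IsBounded U)
    (i : ι) {K : (ι → ℝ) → ℝ} (hK : ∀ v ∈ U, DifferentiableAt ℝ K v)
    (h_int : IntegrableOn (pderiv K i) U) {W : (ι → ℝ) → ℝ}
    (hbd : ∀ v ∈ U, ∃ C, ∀ y, Function.update v i y ∈ U →
      |K (Function.update v i y)| ≤ C * W (Function.update v i y))
    (hWc : ∀ v ∈ U, Continuous fun y => W (Function.update v i y))
    (hW0 : ∀ v ∈ U, ∀ y, Function.update v i y ∉ U → W (Function.update v i y) = 0)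
    (hcount : ∀ v ∈ U, (frontier {y | Function.update v i y ∈ U}).Countable) :
    ∫ v in U, pderiv K i v = 0 := by
  rw [← integral_indicator hU.measurableSet]
  refine integral_eq_zero_of_slices i ((integrable_indicator_iff hU.measurableSet).2 h_int) ?_
  intro v hvint
  by_cases hne : ∃ y₀, Function.update v i y₀ ∈ U
  swap
  · push Not at hne
    simp [indicator_of_notMem (hne _)]
  obtain ⟨y₀, hy₀⟩ := hne
  obtain ⟨C, hC⟩ := hbd _ hy₀
  have hWc := hWc _ hy₀
  have hW0 := hW0 _ hy₀
  have hcount := hcount _ hy₀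
  simp only [Function.update_idem] at hC hWc hW0 hcount
  set V : Set ℝ := {y | Function.update v i y ∈ U} with hV
  have hcu : Continuous (fun y => Function.update v i y) := by fun_prop
  have hVo : IsOpen V := hU.preimage hcu
  obtain ⟨R, hR⟩ := hb.subset_ball 0
  have hVR : ∀ y ∈ V, |y| < R := by
    intro y hy
    have h1 := hR hy
    rw [mem_ball_zero_iff] at h1
    have h2 := norm_le_pi_norm (Function.update v i y) i
    rw [Function.update_self] at h2
    exact lt_of_le_of_lt h2 h1
  set k : ℝ → ℝ := V.indicator fun y => K (Function.update v i y) with hk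
  have hkd : ∀ y ∈ V, HasDerivAt k (pderiv K i (Function.update v i y)) y := by
    intro y hy
    have h1 := hasDerivAt_pderiv (hK _ hy) i
    simp only [Function.update_idem, Function.update_self] at h1
    refine h1.congr_of_eventuallyEq ?_
    filter_upwards [hVo.mem_nhds hy] with z hz
    exact indicator_of_mem hz _
  have hkc : Continuous k := by
    refine continuous_iff_continuousAt.2 fun y => ?_
    by_cases hy : y ∈ V
    · exact (hkd y hy).continuousAt
    · have hky : k y = 0 := indicator_of_notMem hy _
      rw [ContinuousAt, hky]
      refine squeeze_zero_norm (a := fun z => |C * W (Function.update v i z)|) (fun z => ?_) ?_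
      · by_cases hz : z ∈ V
        · rw [hk, indicator_of_mem hz]
          exact (hC z hz).trans (le_abs_self _)
        · rw [hk, indicator_of_notMem hz, norm_zero]
          exact abs_nonneg _
      · have := (show Continuous fun z => |C * W (Function.update v i z)| from
          (hWc.const_smul C).abs).tendsto y
        rwa [hW0 y hy, mul_zero, abs_zero] at this
  have hkd' : ∀ y ∉ frontier V,
      HasDerivAt k (U.indicator (pderiv K i) (Function.update v i y)) y := by
    intro y hy
    by_cases hyV : y ∈ V
    · rw [indicator_of_mem (show Function.update v i y ∈ U from hyV)]
      exact hkd y hyV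
    · rw [indicator_of_notMem (show Function.update v i y ∉ U from hyV)]
      have : y ∉ closure V := fun h => hy ⟨h, by rwa [hVo.interior_eq]⟩
      refine (hasDerivAt_const y (0 : ℝ)).congr_of_eventuallyEq ?_
      filter_upwards [isClosed_closure.isOpen_compl.mem_nhds this] with z hz
      exact indicator_of_notMem (fun h => hz (subset_closure h)) _
  have hRpos : 0 < R := lt_of_le_of_lt (abs_nonneg _) (hVR y₀ hy₀)
  have hftc := integral_eq_of_hasDerivAt_off_countable (a := -R) (b := R) k
    (fun y => U.indicator (pderiv K i) (Function.update v i y)) hcount hkc.continuousOn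
    (fun y hy => hkd' y hy.2) hvint.intervalIntegrable
  have hzero : ∀ y, |y| = R → k y = 0 := fun y hy =>
    indicator_of_notMem (fun h => (hVR y h).ne hy) _
  rw [hzero R (abs_of_pos hRpos), hzero (-R) (by rw [abs_neg, abs_of_pos hRpos]), sub_zero,
    intervalIntegral.integral_of_le (by linarith)] at hftc
  rw [← hftc, setIntegral_eq_integral_of_forall_compl_eq_zero]
  intro y hy
  refine indicator_of_notMem (fun h => hy ?_) _
  have := abs_lt.1 (hVR y h)
  exact ⟨this.1, this.2.le⟩

end Partial

/-! ### Integration by parts on a weighted region -/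

section WeightedIBP

variable {ι : Type*} [Fintype ι] [DecidableEq ι]

/-- An open bounded region with weights vanishing at the ends of the slices, and a density `p`
with logarithmic derivatives `score`. -/
structure WeightedRegion (U : Set (ι → ℝ)) (w score : ι → (ι → ℝ) → ℝ) (p : (ι → ℝ) → ℝ) :
    Prop where
  isOpen : IsOpen U
  bdd : Bornology.IsBounded U
  weight_diff : ∀ i, ∀ v ∈ U, DifferentiableAt ℝ (w i) v
  weight_pos : ∀ i, ∀ v ∈ U, 0 < w i v
  weight_cont : ∀ i, ∀ v ∈ U, Continuous fun y => w i (Function.update v i y)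
  weight_zero : ∀ i, ∀ v ∈ U, ∀ y, Function.update v i y ∉ U → w i (Function.update v i y) = 0
  frontier : ∀ i, ∀ v ∈ U, (frontier {y | Function.update v i y ∈ U}).Countable
  dens_diff : ∀ v ∈ U, DifferentiableAt ℝ p v
  dens_bdd : ∃ C, ∀ v ∈ U, |p v| ≤ C
  dens_score : ∀ i, ∀ v ∈ U, pderiv p i v = p v * score i v
  score_int : ∀ i, IntegrableOn (score i) U
  exists_dual : ∀ i, ∃ j, (∀ v ∈ U, ∀ y, w j (Function.update v i y) = w j v) ∧
    ∀ k, IntegrableOn (fun v => (w j v)⁻¹ * |pderiv (w k) i v|) U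

/-- A nondegenerate functional `F` and a functional `G`, with bounded derivatives. -/
structure NondegPair (U : Set (ι → ℝ)) (F G : (ι → ℝ) → ℝ) : Prop where
  diff : ∀ v ∈ U, DifferentiableAt ℝ F v
  diff_two : ∀ i, ∀ v ∈ U, DifferentiableAt ℝ (pderiv F i) v
  diff_right : ∀ v ∈ U, DifferentiableAt ℝ G v
  bdd : ∃ C, ∀ v ∈ U, |F v| ≤ C ∧ |G v| ≤ C ∧ ∀ i, |pderiv F i v| ≤ C ∧ |pderiv G i v| ≤ C ∧
    ∀ j, |pderiv (pderiv F j) i v| ≤ C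
  nondeg : ∃ κ, 0 < κ ∧ ∀ v ∈ U, ∀ i, κ ≤ |pderiv F i v|

variable {U : Set (ι → ℝ)} {w score : ι → (ι → ℝ) → ℝ} {p F G : (ι → ℝ) → ℝ} {φ : ℝ → ℝ}

lemma abs_mul_le_of_le {a b A B : ℝ} (ha : |a| ≤ A) (hb : |b| ≤ B) : |a * b| ≤ A * B := by
  rw [abs_mul]
  exact mul_le_mul ha hb (abs_nonneg _) ((abs_nonneg _).trans ha)

/-- The `i`-th component of the vector field that is integrated by parts. -/
def ibpField (w : ι → (ι → ℝ) → ℝ) (p F G : (ι → ℝ) → ℝ) (φ : ℝ → ℝ) (i : ι) (v : ι → ℝ) : ℝ :=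
  φ (F v) * p v * (pderiv F i v * G v * (invCov w F v * w i v))

lemma carre_self_differentiableAt (hw : WeightedRegion U w score p) (hF : NondegPair U F G)
    {v : ι → ℝ} (hv : v ∈ U) : DifferentiableAt ℝ (carre w F F) v := by
  unfold carre
  refine DifferentiableAt.fun_sum fun i _ => ?_
  exact ((hw.weight_diff i v hv).mul (hF.diff_two i v hv)).mul (hF.diff_two i v hv)

lemma le_carre_self (hw : WeightedRegion U w score p) {κ : ℝ} (hκ : 0 < κ) {v : ι → ℝ}
    (hv : v ∈ U) (hk : ∀ i, κ ≤ |pderiv F i v|) (j : ι) : κ ^ 2 * w j v ≤ carre w F F v := by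
  have h1 : w j v * pderiv F j v * pderiv F j v ≤ carre w F F v := by
    refine Finset.single_le_sum (f := fun i => w i v * pderiv F i v * pderiv F i v)
      (fun i _ => ?_) (Finset.mem_univ j)
    have := (hw.weight_pos i v hv).le
    nlinarith [mul_nonneg this (mul_self_nonneg (pderiv F i v))]
  have h2 : κ ^ 2 ≤ pderiv F j v ^ 2 := by
    rw [← sq_abs (pderiv F j v)]
    exact pow_le_pow_left₀ hκ.le (hk j) 2
  nlinarith [hw.weight_pos j v hv]

lemma pderiv_carre_self (hw : WeightedRegion U w score p) (hF : NondegPair U F G)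
    {v : ι → ℝ} (hv : v ∈ U) (i : ι) :
    pderiv (carre w F F) i v = ∑ j, (pderiv (w j) i v * pderiv F j v ^ 2
      + 2 * (w j v * (pderiv F j v * pderiv (pderiv F j) i v))) := by
  have h1 : ∀ j ∈ (Finset.univ : Finset ι), HasDerivAt (fun y => w j (Function.update v i y) *
      pderiv F j (Function.update v i y) * pderiv F j (Function.update v i y))
      (pderiv (w j) i v * pderiv F j v ^ 2
        + 2 * (w j v * (pderiv F j v * pderiv (pderiv F j) i v))) (v i) := by
    intro j _
    have hw' := hasDerivAt_pderiv (hw.weight_diff j v hv) i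
    have hF' := hasDerivAt_pderiv (hF.diff_two j v hv) i
    refine ((hw'.fun_mul hF').fun_mul hF').congr_deriv ?_
    simp only [Function.update_eq_self]
    ring
  exact (HasDerivAt.fun_sum h1).deriv

lemma carre_self_pos [Nonempty ι] (hw : WeightedRegion U w score p) (hF : NondegPair U F G)
    {v : ι → ℝ} (hv : v ∈ U) : 0 < carre w F F v := by
  obtain ⟨κ, hκ, hk⟩ := hF.nondeg
  have j : ι := Classical.arbitrary ι
  exact lt_of_lt_of_le (mul_pos (pow_pos hκ 2) (hw.weight_pos j v hv))
    (le_carre_self hw hκ hv (hk v hv) j)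

lemma invCov_differentiableAt [Nonempty ι] (hw : WeightedRegion U w score p)
    (hF : NondegPair U F G) {v : ι → ℝ} (hv : v ∈ U) : DifferentiableAt ℝ (invCov w F) v :=
  (carre_self_differentiableAt hw hF hv).fun_inv (carre_self_pos hw hF hv).ne'

lemma pderiv_invCov [Nonempty ι] (hw : WeightedRegion U w score p) (hF : NondegPair U F G)
    {v : ι → ℝ} (hv : v ∈ U) (i : ι) :
    pderiv (invCov w F) i v = -(invCov w F v ^ 2 * pderiv (carre w F F) i v) := by
  have h1 := hasDerivAt_pderiv (carre_self_differentiableAt hw hF hv) i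
  have h2 : carre w F F (Function.update v i (v i)) ≠ 0 := by
    rw [Function.update_eq_self]; exact (carre_self_pos hw hF hv).ne'
  refine (h1.fun_inv h2).deriv.trans ?_
  rw [Function.update_eq_self] at h2 ⊢
  simp only [invCov]
  field_simp

lemma ibpField_differentiableAt [Nonempty ι] (hw : WeightedRegion U w score p)
    (hF : NondegPair U F G) (hφ : ContDiff ℝ 1 φ) (i : ι) {v : ι → ℝ} (hv : v ∈ U) :
    DifferentiableAt ℝ (ibpField w p F G φ i) v := by
  have h1 : DifferentiableAt ℝ (fun v => φ (F v)) v :=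
    ((hφ.differentiable one_ne_zero) (F v)).comp v (hF.diff v hv)
  exact (h1.mul (hw.dens_diff v hv)).mul (((hF.diff_two i v hv).mul (hF.diff_right v hv)).mul
    ((invCov_differentiableAt hw hF hv).mul (hw.weight_diff i v hv)))

lemma pderiv_ibpField [Nonempty ι] (hw : WeightedRegion U w score p) (hF : NondegPair U F G)
    (hφ : ContDiff ℝ 1 φ) (i : ι) {v : ι → ℝ} (hv : v ∈ U) :
    pderiv (ibpField w p F G φ i) i v
      = (deriv φ (F v) * pderiv F i v * p v * (pderiv F i v * G v)
        + φ (F v) * p v * (pderiv (pderiv F i) i v * G v)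
        + φ (F v) * p v * (pderiv F i v * pderiv G i v)) * (invCov w F v * w i v)
      + φ (F v) * p v * (pderiv F i v * G v) * (invCov w F v * w i v) * score i v
      + φ (F v) * p v * (pderiv F i v * G v)
        * (pderiv (invCov w F) i v * w i v + invCov w F v * pderiv (w i) i v) := by
  have hF1 := hasDerivAt_pderiv (hF.diff v hv) i
  have hφ1 : HasDerivAt φ (deriv φ (F v)) (F (Function.update v i (v i))) := by
    rw [Function.update_eq_self]
    exact ((hφ.differentiable one_ne_zero) (F v)).hasDerivAt
  have h1 := hφ1.comp (v i) hF1
  have h2 := hasDerivAt_pderiv (hw.dens_diff v hv) i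
  have h3 := hasDerivAt_pderiv (hF.diff_two i v hv) i
  have h4 := hasDerivAt_pderiv (hF.diff_right v hv) i
  have h5 := hasDerivAt_pderiv (invCov_differentiableAt hw hF hv) i
  have h6 := hasDerivAt_pderiv (hw.weight_diff i v hv) i
  have h7 := (h1.fun_mul h2).fun_mul ((h3.fun_mul h4).fun_mul (h5.fun_mul h6))
  refine h7.deriv.trans ?_
  simp only [Function.comp_apply, Function.update_eq_self, hw.dens_score i v hv]
  ring

lemma sum_pderiv_ibpField [Nonempty ι] (hw : WeightedRegion U w score p)
    (hF : NondegPair U F G) (hφ : ContDiff ℝ 1 φ) {v : ι → ℝ} (hv : v ∈ U) :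
    ∑ i, pderiv (ibpField w p F G φ i) i v
      = deriv φ (F v) * G v * p v - φ (F v) * malliavinWeight w score F G v * p v := by
  have hσ := (carre_self_pos hw hF hv).ne'
  have h1 : invCov w F v * carre w F F v = 1 := inv_mul_cancel₀ hσ
  have h2 : ∀ i, pderiv (ibpField w p F G φ i) i v
      = deriv φ (F v) * G v * p v * (invCov w F v * (w i v * pderiv F i v * pderiv F i v))
        + φ (F v) * p v * (G v * invCov w F v * ((pderiv (w i) i v + w i v * score i v) * pderiv F i v
            + w i v * pderiv (pderiv F i) i v))
        + φ (F v) * p v * (invCov w F v * (w i v * pderiv F i v * pderiv G i v))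
        + φ (F v) * p v * (G v * (w i v * pderiv F i v * pderiv (invCov w F) i v)) := by
    intro i
    rw [pderiv_ibpField hw hF hφ i hv]
    ring
  simp only [h2, Finset.sum_add_distrib, ← Finset.mul_sum]
  have h3 : invCov w F v * ∑ i, w i v * pderiv F i v * pderiv F i v = 1 := h1
  rw [h3]
  simp only [malliavinWeight, ouOp, Finset.sum_add_distrib]
  have h4 : carre w F G v = ∑ i, w i v * pderiv F i v * pderiv G i v := rfl
  have h5 : carre w F (invCov w F) v
    = ∑ i, w i v * pderiv F i v * pderiv (invCov w F) i v := rfl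
  rw [h4, h5]
  ring

/-- Uniform bounds for the factors of the field. -/
lemma exists_bound_factors (hw : WeightedRegion U w score p) (hF : NondegPair U F G)
    (hφ : ContDiff ℝ 1 φ) : ∃ M, 0 ≤ M ∧ ∀ v ∈ U, |φ (F v)| ≤ M ∧ |deriv φ (F v)| ≤ M ∧
      |p v| ≤ M ∧ |G v| ≤ M ∧ ∀ i, |pderiv F i v| ≤ M ∧ |pderiv G i v| ≤ M ∧
      ∀ j, |pderiv (pderiv F j) i v| ≤ M := by
  obtain ⟨C, hC⟩ := hF.bdd
  obtain ⟨C', hC'⟩ := hw.dens_bdd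
  obtain ⟨A, hA⟩ := isCompact_Icc.exists_bound_of_continuousOn (s := Icc (-C) C)
    hφ.continuous.continuousOn
  obtain ⟨B, hB⟩ := isCompact_Icc.exists_bound_of_continuousOn (s := Icc (-C) C)
    (hφ.continuous_deriv le_rfl).continuousOn
  refine ⟨max 0 (max (max C C') (max A B)), le_max_left _ _, fun v hv => ?_⟩
  obtain ⟨h1, h2, h3⟩ := hC v hv
  have hm : F v ∈ Icc (-C) C := abs_le.1 h1
  have e1 : C ≤ max 0 (max (max C C') (max A B)) := by simp
  have e2 : C' ≤ max 0 (max (max C C') (max A B)) := by simp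
  have e3 : A ≤ max 0 (max (max C C') (max A B)) := by simp
  have e4 : B ≤ max 0 (max (max C C') (max A B)) := by simp
  exact ⟨(hA _ hm).trans e3, (hB _ hm).trans e4, (hC' v hv).trans e2, h2.trans e1, fun i =>
    ⟨(h3 i).1.trans e1, (h3 i).2.1.trans e1, fun j => ((h3 i).2.2 j).trans e1⟩⟩

lemma invCov_mul_weight_le [Nonempty ι] (hw : WeightedRegion U w score p) (hF : NondegPair U F G) :
    ∃ A, 0 ≤ A ∧ ∀ v ∈ U, 0 ≤ invCov w F v ∧ ∀ j, invCov w F v * w j v ≤ A ∧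
      invCov w F v ≤ A * (w j v)⁻¹ := by
  obtain ⟨κ, hκ, hk⟩ := hF.nondeg
  refine ⟨(κ ^ 2)⁻¹, by positivity, fun v hv => ?_⟩
  have hσ := carre_self_pos hw hF hv
  have hγ : 0 < invCov w F v := inv_pos.2 hσ
  refine ⟨hγ.le, fun j => ?_⟩
  have hwj := hw.weight_pos j v hv
  have h1 := le_carre_self hw hκ hv (hk v hv) j
  have h2 : invCov w F v * w j v ≤ (κ ^ 2)⁻¹ := by
    rw [invCov, inv_mul_le_iff₀ hσ, ← div_eq_mul_inv, le_div_iff₀ (by positivity)]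
    linarith
  exact ⟨h2, by rw [← div_eq_mul_inv, le_div_iff₀ hwj]; exact h2⟩

lemma integrableOn_pderiv_ibpField [Nonempty ι] (hw : WeightedRegion U w score p)
    (hF : NondegPair U F G) (hφ : ContDiff ℝ 1 φ) (i : ι) :
    IntegrableOn (pderiv (ibpField w p F G φ i) i) U := by
  obtain ⟨M, hM0, hM⟩ := exists_bound_factors hw hF hφ
  obtain ⟨A, hA0, hA⟩ := invCov_mul_weight_le hw hF
  obtain ⟨d, -, hd⟩ := hw.exists_dual i
  have hvol : volume U ≠ ⊤ := hw.bdd.measure_lt_top.ne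
  have hmaj : IntegrableOn (fun v => (M * M * M * (M * M) + M * M * (M * M) + M * M * (M * M)) * A
      + M * M * (M * M) * A * |score i v|
      + M * M * (M * M) * ((∑ j, A * (A * (M ^ 2 * ((w d v)⁻¹ * |pderiv (w j) i v|) + 2 * (M * M))))
        + A * ((w d v)⁻¹ * |pderiv (w i) i v|))) U := by
    refine (((integrableOn_const hvol).add ((hw.score_int i).abs.const_mul _)).add
      (Integrable.const_mul (Integrable.add (integrable_finsetSum _ fun j _ => ?_)
        ((hd i).const_mul _)) _))
    exact (((((hd j).const_mul _).add (integrableOn_const hvol)).const_mul _).const_mul _)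
  refine hmaj.mono' (aestronglyMeasurable_pderiv hw.isOpen
    (fun v hv => ibpField_differentiableAt hw hF hφ i hv) i) ?_
  filter_upwards [ae_restrict_mem hw.isOpen.measurableSet] with v hv
  obtain ⟨m1, m2, m3, m4, m5⟩ := hM v hv
  obtain ⟨hγ0, hγ⟩ := hA v hv
  have hγw : ∀ j, |invCov w F v * w j v| ≤ A := fun j => by
    rw [abs_of_nonneg (mul_nonneg hγ0 (hw.weight_pos j v hv).le)]
    exact (hγ j).1
  have hγd : |invCov w F v| ≤ A * (w d v)⁻¹ := by
    rw [abs_of_nonneg hγ0]; exact (hγ d).2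
  have hwγ : |pderiv (invCov w F) i v * w i v|
      ≤ ∑ j, A * (A * (M ^ 2 * ((w d v)⁻¹ * |pderiv (w j) i v|) + 2 * (M * M))) := by
    rw [pderiv_invCov hw hF hv, pderiv_carre_self hw hF hv]
    have e : -(invCov w F v ^ 2 * ∑ j, (pderiv (w j) i v * pderiv F j v ^ 2
        + 2 * (w j v * (pderiv F j v * pderiv (pderiv F j) i v)))) * w i v
        = -∑ j, (invCov w F v * w i v) * (invCov w F v * pderiv (w j) i v * pderiv F j v ^ 2
          + 2 * ((invCov w F v * w j v) * (pderiv F j v * pderiv (pderiv F j) i v))) := by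
      rw [neg_mul, mul_right_comm, Finset.mul_sum]
      congr 1
      exact Finset.sum_congr rfl fun j _ => by ring
    rw [e, abs_neg]
    refine (Finset.abs_sum_le_sum_abs _ _).trans (Finset.sum_le_sum fun j _ => ?_)
    refine abs_mul_le_of_le (hγw i) ((abs_add_le _ _).trans ?_)
    have a1 : |invCov w F v * pderiv (w j) i v * pderiv F j v ^ 2|
        ≤ A * (w d v)⁻¹ * |pderiv (w j) i v| * M ^ 2 := by
      refine abs_mul_le_of_le (abs_mul_le_of_le hγd le_rfl) ?_
      rw [abs_pow]
      exact pow_le_pow_left₀ (abs_nonneg _) (m5 j).1 2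
    have a2 : |2 * ((invCov w F v * w j v) * (pderiv F j v * pderiv (pderiv F j) i v))|
        ≤ 2 * (A * (M * M)) :=
      abs_mul_le_of_le (by norm_num) (abs_mul_le_of_le (hγw j)
        (abs_mul_le_of_le (m5 j).1 ((m5 i).2.2 j)))
    linarith
  rw [Real.norm_eq_abs, pderiv_ibpField hw hF hφ i hv]
  refine (abs_add_le _ _).trans (add_le_add ((abs_add_le _ _).trans (add_le_add ?_ ?_)) ?_)
  · refine abs_mul_le_of_le ((abs_add_le _ _).trans (add_le_add ((abs_add_le _ _).trans
      (add_le_add ?_ ?_)) ?_)) (hγw i)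
    · exact abs_mul_le_of_le (abs_mul_le_of_le (abs_mul_le_of_le m2 (m5 i).1) m3)
        (abs_mul_le_of_le (m5 i).1 m4)
    · exact abs_mul_le_of_le (abs_mul_le_of_le m1 m3) (abs_mul_le_of_le ((m5 i).2.2 i) m4)
    · exact abs_mul_le_of_le (abs_mul_le_of_le m1 m3) (abs_mul_le_of_le (m5 i).1 (m5 i).2.1)
  · exact abs_mul_le_of_le (abs_mul_le_of_le (abs_mul_le_of_le (abs_mul_le_of_le m1 m3)
      (abs_mul_le_of_le (m5 i).1 m4)) (hγw i)) le_rfl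
  · refine abs_mul_le_of_le (abs_mul_le_of_le (abs_mul_le_of_le m1 m3)
      (abs_mul_le_of_le (m5 i).1 m4)) ((abs_add_le _ _).trans (add_le_add hwγ ?_))
    rw [← mul_assoc]
    exact abs_mul_le_of_le hγd le_rfl

lemma integral_pderiv_ibpField [Nonempty ι] (hw : WeightedRegion U w score p)
    (hF : NondegPair U F G) (hφ : ContDiff ℝ 1 φ) (i : ι) :
    ∫ v in U, pderiv (ibpField w p F G φ i) i v = 0 := by
  obtain ⟨M, hM0, hM⟩ := exists_bound_factors hw hF hφ
  obtain ⟨A, hA0, hA⟩ := invCov_mul_weight_le hw hF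
  obtain ⟨d, hdual, -⟩ := hw.exists_dual i
  refine integral_pderiv_eq_zero hw.isOpen hw.bdd i
    (fun v hv => ibpField_differentiableAt hw hF hφ i hv) (integrableOn_pderiv_ibpField hw hF hφ i)
    (W := w i) (fun v hv => ⟨M * M * (M * M) * (A * (w d v)⁻¹), fun y hy => ?_⟩)
    (hw.weight_cont i) (hw.weight_zero i) (hw.frontier i)
  obtain ⟨m1, -, m3, m4, m5⟩ := hM _ hy
  obtain ⟨hγ0, hγ⟩ := hA _ hy
  rw [← hdual v hv y]
  have e : ibpField w p F G φ i (Function.update v i y)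
      = φ (F (Function.update v i y)) * p (Function.update v i y)
        * (pderiv F i (Function.update v i y) * G (Function.update v i y))
        * invCov w F (Function.update v i y) * w i (Function.update v i y) := by
    rw [ibpField]; ring
  rw [e]
  refine abs_mul_le_of_le (abs_mul_le_of_le (abs_mul_le_of_le (abs_mul_le_of_le m1 m3)
    (abs_mul_le_of_le (m5 i).1 m4)) ?_) (abs_of_pos (hw.weight_pos i _ hy)).le
  rw [abs_of_nonneg hγ0]
  exact (hγ d).2

/-- Integration by parts with the weight `malliavinWeight`. -/
theorem integral_by_parts [Nonempty ι] (hw : WeightedRegion U w score p)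
    (hF : NondegPair U F G) (hφ : ContDiff ℝ 1 φ) :
    IntegrableOn (fun v => deriv φ (F v) * G v * p v) U ∧
    IntegrableOn (fun v => φ (F v) * malliavinWeight w score F G v * p v) U ∧
    ∫ v in U, deriv φ (F v) * G v * p v
      = ∫ v in U, φ (F v) * malliavinWeight w score F G v * p v := by
  obtain ⟨M, hM0, hM⟩ := exists_bound_factors hw hF hφ
  have hUm := hw.isOpen.measurableSet
  have hl : IntegrableOn (fun v => deriv φ (F v) * G v * p v) U := by
    refine Integrable.mono' (g := fun _ => M * M * M)
      (integrableOn_const hw.bdd.measure_lt_top.ne) ?_ ?_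
    · have hc : ∀ {f : (ι → ℝ) → ℝ}, (∀ v ∈ U, DifferentiableAt ℝ f v) → ContinuousOn f U :=
        fun hf v hv => (hf v hv).continuousAt.continuousWithinAt
      have h1 : ContinuousOn (fun v => deriv φ (F v) * G v * p v) U :=
        (((hφ.continuous_deriv le_rfl).comp_continuousOn (hc hF.diff)).mul (hc hF.diff_right)).mul
          (hc hw.dens_diff)
      exact h1.aestronglyMeasurable hUm
    · filter_upwards [ae_restrict_mem hUm] with v hv
      obtain ⟨-, m2, m3, m4, -⟩ := hM v hv
      exact abs_mul_le_of_le (abs_mul_le_of_le m2 m4) m3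
  have hsum : IntegrableOn (fun v => ∑ i, pderiv (ibpField w p F G φ i) i v) U :=
    integrable_finsetSum _ fun i _ => integrableOn_pderiv_ibpField hw hF hφ i
  have hr : IntegrableOn (fun v => φ (F v) * malliavinWeight w score F G v * p v) U := by
    refine (hl.sub hsum).congr ?_
    filter_upwards [ae_restrict_mem hUm] with v hv
    simp only [Pi.sub_apply, sum_pderiv_ibpField hw hF hφ hv]
    ring
  refine ⟨hl, hr, ?_⟩
  rw [← sub_eq_zero, ← integral_sub hl hr]
  have h1 : ∫ v in U, ∑ i, pderiv (ibpField w p F G φ i) i v = 0 := by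
    rw [integral_finsetSum _ fun i _ => integrableOn_pderiv_ibpField hw hF hφ i]
    exact Finset.sum_eq_zero fun i _ => integral_pderiv_ibpField hw hF hφ i
  rw [← h1]
  refine setIntegral_congr_fun hUm fun v hv => ?_
  exact (sum_pderiv_ibpField hw hF hφ hv).symm

end WeightedIBP

/-! ### Integrable singularities along coordinate directions -/

section Singular

open scoped ENNReal

lemma exists_lintegral_abs_sub_rpow_le {s : ℝ} (hs : -1 < s) (hs0 : s ≤ 0) (R : ℝ) :
    ∃ C : ℝ≥0∞, C ≠ ∞ ∧ ∀ κ : ℝ, ∫⁻ y in Ioo (-R) R, ENNReal.ofReal (|y - κ| ^ s) ≤ C := by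
  have h1 : IntervalIntegrable (fun y : ℝ => |y| ^ s) volume 0 1 := by
    refine (intervalIntegral.intervalIntegrable_rpow' (a := 0) (b := 1) hs).congr ?_
    rw [uIoc_of_le zero_le_one]
    exact fun y hy => by simp only [abs_of_pos hy.1]
  have h2 : IntervalIntegrable (fun y : ℝ => |y| ^ s) volume (-1) 0 := by
    have := ((IntervalIntegrable.iff_comp_neg (f := fun y : ℝ => |y| ^ s)).1 h1).symm
    simpa using this
  have h3 := (intervalIntegrable_iff_integrableOn_Ioo_of_le (by norm_num)).1 (h2.trans h1)
  have h4 : ∫⁻ y in Ioo (-1 : ℝ) 1, ENNReal.ofReal (|y| ^ s) < ∞ := h3.lintegral_lt_top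
  refine ⟨(∫⁻ y in Ioo (-1 : ℝ) 1, ENNReal.ofReal (|y| ^ s)) + volume (Ioo (-R) R),
    ENNReal.add_ne_top.2 ⟨h4.ne, by simp⟩, fun κ => ?_⟩
  have h5 : ∀ y : ℝ, ENNReal.ofReal (|y - κ| ^ s)
      ≤ (Ioo (-1 : ℝ) 1).indicator (fun y => ENNReal.ofReal (|y| ^ s)) (y - κ) + 1 := by
    intro y
    by_cases hy : y - κ ∈ Ioo (-1 : ℝ) 1
    · rw [indicator_of_mem hy]; exact le_self_add
    · rw [indicator_of_notMem hy, zero_add]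
      refine ENNReal.ofReal_le_one.2 (Real.rpow_le_one_of_one_le_of_nonpos ?_ hs0)
      by_contra hlt
      exact hy (abs_lt.1 (not_le.1 hlt))
  calc ∫⁻ y in Ioo (-R) R, ENNReal.ofReal (|y - κ| ^ s)
      ≤ ∫⁻ y in Ioo (-R) R,
        ((Ioo (-1 : ℝ) 1).indicator (fun y => ENNReal.ofReal (|y| ^ s)) (y - κ) + 1) :=
        lintegral_mono h5
    _ = (∫⁻ y in Ioo (-R) R, (Ioo (-1 : ℝ) 1).indicator (fun y => ENNReal.ofReal (|y| ^ s)) (y - κ))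
        + volume (Ioo (-R) R) := by
        rw [lintegral_add_right _ measurable_const]; simp
    _ ≤ (∫⁻ y, (Ioo (-1 : ℝ) 1).indicator (fun y => ENNReal.ofReal (|y| ^ s)) (y - κ))
        + volume (Ioo (-R) R) := by gcongr; exact Measure.restrict_le_self
    _ = _ := by
        rw [lintegral_sub_right_eq_self
          (fun y => (Ioo (-1 : ℝ) 1).indicator (fun y => ENNReal.ofReal (|y| ^ s)) y) κ,
          lintegral_indicator measurableSet_Ioo]

variable {ι : Type*} [Fintype ι]

/-- The open cube `(-R, R)^ι`. -/
def cube (ι : Type*) (R : ℝ) : Set (ι → ℝ) := univ.pi fun _ => Ioo (-R) R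

lemma measurableSet_cube (R : ℝ) : MeasurableSet (cube ι R) :=
  MeasurableSet.univ_pi fun _ => measurableSet_Ioo

lemma volume_cube_ne_top (R : ℝ) : volume (cube ι R) ≠ ∞ := by
  rw [cube, Real.volume_pi_Ioo]
  exact (ENNReal.prod_lt_top fun _ _ => ENNReal.ofReal_lt_top).ne

variable [DecidableEq ι]

lemma lintegral_cube_mul_le (i : ι) {R : ℝ} (hR : 0 < R) {C : ℝ≥0∞} {A B : (ι → ℝ) → ℝ≥0∞}
    (hA : Measurable A) (hB : Measurable B) (hBi : ∀ v y, B (Function.update v i y) = B v)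
    (hAi : ∀ v, ∫⁻ y in Ioo (-R) R, A (Function.update v i y) ≤ C) :
    ∫⁻ v in cube ι R, A v * B v ≤ C / ENNReal.ofReal (2 * R) * ∫⁻ v in cube ι R, B v := by
  have hm := measurableSet_cube (ι := ι) R
  rw [← lintegral_const_mul _ hB, ← lintegral_indicator hm, ← lintegral_indicator hm, volume_pi]
  refine lintegral_le_of_lmarginal_le {i} ((hA.mul hB).indicator hm)
    ((hB.const_mul _).indicator hm) ?_
  rw [lmarginal_singleton, lmarginal_singleton]
  intro v
  by_cases hv : ∀ j ≠ i, v j ∈ Ioo (-R) R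
  · have hmem : ∀ y, Function.update v i y ∈ cube ι R ↔ y ∈ Ioo (-R) R := by
      intro y
      simp only [cube, mem_univ_pi]
      constructor
      · intro h; simpa using h i
      · intro h j
        by_cases hj : j = i
        · subst hj; simpa using h
        · rw [Function.update_of_ne hj]; exact hv j hj
    have hind : ∀ (f : (ι → ℝ) → ℝ≥0∞) y, (cube ι R).indicator f (Function.update v i y)
        = (Ioo (-R) R).indicator (fun y => f (Function.update v i y)) y := by
      intro f y
      by_cases hy : y ∈ Ioo (-R) R
      · rw [indicator_of_mem hy, indicator_of_mem ((hmem y).2 hy)]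
      · rw [indicator_of_notMem hy, indicator_of_notMem (fun h => hy ((hmem y).1 h))]
    simp only [hind, lintegral_indicator measurableSet_Ioo, hBi]
    have hAm : Measurable (fun y => A (Function.update v i y)) :=
      hA.comp (measurable_update v)
    rw [lintegral_mul_const _ hAm, lintegral_const, Measure.restrict_apply_univ, Real.volume_Ioo,
      show R - -R = 2 * R by ring]
    calc (∫⁻ y in Ioo (-R) R, A (Function.update v i y)) * B v ≤ C * B v := by gcongr; exact hAi v
      _ = C / ENNReal.ofReal (2 * R) * ENNReal.ofReal (2 * R) * B v := by
        rw [ENNReal.div_mul_cancel (by simpa using hR) ENNReal.ofReal_ne_top]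
      _ = _ := by ring
  · have hmem : ∀ y, Function.update v i y ∉ cube ι R := by
      intro y hy
      refine hv fun j hj => ?_
      have := hy j (mem_univ j)
      rwa [Function.update_of_ne hj] at this
    simp [indicator_of_notMem (hmem _)]

lemma integrableOn_cube_singular {i j : ι} (hij : j ≠ i) {R : ℝ} (hR : 0 < R) {s s' : ℝ}
    (hs : -1 < s) (hs0 : s ≤ 0) (hs' : -1 < s') (hs0' : s' ≤ 0) {κ : (ι → ℝ) → ℝ}
    (hκ : Measurable κ) (hκi : ∀ v y, κ (Function.update v i y) = κ v) (b : ℝ) :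
    IntegrableOn (fun v => |v i - κ v| ^ s * |v j - b| ^ s') (cube ι R) := by
  obtain ⟨C, hC, hCb⟩ := exists_lintegral_abs_sub_rpow_le hs hs0 R
  obtain ⟨C', hC', hCb'⟩ := exists_lintegral_abs_sub_rpow_le hs' hs0' R
  have hAm : Measurable fun v : ι → ℝ => ENNReal.ofReal (|v i - κ v| ^ s) := by fun_prop
  have hBm : Measurable fun v : ι → ℝ => ENNReal.ofReal (|v j - b| ^ s') := by fun_prop
  refine ⟨by fun_prop, ?_⟩
  rw [hasFiniteIntegral_iff_ofReal (Filter.Eventually.of_forall fun v => by positivity)]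
  simp only [ENNReal.ofReal_mul (Real.rpow_nonneg (abs_nonneg _) _)]
  have h2R : C / ENNReal.ofReal (2 * R) ≠ ∞ :=
    ENNReal.div_ne_top hC (by simpa using hR)
  have h2R' : C' / ENNReal.ofReal (2 * R) ≠ ∞ :=
    ENNReal.div_ne_top hC' (by simpa using hR)
  have h1 := lintegral_cube_mul_le i hR hAm hBm (fun v y => by simp [Function.update_of_ne hij])
    (fun v => by simpa [hκi] using hCb (κ v))
  have h2 := lintegral_cube_mul_le j hR hBm (measurable_const (a := (1 : ℝ≥0∞)))
    (fun _ _ => rfl) (fun v => by simpa using hCb' b)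
  simp only [mul_one, lintegral_const, Measure.restrict_apply_univ, one_mul] at h2
  refine lt_of_le_of_lt (h1.trans (mul_le_mul_right h2 _)) ?_
  exact ENNReal.mul_lt_top h2R.lt_top (ENNReal.mul_lt_top h2R'.lt_top
    (volume_cube_ne_top R).lt_top)

lemma integrableOn_cube_coord (i : ι) {R : ℝ} (hR : 0 < R) {f : ℝ → ℝ} (hf : Measurable f)
    (h_int : Integrable f) : IntegrableOn (fun v : ι → ℝ => f (v i)) (cube ι R) := by
  refine ⟨(hf.comp (measurable_pi_apply i)).aestronglyMeasurable, ?_⟩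
  rw [hasFiniteIntegral_iff_enorm]
  have hAm : Measurable fun v : ι → ℝ => ‖f (v i)‖ₑ := (hf.comp (measurable_pi_apply i)).enorm
  have h2 := lintegral_cube_mul_le (C := ∫⁻ y, ‖f y‖ₑ) i hR hAm
    (measurable_const (a := (1 : ℝ≥0∞))) (fun _ _ => rfl)
    (fun v => by
      simp only [Function.update_self]
      exact setLIntegral_le_lintegral _ _)
  simp only [mul_one, lintegral_const, Measure.restrict_apply_univ, one_mul] at h2
  refine lt_of_le_of_lt h2 (ENNReal.mul_lt_top (ENNReal.div_ne_top ?_ (by simpa using hR)).lt_top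
    (volume_cube_ne_top R).lt_top)
  exact (hasFiniteIntegral_iff_enorm.1 h_int.2).ne

end Singular

/-! ### The weights on the region -/

section BetaWeight

variable {α : ℝ}

lemma hasDerivAt_beta {a b : ℝ → ℝ} {a' b' y : ℝ} (ha : HasDerivAt a a' y)
    (hb : HasDerivAt b b' y) (ha0 : 0 < a y) (hb0 : 0 < b y) :
    HasDerivAt (fun y => a y ^ α * b y ^ α)
      (a' * α * a y ^ (α - 1) * b y ^ α + a y ^ α * (b' * α * b y ^ (α - 1))) y :=
  (ha.rpow_const (Or.inl ha0.ne')).fun_mul (hb.rpow_const (Or.inl hb0.ne'))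

lemma inv_beta_le {a b : ℝ} (ha : 0 < a) (hb : 0 < b) :
    (a ^ α * b ^ α)⁻¹ ≤ a ^ (-(2 * α)) + b ^ (-(2 * α)) := by
  have e : ∀ {x : ℝ}, 0 < x → x ^ (-(2 * α)) = (x ^ (-α)) ^ 2 := fun {x} hx => by
    rw [← Real.rpow_natCast, ← Real.rpow_mul hx.le]
    congr 1
    push_cast
    ring
  rw [e ha, e hb, mul_inv, ← Real.rpow_neg ha.le, ← Real.rpow_neg hb.le]
  nlinarith [sq_nonneg (a ^ (-α) - b ^ (-α)), sq_nonneg (a ^ (-α)), sq_nonneg (b ^ (-α))]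

lemma abs_deriv_beta_le {a b a' b' Q Sa : ℝ} (hα : α ∈ Ioo (0 : ℝ) (1 / 2)) (ha : 0 < a)
    (hb : 0 < b) (haQ : a ≤ Q) (hbQ : b ≤ Q) (hSa : |a'| * a ^ (α - 1) ≤ Sa)
    (hSb : |b'| * b ^ (α - 1) ≤ Sa) :
    |a' * α * a ^ (α - 1) * b ^ α + a ^ α * (b' * α * b ^ (α - 1))| ≤ 2 * Q ^ α * Sa := by
  have h1 : a ^ α ≤ Q ^ α := Real.rpow_le_rpow ha.le haQ hα.1.le
  have h2 : b ^ α ≤ Q ^ α := Real.rpow_le_rpow hb.le hbQ hα.1.le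
  have hα1 : |α| ≤ 1 := by rw [abs_of_pos hα.1]; linarith [hα.2]
  have hpa : 0 ≤ a ^ (α - 1) := Real.rpow_nonneg ha.le _
  have hpb : 0 ≤ b ^ (α - 1) := Real.rpow_nonneg hb.le _
  have hSa0 : 0 ≤ Sa := le_trans (by positivity) hSa
  have e1 : |α * (a' * a ^ (α - 1)) * b ^ α| ≤ 1 * Sa * Q ^ α := by
    refine abs_mul_le_of_le (abs_mul_le_of_le hα1 ?_) ?_
    · rw [abs_mul, abs_of_nonneg hpa]; exact hSa
    · rwa [abs_of_nonneg (Real.rpow_nonneg hb.le _)]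
  have e2 : |α * (b' * b ^ (α - 1)) * a ^ α| ≤ 1 * Sa * Q ^ α := by
    refine abs_mul_le_of_le (abs_mul_le_of_le hα1 ?_) ?_
    · rw [abs_mul, abs_of_nonneg hpb]; exact hSb
    · rwa [abs_of_nonneg (Real.rpow_nonneg ha.le _)]
  calc |a' * α * a ^ (α - 1) * b ^ α + a ^ α * (b' * α * b ^ (α - 1))|
      = |α * (a' * a ^ (α - 1)) * b ^ α + α * (b' * b ^ (α - 1)) * a ^ α| := by congr 1; ring
    _ ≤ 1 * Sa * Q ^ α + 1 * Sa * Q ^ α := (abs_add_le _ _).trans (add_le_add e1 e2)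
    _ = 2 * Q ^ α * Sa := by ring

lemma max_rpow_eq_zero (hα : 0 < α) {y : ℝ} (hy : y ≤ 0) : max 0 y ^ α = 0 := by
  rw [max_eq_left hy, Real.zero_rpow hα.ne']

lemma indicator_beta_eq (hα : 0 < α) {l r y : ℝ} {s : Set ℝ} (hs : Ioo l r ⊆ s)
    (hs' : s ⊆ Icc l r) :
    s.indicator (fun y => (r - y) ^ α * (y - l) ^ α) y
      = max 0 (r - y) ^ α * max 0 (y - l) ^ α := by
  by_cases hy : y ∈ s
  · have := hs' hy
    rw [indicator_of_mem hy, max_eq_right (by linarith [this.2]), max_eq_right (by linarith [this.1])]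
  · rw [indicator_of_notMem hy]
    have : y ∉ Ioo l r := fun h => hy (hs h)
    rw [mem_Ioo, not_and_or] at this
    rcases this with h | h
    · rw [max_rpow_eq_zero hα (y := y - l) (by linarith), mul_zero]
    · rw [max_rpow_eq_zero hα (y := r - y) (by linarith), zero_mul]

lemma continuous_beta (hα : 0 < α) (l r : ℝ) :
    Continuous fun y : ℝ => max 0 (r - y) ^ α * max 0 (y - l) ^ α := by
  refine Continuous.mul (Continuous.rpow_const (by fun_prop) fun _ => Or.inr hα.le)
    (Continuous.rpow_const (by fun_prop) fun _ => Or.inr hα.le)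

end BetaWeight

section MarkWeight

variable {α : ℝ} {k : ℕ} {q : Fin (k + 2) → ℝ}

lemma isOpen_markSet (q : Fin (k + 2) → ℝ) : IsOpen (markSet q) :=
  isOpen_iUnion fun _ => isOpen_Ioo

lemma exists_markSet_bound (q : Fin (k + 2) → ℝ) : ∃ Q, 0 < Q ∧ ∀ p, |q p| ≤ Q := by
  refine ⟨1 + ∑ p, |q p|, by positivity, fun p => ?_⟩
  have := Finset.single_le_sum (f := fun p => |q p|) (fun _ _ => abs_nonneg _) (Finset.mem_univ p)
  linarith

lemma abs_lt_of_mem_markSet {Q : ℝ} (hQ : ∀ p, |q p| ≤ Q) {y : ℝ} (hy : y ∈ markSet q) :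
    |y| < Q := by
  obtain ⟨p, hp⟩ := mem_iUnion.1 hy
  have h1 := abs_le.1 (hQ p.castSucc)
  have h2 := abs_le.1 (hQ p.succ)
  exact abs_lt.2 ⟨by linarith [hp.1], by linarith [hp.2]⟩

lemma isBounded_markSet (q : Fin (k + 2) → ℝ) : Bornology.IsBounded (markSet q) := by
  obtain ⟨Q, -, hQ⟩ := exists_markSet_bound q
  exact (Metric.isBounded_ball (x := (0 : ℝ)) (r := Q)).subset fun y hy => by
    rw [mem_ball_zero_iff]; exact abs_lt_of_mem_markSet hQ hy

lemma nonempty_markSet (hq : StrictMono q) : (markSet q).Nonempty := by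
  have h : q (0 : Fin (k + 1)).castSucc < q (0 : Fin (k + 1)).succ := hq (by simp)
  obtain ⟨y, hy⟩ := exists_between h
  exact ⟨y, mem_iUnion.2 ⟨0, hy⟩⟩

lemma countable_frontier_markSet (q : Fin (k + 2) → ℝ) : (frontier (markSet q)).Countable := by
  refine (finite_range q).countable.mono fun y hy => ?_
  rw [(isOpen_markSet q).frontier_eq, markSet, closure_iUnion_of_finite] at hy
  obtain ⟨hy1, hy2⟩ := hy
  obtain ⟨p, hp⟩ := mem_iUnion.1 hy1
  have hp' := closure_minimal Ioo_subset_Icc_self isClosed_Icc hp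
  have : y ∉ Ioo (q p.castSucc) (q p.succ) := fun h => hy2 (mem_iUnion.2 ⟨p, h⟩)
  rcases hp'.1.eq_or_lt with h | h
  · exact ⟨_, h⟩
  · rcases hp'.2.eq_or_lt with h' | h'
    · exact ⟨_, h'.symm⟩
    · exact absurd ⟨h, h'⟩ this

lemma markWeight_of_mem (hq : StrictMono q) {y : ℝ} {p : Fin (k + 1)}
    (hy : y ∈ Ioo (q p.castSucc) (q p.succ)) :
    markWeight α q y = (q p.succ - y) ^ α * (y - q p.castSucc) ^ α := by
  rw [markWeight, Finset.sum_eq_single p, indicator_of_mem hy]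
  · intro p' _ hne
    refine indicator_of_notMem (fun h => hne ?_) _
    have h1 := hq.lt_iff_lt.1 (hy.1.trans h.2)
    have h2 := hq.lt_iff_lt.1 (h.1.trans hy.2)
    rw [Fin.castSucc_lt_succ_iff] at h1 h2
    exact le_antisymm h2 h1
  · simp

lemma continuous_markWeight (hα : 0 < α) (q : Fin (k + 2) → ℝ) : Continuous (markWeight α q) := by
  unfold markWeight
  refine continuous_finsetSum _ fun p _ => ?_
  exact (continuous_beta hα _ _).congr fun y =>
    (indicator_beta_eq hα Subset.rfl Ioo_subset_Icc_self).symm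

lemma markWeight_of_notMem {y : ℝ} (hy : y ∉ markSet q) : markWeight α q y = 0 :=
  Finset.sum_eq_zero fun p _ => indicator_of_notMem (fun h => hy (mem_iUnion.2 ⟨p, h⟩)) _

lemma markWeight_pos (hq : StrictMono q) {y : ℝ} (hy : y ∈ markSet q) : 0 < markWeight α q y := by
  obtain ⟨p, hp⟩ := mem_iUnion.1 hy
  rw [markWeight_of_mem hq hp]
  exact mul_pos (Real.rpow_pos_of_pos (sub_pos.2 hp.2) _) (Real.rpow_pos_of_pos (sub_pos.2 hp.1) _)

/-- Sum of the powers of the distances to the end points of the mark intervals. -/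
def markSing (q : Fin (k + 2) → ℝ) (s y : ℝ) : ℝ := ∑ p, |y - q p| ^ s

lemma le_markSing (s y : ℝ) (p : Fin (k + 2)) : |y - q p| ^ s ≤ markSing q s y :=
  Finset.single_le_sum (f := fun p => |y - q p| ^ s)
    (fun _ _ => Real.rpow_nonneg (abs_nonneg _) _) (Finset.mem_univ p)

lemma inv_markWeight_le (hq : StrictMono q) {y : ℝ} (hy : y ∈ markSet q) :
    (markWeight α q y)⁻¹ ≤ 2 * markSing q (-(2 * α)) y := by
  obtain ⟨p, hp⟩ := mem_iUnion.1 hy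
  rw [markWeight_of_mem hq hp]
  refine (inv_beta_le (sub_pos.2 hp.2) (sub_pos.2 hp.1)).trans ?_
  have h1 := le_markSing (q := q) (-(2 * α)) y p.succ
  have h2 := le_markSing (q := q) (-(2 * α)) y p.castSucc
  rw [abs_sub_comm, abs_of_pos (sub_pos.2 hp.2)] at h1
  rw [abs_of_pos (sub_pos.2 hp.1)] at h2
  linarith

lemma exists_hasDerivAt_markWeight (hα : α ∈ Ioo (0 : ℝ) (1 / 2)) (hq : StrictMono q) {Q : ℝ}
    (hQ : ∀ p, |q p| ≤ Q) {y : ℝ} (hy : y ∈ markSet q) :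
    ∃ d, HasDerivAt (markWeight α q) d y ∧ |d| ≤ 2 * (2 * Q) ^ α * markSing q (α - 1) y := by
  obtain ⟨p, hp⟩ := mem_iUnion.1 hy
  have ha : HasDerivAt (fun y => q p.succ - y) (-1) y := (hasDerivAt_id y).const_sub _
  have hb : HasDerivAt (fun y => y - q p.castSucc) 1 y := (hasDerivAt_id y).sub_const _
  have h1 := hasDerivAt_beta (α := α) ha hb (sub_pos.2 hp.2) (sub_pos.2 hp.1)
  have e1 := abs_le.1 (hQ p.castSucc)
  have e2 := abs_le.1 (hQ p.succ)
  refine ⟨_, h1.congr_of_eventuallyEq ?_, abs_deriv_beta_le hα (sub_pos.2 hp.2) (sub_pos.2 hp.1)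
    ?_ ?_ ?_ ?_⟩
  · filter_upwards [isOpen_Ioo.mem_nhds hp] with z hz
    exact markWeight_of_mem hq hz
  · linarith [hp.1]
  · linarith [hp.2]
  · have h1 := le_markSing (q := q) (α - 1) y p.succ
    rw [abs_sub_comm, abs_of_pos (sub_pos.2 hp.2)] at h1
    simpa using h1
  · have h2 := le_markSing (q := q) (α - 1) y p.castSucc
    rw [abs_of_pos (sub_pos.2 hp.1)] at h2
    simpa using h2

end MarkWeight

section TimeWeight

variable {α t : ℝ} {k n : ℕ} {q : Fin (k + 2) → ℝ} {I : Set ℝ}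

/-- The knots as functions of all coordinates. -/
def knotOf (t : ℝ) {n : ℕ} (v : Fin n ⊕ Fin n → ℝ) (m : ℕ) : ℝ := knot t (fun i => v (Sum.inl i)) m

lemma knotOf_succ (v : Fin n ⊕ Fin n → ℝ) (i : Fin n) : knotOf t v (i + 1) = v (Sum.inl i) :=
  knot_succ_of_lt t _ i.2

lemma knotOf_update_inl (v : Fin n ⊕ Fin n → ℝ) (i : Fin n) (y : ℝ) (m : ℕ) :
    knotOf t (Function.update v (Sum.inl i) y) m = if m = i + 1 then y else knotOf t v m := by
  rcases m with - | m
  · simp [knotOf, knot]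
  · by_cases hm : m < n
    · simp only [knotOf, knot_succ_of_lt t _ hm]
      by_cases h : m = i
      · subst h; simp
      · rw [if_neg (by omega), Function.update_of_ne]
        intro h'
        exact h (by simpa [Fin.ext_iff] using h')
    · have : m ≠ i := by have := i.2; omega
      simp [knotOf, knot, hm, this]

lemma knotOf_update_inr (v : Fin n ⊕ Fin n → ℝ) (i : Fin n) (y : ℝ) (m : ℕ) :
    knotOf t (Function.update v (Sum.inr i) y) m = knotOf t v m := by
  simp [knotOf]

lemma differentiable_knotOf (t : ℝ) (m : ℕ) :
    Differentiable ℝ fun v : Fin n ⊕ Fin n → ℝ => knotOf t v m := by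
  rcases m with - | m
  · simp [knotOf, knot]
  · by_cases hm : m < n
    · simp only [knotOf, knot_succ_of_lt t _ hm]; fun_prop
    · simp [knotOf, knot, hm]

lemma knotOf_mem_Icc {v : Fin n ⊕ Fin n → ℝ} (hv : v ∈ mixedRegion t I n) {m : ℕ}
    (hm : m ≤ n + 1) : knotOf t v m ∈ Icc 0 t := by
  constructor
  · rcases m.eq_zero_or_pos with rfl | h
    · simp [knotOf, knot]
    · exact (knot_lt_knot hv.1 h hm).le
  · rcases hm.eq_or_lt with rfl | h
    · simp [knotOf, knot]
    · have := (knot_lt_knot hv.1 h le_rfl).le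
      rwa [knot_last] at this

lemma timeWeight_of_mem {v : Fin n ⊕ Fin n → ℝ} (hv : v ∈ mixedRegion t I n) (i : Fin n) :
    mixedWeight α t q (Sum.inl i) v
      = (knotOf t v (i + 2) - knotOf t v (i + 1)) ^ α * (knotOf t v (i + 1) - knotOf t v i) ^ α := by
  have h1 : knotOf t v i < knotOf t v (i + 1) := hv.1 i i.2.le
  have h2 : knotOf t v (i + 1) < knotOf t v (i + 2) := hv.1 (i + 1) i.2
  have hmem : v (Sum.inl i) ∈ Icc (knotOf t v i) (knotOf t v (i + 2)) := by
    rw [← knotOf_succ (t := t) v i]; exact ⟨h1.le, h2.le⟩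
  rw [knotOf_succ v i]
  exact indicator_of_mem hmem (fun y => (knotOf t v (i + 2) - y) ^ α * (y - knotOf t v i) ^ α)

lemma timeWeight_update {v : Fin n ⊕ Fin n → ℝ} (hα : 0 < α) (i : Fin n)
    (y : ℝ) : mixedWeight α t q (Sum.inl i) (Function.update v (Sum.inl i) y)
      = max 0 (knotOf t v (i + 2) - y) ^ α * max 0 (y - knotOf t v i) ^ α := by
  have h1 : knotOf t (Function.update v (Sum.inl i) y) i = knotOf t v i := by
    rw [knotOf_update_inl, if_neg (by omega)]
  have h2 : knotOf t (Function.update v (Sum.inl i) y) (i + 2) = knotOf t v (i + 2) := by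
    rw [knotOf_update_inl, if_neg (by omega)]
  have h3 := indicator_beta_eq hα (l := knotOf t v i) (r := knotOf t v (i + 2)) (y := y)
    Ioo_subset_Icc_self Subset.rfl
  refine Eq.trans ?_ h3
  unfold knotOf at h1 h2 ⊢
  simp only [mixedWeight, h1, h2, Function.update_self]

lemma update_inl_mem_iff {v : Fin n ⊕ Fin n → ℝ} (hv : v ∈ mixedRegion t I n) (i : Fin n) (y : ℝ) :
    Function.update v (Sum.inl i) y ∈ mixedRegion t I n
      ↔ y ∈ Ioo (knotOf t v i) (knotOf t v (i + 2)) := by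
  have hk := knotOf_update_inl (t := t) v i y
  constructor
  · intro h
    have h1 : knotOf t _ (i : ℕ) < knotOf t _ (i + 1) := h.1 i i.2.le
    have h2 : knotOf t _ ((i : ℕ) + 1) < knotOf t _ (i + 2) := h.1 (i + 1) i.2
    rw [hk, hk, if_neg (by omega), if_pos rfl] at h1
    rw [hk, hk, if_pos rfl, if_neg (by omega)] at h2
    exact ⟨h1, h2⟩
  · intro hy
    refine ⟨fun j hj => ?_, fun j => by simpa using hv.2 j⟩
    change knotOf t _ j < knotOf t _ (j + 1)
    rw [hk, hk]
    have hvj : knotOf t v j < knotOf t v (j + 1) := hv.1 j hj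
    split_ifs with h1 h2 h2
    · omega
    · subst h1; exact hy.2
    · have : j = i := by omega
      subst this; exact hy.1
    · exact hvj

lemma update_inr_mem_iff {v : Fin n ⊕ Fin n → ℝ} (hv : v ∈ mixedRegion t I n) (i : Fin n) (y : ℝ) :
    Function.update v (Sum.inr i) y ∈ mixedRegion t I n ↔ y ∈ I := by
  constructor
  · intro h; simpa using h.2 i
  · intro hy
    refine ⟨fun j hj => ?_, fun j => ?_⟩
    · have hvj : knotOf t v j < knotOf t v (j + 1) := hv.1 j hj
      rw [← knotOf_update_inr v i y, ← knotOf_update_inr v i y] at hvj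
      exact hvj
    · by_cases h : j = i
      · subst h; simpa using hy
      · rw [Function.update_of_ne (by simpa using h)]; exact hv.2 j

/-- Sum of the powers of the distances of a jump time to the other knots. -/
def timeSing (t s : ℝ) {n : ℕ} (i : Fin n) (v : Fin n ⊕ Fin n → ℝ) : ℝ :=
  ∑ m ∈ (Finset.range (n + 2)).erase (i + 1), |v (Sum.inl i) - knotOf t v m| ^ s

lemma le_timeSing (s : ℝ) (i : Fin n) (v : Fin n ⊕ Fin n → ℝ) {m : ℕ} (hm : m ≤ n + 1)
    (hmi : m ≠ i + 1) : |v (Sum.inl i) - knotOf t v m| ^ s ≤ timeSing t s i v :=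
  Finset.single_le_sum (f := fun m => |v (Sum.inl i) - knotOf t v m| ^ s)
    (fun _ _ => Real.rpow_nonneg (abs_nonneg _) _)
    (Finset.mem_erase.2 ⟨hmi, Finset.mem_range.2 (by omega)⟩)

lemma timeSing_nonneg (t s : ℝ) (i : Fin n) (v : Fin n ⊕ Fin n → ℝ) : 0 ≤ timeSing t s i v :=
  Finset.sum_nonneg fun _ _ => Real.rpow_nonneg (abs_nonneg _) _

/-- A gap that depends on the `i`-th jump time is a distance of that time to another knot. -/
lemma gap_rpow_le_timeSing (s : ℝ) (i : Fin n) {v : Fin n ⊕ Fin n → ℝ}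
    (hv : v ∈ mixedRegion t I n) {m : ℕ} (hm : m ≤ n) :
    |((if m + 1 = i + 1 then 1 else 0) - (if m = i + 1 then 1 else 0) : ℝ)|
      * (knotOf t v (m + 1) - knotOf t v m) ^ s ≤ timeSing t s i v := by
  have hpos : 0 < knotOf t v (m + 1) - knotOf t v m := sub_pos.2 (hv.1 m hm)
  by_cases h1 : m = i
  · rw [if_pos (by omega), if_neg (by omega), sub_zero, abs_one, one_mul]
    have h2 := le_timeSing (t := t) s i v (m := m) (by omega) (by omega)
    rw [← knotOf_succ (t := t) v i] at h2
    rw [← h1, abs_of_pos hpos] at h2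
    exact h2
  · by_cases h2 : m = i + 1
    · rw [if_neg (by omega), if_pos h2, zero_sub, abs_neg, abs_one, one_mul]
      have h3 := le_timeSing (t := t) s i v (m := m + 1) (by omega) (by omega)
      rw [← knotOf_succ (t := t) v i, ← h2, abs_sub_comm, abs_of_pos hpos] at h3
      exact h3
    · rw [if_neg (by omega), if_neg h2, sub_zero, abs_zero, zero_mul]
      exact timeSing_nonneg _ _ _ _

lemma inv_timeWeight_le (i : Fin n) {v : Fin n ⊕ Fin n → ℝ} (hv : v ∈ mixedRegion t I n) :
    (mixedWeight α t q (Sum.inl i) v)⁻¹ ≤ 2 * timeSing t (-(2 * α)) i v := by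
  have h1 : knotOf t v i < knotOf t v (i + 1) := hv.1 i i.2.le
  have h2 : knotOf t v (i + 1) < knotOf t v (i + 2) := hv.1 (i + 1) i.2
  rw [timeWeight_of_mem hv]
  refine (inv_beta_le (sub_pos.2 h2) (sub_pos.2 h1)).trans ?_
  have h3 := gap_rpow_le_timeSing (-(2 * α)) i hv (m := i) i.2.le
  have h4 := gap_rpow_le_timeSing (-(2 * α)) i hv (m := i + 1) i.2
  rw [if_pos rfl, if_neg (by omega), sub_zero, abs_one, one_mul] at h3
  rw [if_neg (by omega), if_pos rfl, zero_sub, abs_neg, abs_one, one_mul] at h4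
  change (knotOf t v (i + 2) - knotOf t v (i + 1)) ^ (-(2 * α)) ≤ _ at h4
  linarith

lemma timeWeight_pos (i : Fin n) {v : Fin n ⊕ Fin n → ℝ} (hv : v ∈ mixedRegion t I n) :
    0 < mixedWeight α t q (Sum.inl i) v := by
  have h1 : knotOf t v i < knotOf t v (i + 1) := hv.1 i i.2.le
  have h2 : knotOf t v (i + 1) < knotOf t v (i + 2) := hv.1 (i + 1) i.2
  rw [timeWeight_of_mem hv]
  exact mul_pos (Real.rpow_pos_of_pos (sub_pos.2 h2) _) (Real.rpow_pos_of_pos (sub_pos.2 h1) _)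

lemma timeWeight_differentiableAt (hI : IsOpen I) (i : Fin n) {v : Fin n ⊕ Fin n → ℝ}
    (hv : v ∈ mixedRegion t I n) : DifferentiableAt ℝ (mixedWeight α t q (Sum.inl i)) v := by
  have h1 : knotOf t v i < knotOf t v (i + 1) := hv.1 i i.2.le
  have h2 : knotOf t v (i + 1) < knotOf t v (i + 2) := hv.1 (i + 1) i.2
  have hd := differentiable_knotOf (n := n) t
  have h3 : DifferentiableAt ℝ (fun v : Fin n ⊕ Fin n → ℝ =>
      (knotOf t v (i + 2) - knotOf t v (i + 1)) ^ α
        * (knotOf t v (i + 1) - knotOf t v i) ^ α) v :=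
    (((hd _ v).sub (hd _ v)).rpow_const (Or.inl (sub_pos.2 h2).ne')).mul
      (((hd _ v).sub (hd _ v)).rpow_const (Or.inl (sub_pos.2 h1).ne'))
  refine h3.congr_of_eventuallyEq ?_
  filter_upwards [(isOpen_mixedRegion t hI n).mem_nhds hv] with z hz
  exact timeWeight_of_mem hz i

lemma abs_pderiv_timeWeight_le (hα : α ∈ Ioo (0 : ℝ) (1 / 2)) (hI : IsOpen I) (i j : Fin n)
    {v : Fin n ⊕ Fin n → ℝ} (hv : v ∈ mixedRegion t I n) :
    |pderiv (mixedWeight α t q (Sum.inl j)) (Sum.inl i) v|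
      ≤ 2 * t ^ α * timeSing t (α - 1) i v := by
  have h1 : knotOf t v j < knotOf t v (j + 1) := hv.1 j j.2.le
  have h2 : knotOf t v (j + 1) < knotOf t v (j + 2) := hv.1 (j + 1) j.2
  have hk : ∀ m, HasDerivAt (fun y => knotOf t (Function.update v (Sum.inl i) y) m)
      (if m = i + 1 then 1 else 0) (v (Sum.inl i)) := by
    intro m
    simp only [knotOf_update_inl]
    split_ifs
    · exact hasDerivAt_id _
    · exact hasDerivAt_const _ _
  have hd : pderiv (mixedWeight α t q (Sum.inl j)) (Sum.inl i) v
      = pderiv (fun v => (knotOf t v (j + 2) - knotOf t v (j + 1)) ^ α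
        * (knotOf t v (j + 1) - knotOf t v j) ^ α) (Sum.inl i) v := by
    refine pderiv_congr ?_ _
    filter_upwards [(isOpen_mixedRegion t hI n).mem_nhds hv] with z hz
    exact timeWeight_of_mem hz j
  have hupd : Function.update v (Sum.inl i) (v (Sum.inl i)) = v := Function.update_eq_self _ _
  have h3 := hasDerivAt_beta (α := α) ((hk (j + 2)).fun_sub (hk (j + 1)))
    ((hk (j + 1)).fun_sub (hk j)) (by rw [hupd]; exact sub_pos.2 h2)
    (by rw [hupd]; exact sub_pos.2 h1)
  rw [hd, pderiv, h3.deriv, hupd]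
  have e0 := knotOf_mem_Icc hv (m := j) (by omega)
  have e1 := knotOf_mem_Icc hv (m := j + 1) (by omega)
  have e2 := knotOf_mem_Icc hv (m := j + 2) (by omega)
  exact abs_deriv_beta_le hα (sub_pos.2 h2) (sub_pos.2 h1) (by linarith [e2.2, e1.1])
    (by linarith [e1.2, e0.1]) (gap_rpow_le_timeSing (α - 1) i hv (m := j + 1) j.2)
    (gap_rpow_le_timeSing (α - 1) i hv (m := j) j.2.le)

end TimeWeight

/-! ### The region of jump times and amplitudes as a weighted region -/

section Region

variable {α t : ℝ} {k n : ℕ} {q : Fin (k + 2) → ℝ} {ρ : ℝ → ℝ} {ν : Measure ℝ}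

/-- The density of the amplitudes, as a function of all coordinates. -/
def mixedDens (ρ : ℝ → ℝ) {n : ℕ} (v : Fin n ⊕ Fin n → ℝ) : ℝ :=
  Real.exp (∑ i : Fin n, ρ (v (Sum.inr i)))

lemma exists_mixedRegion_subset_cube (t : ℝ) (q : Fin (k + 2) → ℝ) (n : ℕ) :
    ∃ R, 0 < R ∧ mixedRegion t (markSet q) n ⊆ cube (Fin n ⊕ Fin n) R := by
  obtain ⟨Q, hQ0, hQ⟩ := exists_markSet_bound q
  refine ⟨|t| + Q, by positivity, fun v hv => mem_univ_pi.2 ?_⟩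
  rintro (i | i)
  · have h := knotOf_mem_Icc hv (m := i + 1) (by omega)
    rw [knotOf_succ] at h
    have := le_abs_self t
    exact ⟨by linarith [h.1, abs_nonneg t], by linarith [h.2]⟩
  · have h := abs_lt.1 (abs_lt_of_mem_markSet hQ (hv.2 i))
    have := abs_nonneg t
    exact ⟨by linarith [h.1], by linarith [h.2]⟩

lemma isBounded_mixedRegion (t : ℝ) (q : Fin (k + 2) → ℝ) (n : ℕ) :
    Bornology.IsBounded (mixedRegion t (markSet q) n) := by
  obtain ⟨R, -, hR⟩ := exists_mixedRegion_subset_cube t q n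
  exact (Bornology.IsBounded.pi fun _ => Metric.isBounded_Ioo _ _).subset hR

lemma integrableOn_timeSing_mul_markSing {s s' : ℝ} (hs : -1 < s) (hs0 : s ≤ 0) (hs' : -1 < s')
    (hs0' : s' ≤ 0) (i : Fin n) :
    IntegrableOn (fun v => timeSing t s i v * markSing q s' (v (Sum.inr i)))
      (mixedRegion t (markSet q) n) := by
  obtain ⟨R, hR0, hR⟩ := exists_mixedRegion_subset_cube t q n
  refine IntegrableOn.mono_set ?_ hR
  simp only [timeSing, markSing, Finset.sum_mul_sum]
  refine integrable_finsetSum _ fun m hm => integrable_finsetSum _ fun p _ => ?_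
  refine integrableOn_cube_singular (κ := fun v => knotOf t v m) (by simp) hR0 hs hs0 hs' hs0'
    (differentiable_knotOf t m).continuous.measurable (fun v y => ?_) (q p)
  rw [knotOf_update_inl, if_neg (Finset.mem_erase.1 hm).1]

lemma MarkLawHyp.integrable_score {I : Set ℝ} (hI : IsOpen I) (hlaw : MarkLawHyp ν I ρ) :
    Integrable (I.indicator (deriv ρ)) := by
  obtain ⟨M, hM⟩ := hlaw.bdd
  have hm := (measurable_deriv ρ)
  refine ⟨(hm.indicator hI.measurableSet).aestronglyMeasurable, ?_⟩
  have h1 := (hasFiniteIntegral_iff_enorm.1 (hlaw.score_moments 1).2)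
  rw [hlaw.density, lintegral_withDensity_eq_lintegral_mul _ (hlaw.measurable_density hI)
    (by fun_prop)] at h1
  rw [hasFiniteIntegral_iff_enorm]
  have h2 : ∀ y, ‖I.indicator (deriv ρ) y‖ₑ ≤ ENNReal.ofReal (Real.exp M) *
      ((I.indicator fun y => ENNReal.ofReal (Real.exp (ρ y))) * fun y => ‖|deriv ρ y| ^ 1‖ₑ) y := by
    intro y
    by_cases hy : y ∈ I
    · rw [Pi.mul_apply, indicator_of_mem hy, indicator_of_mem hy, ← mul_assoc,
        ← ENNReal.ofReal_mul (Real.exp_pos _).le, ← Real.exp_add]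
      have h3 : (1 : ENNReal) ≤ ENNReal.ofReal (Real.exp (M + ρ y)) := by
        rw [ENNReal.one_le_ofReal, Real.one_le_exp_iff]
        linarith [(abs_le.1 (hM y hy)).1]
      have h4 : ‖|deriv ρ y| ^ 1‖ₑ = ‖deriv ρ y‖ₑ := by
        rw [pow_one, ← Real.norm_eq_abs, enorm_norm]
      rw [h4]
      exact le_mul_of_one_le_left zero_le h3
    · simp [indicator_of_notMem hy]
  refine lt_of_le_of_lt (lintegral_mono h2) ?_
  rw [lintegral_const_mul' _ _ ENNReal.ofReal_ne_top]
  exact ENNReal.mul_lt_top ENNReal.ofReal_lt_top h1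

lemma markWeight_differentiableAt (hα : α ∈ Ioo (0 : ℝ) (1 / 2)) (hq : StrictMono q) (i : Fin n)
    {v : Fin n ⊕ Fin n → ℝ} (hv : v (Sum.inr i) ∈ markSet q) :
    DifferentiableAt ℝ (mixedWeight α t q (Sum.inr i)) v := by
  obtain ⟨Q, -, hQ⟩ := exists_markSet_bound q
  obtain ⟨d, hd, -⟩ := exists_hasDerivAt_markWeight hα hq hQ hv
  exact hd.differentiableAt.comp v (f := fun v : Fin n ⊕ Fin n → ℝ => v (Sum.inr i))
    (differentiableAt_apply _ _)

lemma pderiv_eq_zero_of_update {ι : Type*} [DecidableEq ι] {f : (ι → ℝ) → ℝ} {i : ι} {v : ι → ℝ}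
    (h : ∀ y, f (Function.update v i y) = f v) : pderiv f i v = 0 := by
  simp [pderiv, h]

lemma mixedWeight_inr_update (i j : Fin n) (v : Fin n ⊕ Fin n → ℝ) (y : ℝ) :
    mixedWeight α t q (Sum.inr j) (Function.update v (Sum.inl i) y)
      = mixedWeight α t q (Sum.inr j) v := by
  simp [mixedWeight]

lemma mixedWeight_inl_update (i j : Fin n) (v : Fin n ⊕ Fin n → ℝ) (y : ℝ) :
    mixedWeight α t q (Sum.inl j) (Function.update v (Sum.inr i) y)
      = mixedWeight α t q (Sum.inl j) v := by
  simp [mixedWeight]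

lemma markSing_nonneg (s y : ℝ) : 0 ≤ markSing q s y :=
  Finset.sum_nonneg fun _ _ => Real.rpow_nonneg (abs_nonneg _) _

lemma exists_abs_pderiv_markWeight_le (hα : α ∈ Ioo (0 : ℝ) (1 / 2)) (hq : StrictMono q) :
    ∃ C, 0 ≤ C ∧ ∀ (i j : Fin n) (v : Fin n ⊕ Fin n → ℝ), v (Sum.inr i) ∈ markSet q →
      |pderiv (mixedWeight α t q (Sum.inr j)) (Sum.inr i) v|
        ≤ C * markSing q (α - 1) (v (Sum.inr i)) := by
  obtain ⟨Q, hQ0, hQ⟩ := exists_markSet_bound q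
  have hC : 0 ≤ 2 * (2 * Q) ^ α := by positivity
  refine ⟨2 * (2 * Q) ^ α, hC, fun i j v hv => ?_⟩
  by_cases hij : j = i
  · subst hij
    obtain ⟨d, hd, hdb⟩ := exists_hasDerivAt_markWeight hα hq hQ hv
    have : pderiv (mixedWeight α t q (Sum.inr j)) (Sum.inr j) v = d := by
      simp only [pderiv, mixedWeight, Function.update_self]
      exact hd.deriv
    rwa [this]
  · rw [pderiv_eq_zero_of_update, abs_zero]
    · exact mul_nonneg hC (markSing_nonneg _ _)
    · intro y
      simp only [mixedWeight]
      rw [Function.update_of_ne (by simpa using hij)]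

lemma hasDerivAt_mixedDens_exponent (hρ : ∀ y ∈ markSet q, DifferentiableAt ℝ ρ y) (i : Fin n)
    {v : Fin n ⊕ Fin n → ℝ} (hv : v ∈ mixedRegion t (markSet q) n) :
    HasDerivAt (fun y => ∑ j : Fin n, ρ (Function.update v (Sum.inr i) y (Sum.inr j)))
      (deriv ρ (v (Sum.inr i))) (v (Sum.inr i)) := by
  have h1 : ∀ j ∈ (Finset.univ : Finset (Fin n)), HasDerivAt
      (fun y => ρ (Function.update v (Sum.inr i) y (Sum.inr j)))
      (if j = i then deriv ρ (v (Sum.inr i)) else 0) (v (Sum.inr i)) := by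
    intro j _
    by_cases hij : j = i
    · subst hij
      simp only [Function.update_self, if_true]
      exact (hρ _ (hv.2 j)).hasDerivAt
    · rw [if_neg hij]
      have : (Sum.inr j : Fin n ⊕ Fin n) ≠ Sum.inr i := by simpa using hij
      simp only [Function.update_of_ne this]
      exact hasDerivAt_const _ _
  exact (HasDerivAt.fun_sum h1).congr_deriv (by simp)

theorem weightedRegion_mixedRegion (hα : α ∈ Ioo (0 : ℝ) (1 / 2)) (hq : StrictMono q)
    (hlaw : MarkLawHyp ν (markSet q) ρ) (t : ℝ) (n : ℕ) :
    WeightedRegion (mixedRegion t (markSet q) n) (mixedWeight α t q) (mixedScore ρ)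
      (mixedDens ρ) := by
  have hI := isOpen_markSet q
  have hU := isOpen_mixedRegion t hI n
  have hρ : ∀ y ∈ markSet q, DifferentiableAt ℝ ρ y := fun y hy =>
    (hlaw.contDiff.differentiableOn one_ne_zero).differentiableAt (hI.mem_nhds hy)
  have hwd : ∀ i, ∀ v ∈ mixedRegion t (markSet q) n,
      DifferentiableAt ℝ (mixedWeight α t q i) v := by
    rintro (i | i) v hv
    · exact timeWeight_differentiableAt hI i hv
    · exact markWeight_differentiableAt hα hq i (hv.2 i)
  have hwpos : ∀ i, ∀ v ∈ mixedRegion t (markSet q) n, 0 < mixedWeight α t q i v := by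
    rintro (i | i) v hv
    · exact timeWeight_pos i hv
    · exact markWeight_pos hq (hv.2 i)
  have hdm : ∀ i j : Fin n ⊕ Fin n, ∀ d, AEStronglyMeasurable
      (fun v => (mixedWeight α t q d v)⁻¹ * |pderiv (mixedWeight α t q j) i v|)
      (volume.restrict (mixedRegion t (markSet q) n)) := fun i j d =>
    ((aestronglyMeasurable_of_differentiableAt hU (hwd d)).aemeasurable.inv.mul
      (aestronglyMeasurable_pderiv hU (hwd j) i).aemeasurable.abs).aestronglyMeasurable
  have hα1 : -1 < α - 1 := by linarith [hα.1]
  have hα2 : α - 1 ≤ 0 := by linarith [hα.2]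
  have hα3 : -1 < -(2 * α) := by linarith [hα.2]
  have hα4 : -(2 * α) ≤ 0 := by linarith [hα.1]
  refine ⟨hU, isBounded_mixedRegion t q n, hwd, hwpos, ?_, ?_, ?_, ?_, ?_, ?_, ?_, ?_⟩
  · rintro (i | i) v hv
    · simp only [timeWeight_update hα.1]
      exact continuous_beta hα.1 _ _
    · simp only [mixedWeight, Function.update_self]
      exact continuous_markWeight hα.1 q
  · rintro (i | i) v hv y hy
    · rw [update_inl_mem_iff hv, mem_Ioo, not_and_or] at hy
      rw [timeWeight_update hα.1]
      rcases hy with h | h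
      · rw [max_rpow_eq_zero hα.1 (y := y - knotOf t v i) (by linarith), mul_zero]
      · rw [max_rpow_eq_zero hα.1 (y := knotOf t v (i + 2) - y) (by linarith), zero_mul]
    · rw [update_inr_mem_iff hv] at hy
      simp only [mixedWeight, Function.update_self]
      exact markWeight_of_notMem hy
  · rintro (i | i) v hv
    · simp only [update_inl_mem_iff hv]
      refine ((countable_singleton (knotOf t v (i + 2))).insert (knotOf t v i)).mono fun y hy => ?_
      have hlt : knotOf t v i < knotOf t v (i + 2) :=
        knot_lt_knot hv.1 (by omega) (by have := i.2; omega)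
      rw [← frontier_Ioo hlt]
      exact hy
    · simp only [update_inr_mem_iff hv]
      exact countable_frontier_markSet q
  · intro v hv
    refine DifferentiableAt.exp (DifferentiableAt.fun_sum fun i _ => ?_)
    exact (hρ _ (hv.2 i)).comp v (f := fun v : Fin n ⊕ Fin n → ℝ => v (Sum.inr i))
      (differentiableAt_apply _ _)
  · obtain ⟨M, hM⟩ := hlaw.bdd
    refine ⟨Real.exp (∑ _i : Fin n, M), fun v hv => ?_⟩
    rw [mixedDens, Real.abs_exp, Real.exp_le_exp]
    exact Finset.sum_le_sum fun i _ => (abs_le.1 (hM _ (hv.2 i))).2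
  · rintro (i | i) v hv
    · rw [pderiv_eq_zero_of_update fun y => by simp [mixedDens]]
      simp [mixedScore]
    · have h1 := (hasDerivAt_mixedDens_exponent hρ i hv).exp
      refine h1.deriv.trans ?_
      simp only [Function.update_eq_self]
      rfl
  · rintro (i | i)
    · exact (integrableOn_zero : IntegrableOn (fun _ : Fin n ⊕ Fin n → ℝ => (0 : ℝ)) _ volume)
    · obtain ⟨R, hR0, hR⟩ := exists_mixedRegion_subset_cube t q n
      have h1 := (integrableOn_cube_coord (ι := Fin n ⊕ Fin n) (Sum.inr i) hR0
        ((measurable_deriv ρ).indicator hI.measurableSet) (hlaw.integrable_score hI)).mono_set hR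
      refine h1.congr_fun (fun v hv => ?_) hU.measurableSet
      exact indicator_of_mem (hv.2 i) _
  · rintro (i | i)
    · refine ⟨Sum.inr i, fun v _ y => mixedWeight_inr_update i i v y, ?_⟩
      rintro (j | j)
      · refine ((integrableOn_timeSing_mul_markSing (t := t) (q := q) hα1 hα2 hα3 hα4 i).const_mul
          (2 * (2 * t ^ α))).mono' (hdm _ _ _) ?_
        filter_upwards [ae_restrict_mem hU.measurableSet] with v hv
        refine (abs_mul_le_of_le (abs_of_pos (inv_pos.2 (hwpos _ v hv))).le (abs_abs _).le).trans ?_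
        refine (mul_le_mul (inv_markWeight_le hq (hv.2 i)) (abs_pderiv_timeWeight_le hα hI i j hv)
          (abs_nonneg _) (mul_nonneg two_pos.le (markSing_nonneg _ _))).trans (le_of_eq ?_)
        ring
      · simp only [pderiv_eq_zero_of_update fun y => mixedWeight_inr_update i j _ y, abs_zero,
          mul_zero]
        exact integrableOn_zero
    · refine ⟨Sum.inl i, fun v _ y => mixedWeight_inl_update i i v y, ?_⟩
      rintro (j | j)
      · simp only [pderiv_eq_zero_of_update fun y => mixedWeight_inl_update i j _ y, abs_zero,
          mul_zero]
        exact integrableOn_zero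
      · obtain ⟨C, hC0, hC⟩ := exists_abs_pderiv_markWeight_le (n := n) (t := t) hα hq
        refine ((integrableOn_timeSing_mul_markSing (t := t) (q := q) hα3 hα4 hα1 hα2 i).const_mul
          (2 * C)).mono' (hdm _ _ _) ?_
        filter_upwards [ae_restrict_mem hU.measurableSet] with v hv
        refine (abs_mul_le_of_le (abs_of_pos (inv_pos.2 (hwpos _ v hv))).le (abs_abs _).le).trans ?_
        refine (mul_le_mul (inv_timeWeight_le i hv) (hC i j v (hv.2 i))
          (abs_nonneg _) (mul_nonneg two_pos.le (timeSing_nonneg _ _ _ _))).trans (le_of_eq ?_)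
        ring

end Region

/-! ### The solution as a nondegenerate functional -/

section Pair

variable {c : ℝ → ℝ → ℝ → ℝ} {g : ℝ → ℝ → ℝ} {h K ε t : ℝ} {I : Set ℝ} {n : ℕ}

lemma hasFDerivAt_section {f : ℝ × (Fin n ⊕ Fin n → ℝ) → ℝ} {x : ℝ} {v : Fin n ⊕ Fin n → ℝ}
    (hf : DifferentiableAt ℝ f (x, v)) :
    HasFDerivAt (fun v => f (x, v))
      ((fderiv ℝ f (x, v)).comp (ContinuousLinearMap.inr ℝ ℝ (Fin n ⊕ Fin n → ℝ))) v :=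
  hf.hasFDerivAt.comp v (hasFDerivAt_prodMk_right x v)

lemma pderiv_section {f : ℝ × (Fin n ⊕ Fin n → ℝ) → ℝ} {x : ℝ} {v : Fin n ⊕ Fin n → ℝ}
    (hf : DifferentiableAt ℝ f (x, v)) (i : Fin n ⊕ Fin n) :
    pderiv (fun v => f (x, v)) i v = fderiv ℝ f (x, v) (coordDir i) := by
  rw [pderiv_eq_fderiv (hasFDerivAt_section hf).differentiableAt, (hasFDerivAt_section hf).fderiv]
  rfl

lemma norm_coordDir_le (i : Fin n ⊕ Fin n) : ‖coordDir i‖ ≤ 1 := by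
  rw [coordDir, Prod.norm_def, norm_zero]
  refine max_le zero_le_one ((pi_norm_le_iff_of_nonneg zero_le_one).2 fun j => ?_)
  by_cases hj : j = i
  · subst hj; simp
  · simp [hj]

theorem nondegPair_detSol (hJ : JumpHyp c g h K ε I) (x : ℝ) (ht : 0 < t) (hth : t ≤ h) (n : ℕ) :
    NondegPair (mixedRegion t I n) (detSol c g h t x) (detSolX c g h t x) := by
  obtain ⟨hΨ, κ, hκ, hκb⟩ := paramSol_regular hJ x ht hth n
  set Ψ : ℝ × (Fin n ⊕ Fin n → ℝ) → ℝ := paramSol c g h t with hΨdef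
  have hU := isOpen_mixedRegion t hJ.isOpen n
  have hD : ∀ v ∈ mixedRegion t I n, (x, v) ∈ paramDomain t x I n := fun v hv =>
    ⟨⟨by simp, by simp⟩, hv⟩
  have hdet : ∀ y, ∀ v ∈ mixedRegion t I n, detSol c g h t y v = Ψ (y, v) := fun y v hv =>
    detSol_eq_paramSol hJ.drift_hyp c ht hth y hv
  have hF : ∀ v ∈ mixedRegion t I n, detSol c g h t x =ᶠ[𝓝 v] fun v => Ψ (x, v) := fun v hv =>
    Filter.eventuallyEq_of_mem (hU.mem_nhds hv) (hdet x)
  have hpF : ∀ i, ∀ v ∈ mixedRegion t I n,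
      pderiv (detSol c g h t x) i v = fderiv ℝ Ψ (x, v) (coordDir i) := fun i v hv => by
    rw [pderiv_congr (hF v hv), pderiv_section (hΨ.1.differentiableAt (hD v hv))]
  have hpF' : ∀ i, ∀ v ∈ mixedRegion t I n,
      pderiv (detSol c g h t x) i =ᶠ[𝓝 v] fun v => fderiv ℝ Ψ (x, v) (coordDir i) := fun i v hv =>
    Filter.eventuallyEq_of_mem (hU.mem_nhds hv) (hpF i)
  have hG : ∀ v ∈ mixedRegion t I n, detSolX c g h t x v = fderiv ℝ Ψ (x, v) (1, 0) := by
    intro v hv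
    have h1 : (fun y => detSol c g h t y v) = fun y => Ψ (y, v) := funext fun y => hdet y v hv
    rw [detSolX, h1]
    have h2 : HasFDerivAt (fun y => Ψ (y, v)) ((fderiv ℝ Ψ (x, v)).comp
        (ContinuousLinearMap.inl ℝ ℝ (Fin n ⊕ Fin n → ℝ))) x :=
      HasFDerivAt.comp (g := Ψ) (f := fun y => (y, v)) x
        (hΨ.1.differentiableAt (hD v hv)).hasFDerivAt (hasFDerivAt_prodMk_left x v)
    rw [h2.hasDerivAt.deriv]
    simp
  have hG' : ∀ v ∈ mixedRegion t I n,
      detSolX c g h t x =ᶠ[𝓝 v] fun v => fderiv ℝ Ψ (x, v) (1, 0) := fun v hv =>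
    Filter.eventuallyEq_of_mem (hU.mem_nhds hv) hG
  have hdir : ∀ e : ℝ × (Fin n ⊕ Fin n → ℝ), ∀ v ∈ mixedRegion t I n,
      HasFDerivAt (fun p => fderiv ℝ Ψ p e) ((fderiv ℝ (fderiv ℝ Ψ) (x, v)).flip e) (x, v) := by
    intro e v hv
    have h1 := (hΨ.2.differentiableAt (hD v hv)).hasFDerivAt.clm_apply (hasFDerivAt_const e (x, v))
    simpa using h1
  obtain ⟨C₀, -, hC₀⟩ := hΨ.1.bdd
  obtain ⟨C₁, hC₁0, hC₁⟩ := hΨ.2.bdd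
  obtain ⟨C₂, hC₂0, hC₂⟩ := hΨ.2.bdd_fderiv
  have hb1 : ∀ e : ℝ × (Fin n ⊕ Fin n → ℝ), ‖e‖ ≤ 1 → ∀ v ∈ mixedRegion t I n,
      |fderiv ℝ Ψ (x, v) e| ≤ C₁ := fun e he v hv => by
    rw [← Real.norm_eq_abs]
    exact ((fderiv ℝ Ψ (x, v)).le_opNorm e).trans
      ((mul_le_mul (hC₁ _ (hD v hv)) he (norm_nonneg _) hC₁0).trans_eq (mul_one _))
  have hb2 : ∀ e : ℝ × (Fin n ⊕ Fin n → ℝ), ‖e‖ ≤ 1 → ∀ i, ∀ v ∈ mixedRegion t I n,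
      |pderiv (fun v => fderiv ℝ Ψ (x, v) e) i v| ≤ C₂ := fun e he i v hv => by
    rw [pderiv_section (hdir e v hv).differentiableAt, (hdir e v hv).fderiv, ← Real.norm_eq_abs,
      ContinuousLinearMap.flip_apply]
    refine ((fderiv ℝ (fderiv ℝ Ψ) (x, v)).le_opNorm₂ _ _).trans ?_
    calc ‖fderiv ℝ (fderiv ℝ Ψ) (x, v)‖ * ‖coordDir i‖ * ‖e‖ ≤ C₂ * 1 * 1 := by
          gcongr
          · exact hC₂ _ (hD v hv)
          · exact norm_coordDir_le i
      _ = C₂ := by ring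
  have he : ‖((1, 0) : ℝ × (Fin n ⊕ Fin n → ℝ))‖ ≤ 1 := by simp [Prod.norm_def]
  refine ⟨fun v hv => ?_, fun i v hv => ?_, fun v hv => ?_, ⟨max C₀ (max C₁ C₂), fun v hv => ?_⟩,
    ⟨κ, hκ, fun v hv i => ?_⟩⟩
  · exact (hasFDerivAt_section (hΨ.1.differentiableAt
      (hD v hv))).differentiableAt.congr_of_eventuallyEq (hF v hv)
  · exact (hasFDerivAt_section (hdir _ v hv).differentiableAt
      ).differentiableAt.congr_of_eventuallyEq (hpF' i v hv)
  · exact (hasFDerivAt_section (hdir _ v hv).differentiableAt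
      ).differentiableAt.congr_of_eventuallyEq (hG' v hv)
  · have e0 : C₀ ≤ max C₀ (max C₁ C₂) := by simp
    have e1 : C₁ ≤ max C₀ (max C₁ C₂) := by simp
    have e2 : C₂ ≤ max C₀ (max C₁ C₂) := by simp
    refine ⟨?_, ?_, fun i => ⟨?_, ?_, fun j => ?_⟩⟩
    · rw [hdet x v hv]; exact (hC₀ _ (hD v hv)).trans e0
    · rw [hG v hv]; exact (hb1 _ he v hv).trans e1
    · rw [hpF i v hv]; exact (hb1 _ (norm_coordDir_le i) v hv).trans e1
    · rw [pderiv_congr (hG' v hv)]; exact (hb2 _ he i v hv).trans e2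
    · rw [pderiv_congr (hpF' j v hv)]; exact (hb2 _ (norm_coordDir_le j) i v hv).trans e2
  · rw [hpF i v hv]
    exact hκb _ (hD v hv) i

end Pair

section Coefficients

variable {c : ℝ → ℝ → ℝ → ℝ} {g : ℝ → ℝ → ℝ} {h ε : ℝ} {I : Set ℝ}

lemma CoeffHyp.exists_jumpHyp (hc : CoeffHyp c g h I) (hh : 0 < h) (hI : IsOpen I)
    (hIb : Bornology.IsBounded I) (hIne : I.Nonempty) (hε : 0 < ε)
    (h_time : ∀ r ∈ Ioo 0 h, ∀ a ∈ I, ∀ y, ε ≤ |timeSens c g r a y|)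
    (h_mark : ∀ r ∈ Ioo 0 h, ∀ a ∈ I, ∀ y, ε ≤ |deriv (fun b => c r b y) a|)
    (h_flow : ∀ r ∈ Ioo 0 h, ∀ a ∈ I, ∀ y, ε ≤ |1 + deriv (fun z => c r a z) y|) :
    ∃ K, JumpHyp c g h K ε I := by
  obtain ⟨K₁, hK₁⟩ := hc.c_bdd
  obtain ⟨K₂, hK₂⟩ := hc.g_bdd
  obtain ⟨K₃, hK₃⟩ := hc.g_bdd_two
  obtain ⟨K₄, hK₄⟩ := hc.growth
  obtain ⟨a₀, ha₀⟩ := hIne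
  have hO : IsOpen (Ioo 0 h ×ˢ I ×ˢ (univ : Set ℝ)) := isOpen_Ioo.prod (hI.prod isOpen_univ)
  have hO' : IsOpen (Ioo 0 h ×ˢ (univ : Set ℝ)) := isOpen_Ioo.prod isOpen_univ
  refine ⟨max 0 (max K₂ (max K₃ K₄)), ⟨hh, le_max_left _ _, fun r hr x => ?_, fun r hr x => ?_,
    hc.g_diff_two, fun r hr x => ?_, fun r hr x => ?_⟩, hI, hIb, fun R => ?_, hε, h_time, h_mark,
    h_flow⟩
  · exact hc.g_diff.differentiableAt (hO'.mem_nhds ⟨hr, mem_univ _⟩)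
  · exact (hK₂ (r, x) ⟨hr, mem_univ _⟩).trans (by simp)
  · exact (hK₃ r hr x).trans (by simp)
  · have h1 := hK₄ r hr a₀ ha₀ x
    have h2 : K₄ ≤ max 0 (max K₂ (max K₃ K₄)) := by simp
    have h3 : K₄ * (1 + |x|) ≤ max 0 (max K₂ (max K₃ K₄)) * (1 + |x|) := by gcongr
    linarith [abs_nonneg (c r a₀ x)]
  · have hsub : ∀ p ∈ Ioo 0 h ×ˢ I ×ˢ Ioo (-R) R, p ∈ Ioo 0 h ×ˢ I ×ˢ (univ : Set ℝ) :=
      fun p hp => ⟨hp.1, hp.2.1, mem_univ _⟩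
    refine ⟨C1b.of_hasFDerivAt (C := |K₄| * (1 + |R|)) (fun p hp => (hc.c_diff.differentiableAt
      (hO.mem_nhds (hsub p hp))).hasFDerivAt) (fun p hp => ?_) (fun p hp => (hK₁ p (hsub p hp)).1),
      C1b.of_hasFDerivAt (fun p hp => (hc.c_diff_two.differentiableAt
      (hO.mem_nhds (hsub p hp))).hasFDerivAt) (fun p hp => (hK₁ p (hsub p hp)).1)
      (fun p hp => (hK₁ p (hsub p hp)).2)⟩
    have h1 := hK₄ p.1 hp.1 p.2.1 hp.2.1 p.2.2
    have h2 : |p.2.2| ≤ |R| := (abs_lt.2 hp.2.2).le.trans (le_abs_self R)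
    rw [Real.norm_eq_abs]
    calc |c p.1 p.2.1 p.2.2| ≤ K₄ * (1 + |p.2.2|) := by linarith [abs_nonneg (g p.1 p.2.2)]
      _ ≤ |K₄| * (1 + |R|) := by
        gcongr
        exact le_abs_self _

end Coefficients

/-! ### Transfer to the probability space -/

section Transfer

open scoped ENNReal

variable {Ω : Type*} [MeasurableSpace Ω] {P : Measure Ω}

lemma mixedDens_eq_prod (ρ : ℝ → ℝ) {n : ℕ} (v : Fin n ⊕ Fin n → ℝ) :
    ∏ i : Fin n, ENNReal.ofReal (Real.exp (ρ (v (Sum.inr i)))) = ENNReal.ofReal (mixedDens ρ v) := by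
  rw [mixedDens, Real.exp_sum, ENNReal.ofReal_prod_of_nonneg fun _ _ => (Real.exp_pos _).le]

lemma integrable_and_integral_comp_of_map {E : Type*} [MeasurableSpace E] {m : Measure E}
    {X : Ω → E} (hX : Measurable X) {C : ℝ≥0∞} (hC : C ≠ ∞) {p : E → ℝ} (hp0 : ∀ v, 0 ≤ p v)
    (hp : AEMeasurable p m)
    (hmap : P.map X = C • m.withDensity fun v => ENNReal.ofReal (p v)) {f : E → ℝ}
    (hf : Integrable (fun v => f v * p v) m) :
    Integrable (fun ω => f (X ω)) P ∧ ∫ ω, f (X ω) ∂P = C.toReal * ∫ v, f v * p v ∂m := by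
  have hd : AEMeasurable (fun v => ENNReal.ofReal (p v)) m := hp.ennreal_ofReal
  have htop : ∀ᵐ v ∂m, ENNReal.ofReal (p v) < ∞ :=
    Filter.Eventually.of_forall fun _ => ENNReal.ofReal_lt_top
  have he : ∀ v, (ENNReal.ofReal (p v)).toReal • f v = f v * p v := fun v => by
    rw [ENNReal.toReal_ofReal (hp0 v), smul_eq_mul, mul_comm]
  have h1 : Integrable f (m.withDensity fun v => ENNReal.ofReal (p v)) := by
    rw [integrable_withDensity_iff_integrable_smul₀' hd htop]
    simpa only [he] using hf
  have h2 : Integrable f (P.map X) := by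
    rw [hmap]; exact h1.smul_measure hC
  refine ⟨h2.comp_measurable hX, ?_⟩
  rw [← integral_map hX.aemeasurable h2.1, hmap, integral_smul_measure,
    integral_withDensity_eq_integral_toReal_smul₀ hd htop, smul_eq_mul]
  simp only [he]

end Transfer

end

end JumpIBP

theorem theorem3p1
    {Ω : Type*} [MeasurableSpace Ω] (P : Measure Ω) [IsProbabilityMeasure P]
    (μ : Measure ℝ) [IsFiniteMeasure μ] (hμ : μ ≠ 0)
    (T Δ : ℕ → Ω → ℝ) (hN : JumpIBP.IsMarkedPoisson P μ T Δ)
    (c : ℝ → ℝ → ℝ → ℝ) (g : ℝ → ℝ → ℝ)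
    (h t : ℝ) (ht0 : 0 ≤ t) (hth : t ≤ h)
    -- the mark set and the density of the amplitudes
    (k : ℕ) (q : Fin (k + 2) → ℝ) (hq : StrictMono q) (ρ : ℝ → ℝ)
    (hlaw : JumpIBP.MarkLawHyp ((μ univ)⁻¹ • μ) (JumpIBP.markSet q) ρ)
    (hcoeff : JumpIBP.CoeffHyp c g h (JumpIBP.markSet q))
    -- nondegeneracy
    (ε : ℝ) (hε : 0 < ε)
    (h_time : ∀ r ∈ Ioo 0 h, ∀ a ∈ JumpIBP.markSet q, ∀ y, ε ≤ |JumpIBP.timeSens c g r a y|)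
    (h_mark : ∀ r ∈ Ioo 0 h, ∀ a ∈ JumpIBP.markSet q, ∀ y, ε ≤ |deriv (fun b => c r b y) a|)
    (h_flow : ∀ r ∈ Ioo 0 h, ∀ a ∈ JumpIBP.markSet q, ∀ y, ε ≤ |1 + deriv (fun z => c r a z) y|)
    -- `S y r ω` is the solution of the jump equation started at `y`, at time `r`
    (S : ℝ → ℝ → Ω → ℝ)
    (hS : ∀ᵐ ω ∂P, ∀ y, JumpIBP.IsJumpPath c g h y (fun r => JumpIBP.jumpCount T r ω)
      (fun i => T i ω) (fun i => Δ i ω) (fun r => S y r ω))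
    (α : ℝ) (hα : α ∈ Ioo (0 : ℝ) (1 / 2))
    (x : ℝ) (n : ℕ) (hn : 1 ≤ n)
    (φ : ℝ → ℝ) (hφ : ContDiff ℝ 1 φ) (hφ_growth : ∃ K : ℝ, ∀ y, |φ y| ≤ K * (1 + |y|)) :
    IntegrableOn (fun ω => deriv φ (S x t ω) * deriv (fun y => S y t ω) x)
        {ω | JumpIBP.jumpCount T t ω = n} P ∧
      IntegrableOn (fun ω => φ (S x t ω)
          * JumpIBP.mixedH c g h t α q ρ x n (JumpIBP.noiseVector T Δ n ω))
        {ω | JumpIBP.jumpCount T t ω = n} P ∧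
      ∫ ω in {ω | JumpIBP.jumpCount T t ω = n},
          deriv φ (S x t ω) * deriv (fun y => S y t ω) x ∂P
        = ∫ ω in {ω | JumpIBP.jumpCount T t ω = n},
          φ (S x t ω) * JumpIBP.mixedH c g h t α q ρ x n (JumpIBP.noiseVector T Δ n ω) ∂P := by
  have hl : 0 < μ.real univ := by
    rw [Measure.real, ENNReal.toReal_pos_iff]
    exact ⟨by simpa [pos_iff_ne_zero] using hμ, measure_lt_top _ _⟩
  have hmono := hN.ae_strictMono hl
  rcases ht0.eq_or_lt with rfl | ht
  · have hnull : P.restrict {ω | JumpIBP.jumpCount T 0 ω = n} = 0 := by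
      rw [Measure.restrict_eq_zero, measure_eq_zero_iff_ae_notMem]
      filter_upwards [hmono] with ω hω hJ
      have h1 := ((JumpIBP.jumpCount_eq_iff hω hn).1 hJ).1
      have h2 : T 0 ω < T n ω := hω (by omega)
      rw [hN.time_zero] at h2
      linarith
    simp [IntegrableOn, hnull]
  have hI := JumpIBP.isOpen_markSet q
  obtain ⟨K, hJ⟩ := hcoeff.exists_jumpHyp (ht.trans_le hth) hI (JumpIBP.isBounded_markSet q)
    (JumpIBP.nonempty_markSet hq) hε h_time h_mark h_flow
  have hw := JumpIBP.weightedRegion_mixedRegion hα hq hlaw t n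
  have hF := JumpIBP.nondegPair_detSol hJ x ht hth n
  have : Nonempty (Fin n ⊕ Fin n) := ⟨Sum.inl ⟨0, hn⟩⟩
  obtain ⟨h1, h2, h3⟩ := JumpIBP.integral_by_parts hw hF hφ
  obtain ⟨C, hC, hmap⟩ := hN.map_noiseVector hμ hI hlaw t hn
  simp only [JumpIBP.mixedDens_eq_prod] at hmap
  have hnm : Measurable (JumpIBP.noiseVector T Δ n) := by
    refine measurable_pi_lambda _ ?_
    rintro (i | i)
    · exact hN.measurable_time _
    · exact hN.measurable_mark _
  have hpm : AEMeasurable (JumpIBP.mixedDens ρ)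
      (volume.restrict (JumpIBP.mixedRegion t (JumpIBP.markSet q) n)) :=
    (JumpIBP.aestronglyMeasurable_of_differentiableAt hw.isOpen hw.dens_diff).aemeasurable
  have hp0 : ∀ v : Fin n ⊕ Fin n → ℝ, 0 ≤ JumpIBP.mixedDens ρ v := fun v => (Real.exp_pos _).le
  obtain ⟨i1, e1⟩ := JumpIBP.integrable_and_integral_comp_of_map hnm hC hp0 hpm hmap h1
  obtain ⟨i2, e2⟩ := JumpIBP.integrable_and_integral_comp_of_map hnm hC hp0 hpm hmap h2
  have hmem : ∀ᵐ ω ∂(P.restrict {ω | JumpIBP.jumpCount T t ω = n}),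
      JumpIBP.noiseVector T Δ n ω ∈ JumpIBP.mixedRegion t (JumpIBP.markSet q) n := by
    refine ae_of_ae_map hnm.aemeasurable ?_
    rw [hmap]
    refine Measure.ae_smul_measure ?_ C
    exact (withDensity_absolutelyContinuous _ _).ae_le (ae_restrict_mem hw.isOpen.measurableSet)
  have hset : MeasurableSet {ω | T n ω ≤ t ∧ t < T (n + 1) ω} :=
    (measurableSet_le (hN.measurable_time n) measurable_const).inter
      (measurableSet_lt measurable_const (hN.measurable_time _))
  have hJset : {ω | JumpIBP.jumpCount T t ω = n} =ᵐ[P] {ω | T n ω ≤ t ∧ t < T (n + 1) ω} := by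
    filter_upwards [hmono] with ω hω
    exact propext (JumpIBP.jumpCount_eq_iff hω hn)
  have hlt : ∀ᵐ ω ∂(P.restrict {ω | JumpIBP.jumpCount T t ω = n}), t < T (n + 1) ω := by
    rw [Measure.restrict_congr_set hJset]
    filter_upwards [ae_restrict_mem hset] with ω hω using hω.2
  have hsol : ∀ᵐ ω ∂(P.restrict {ω | JumpIBP.jumpCount T t ω = n}), ∀ y,
      S y t ω = JumpIBP.detSol c g h t y (JumpIBP.noiseVector T Δ n ω) := by
    filter_upwards [hmem, hlt, ae_restrict_of_ae hS, ae_restrict_of_ae hmono] with ω hω hωt hSω hωm y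
    exact (hSω y).eq_detSol hJ.drift_hyp ht hth (hN.time_zero ω) hωm hωt hω
  have c1 : (fun ω => deriv φ (JumpIBP.detSol c g h t x (JumpIBP.noiseVector T Δ n ω))
      * JumpIBP.detSolX c g h t x (JumpIBP.noiseVector T Δ n ω))
      =ᵐ[P.restrict {ω | JumpIBP.jumpCount T t ω = n}]
      fun ω => deriv φ (S x t ω) * deriv (fun y => S y t ω) x := by
    filter_upwards [hsol] with ω hω
    simp only [hω]
    rfl
  have c2 : (fun ω => φ (JumpIBP.detSol c g h t x (JumpIBP.noiseVector T Δ n ω))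
      * JumpIBP.malliavinWeight (JumpIBP.mixedWeight α t q) (JumpIBP.mixedScore ρ)
        (JumpIBP.detSol c g h t x) (JumpIBP.detSolX c g h t x) (JumpIBP.noiseVector T Δ n ω))
      =ᵐ[P.restrict {ω | JumpIBP.jumpCount T t ω = n}]
      fun ω => φ (S x t ω)
        * JumpIBP.mixedH c g h t α q ρ x n (JumpIBP.noiseVector T Δ n ω) := by
    filter_upwards [hsol] with ω hω
    simp only [hω]
    rfl
  refine ⟨i1.congr c1, i2.congr c2, ?_⟩
  rw [← integral_congr_ae c1, ← integral_congr_ae c2, e1, e2, h3]
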